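/- Let $X$ be a smooth $n$-manifold, $Y\subset X$ a closed submanifold of even codimension $m=2r\le n$, and $\mu\colon X\to\mathbb R_{\ge 0}$ a nonnegative Morse--Bott function with zero set $Y$, that is, a smooth function with $\mu\ge 0$, $\mu^{-1}(0)=Y$, whose Hessian has rank $m$ at every point of $Y$. Let $j\colon X\smallsetminus Y\to X$ be the inclusion, let $\mathcal A$ denote complexes of sheaves of (real- or complex-valued) smooth differential forms with the de Rham differential $d$, and regard $\mathcal A_X$ as the subcomplex of $j_*\mathcal A_{X\smallsetminus Y}$ of forms that extend smoothly across $Y$. Put $$\mathcal A_{X,\mu}=\bigcup_{N\ge 0}\{\omega\in j_*\mathcal A_{X\smallsetminus Y}:\ \mu^N\omega\in\mathcal A_X\}$$ (union of subsheaves, so that the exponent $N$ is only required to exist locally), and let $$F_r\mathcal A_{X,\mu}=\{\omega\in\mathcal A_{X,\mu}:\ \mu^{r}\omega\in\mathcal A_X,\ \mu^{r-1}d\mu\wedge\omega\in\mathcal A_X\}$$ be the subsheaf of forms with tame singularities. Then: 1. $d$ maps $F_r\mathcal A_{X,\mu}$ to itself, so that $F_r\mathcal A_{X,\mu}$ is a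 subcomplex of $\mathcal A_{X,\mu}$, and the inclusion $F_r\mathcal A_{X,\mu}\hookrightarrow\mathcal A_{X,\mu}$ is a quasi-isomorphism of complexes of sheaves on $X$. 2. (Local form.) Let $B\subset\mathbb R^n$ be an open ball centered at the origin, $\mu=x_1^2+\dots+x_{2r}^2$ with $2r\le n$, and $Y=\mu^{-1}(0)\cap B$. Let $\mathcal A_\mu(B)$ be the complex of smooth forms $\omega$ on $B\smallsetminus Y$ such that $\mu^N\omega$ extends to a smooth form on $B$ for some $N$, and $F_r\mathcal A_\mu(B)$ the subspace of those $\omega$ for which $\mu^r\omega$ and $\mu^{r-1}d\mu\wedge\omega$ extend to smooth forms on $B$. Then $F_r\mathcal A_\mu(B)$ is a subcomplex and the inclusion $F_r\mathcal A_\mu(B)\hookrightarrow\mathcal A_\mu(B)$ is a quasi-isomorphism. -/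

import Mathlib

set_option linter.unusedSectionVars false

open Set Filter Topology
open scoped Manifold ContDiff

noncomputable section

namespace TameForms

section Forms

variable {E : Type} [NormedAddCommGroup E] [NormedSpace ℝ E]
  {X : Type*} [TopologicalSpace X] [ChartedSpace E X]
  {𝕜 : Type} [RCLike 𝕜] {k : ℕ}

/-- The derivative of the inverse of a chart `e` at a point `y` of its target. -/
def chartSymmDeriv (e : OpenPartialHomeomorph X E) (y : E) : E →L[ℝ] E :=
  mfderiv 𝓘(ℝ, E) 𝓘(ℝ, E) e.symm y

/-- The derivative of a chart `e` at a point `x` of its source. -/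
def chartDeriv (e : OpenPartialHomeomorph X E) (x : X) : E →L[ℝ] E :=
  mfderiv 𝓘(ℝ, E) 𝓘(ℝ, E) e x

/-- The differential `df_x` of a real function `f` at `x`. -/
def dFun (f : X → ℝ) (x : X) : E →L[ℝ] ℝ :=
  mfderiv 𝓘(ℝ, E) 𝓘(ℝ, ℝ) f x

/-- The expression of a `k`-form `α` in a chart `e`: the pull-back of `α` under `e⁻¹`.
The tangent space `TangentSpace 𝓘(ℝ, E) x` at a point `x` of a manifold modelled on `E` is `E` by
definition in Mathlib, so that a (not necessarily smooth) `k`-form is a function on `X` with values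
in the alternating forms on `E`. -/
def chartRep (e : OpenPartialHomeomorph X E) (α : X → E [⋀^Fin k]→L[ℝ] 𝕜) (y : E) :
    E [⋀^Fin k]→L[ℝ] 𝕜 :=
  (α (e.symm y)).compContinuousLinearMap (chartSymmDeriv e y)

/-- `α` is a smooth form on the set `S` (used for open `S`): its expressions in all charts of the
atlas are smooth. -/
def SmoothOn (α : X → E [⋀^Fin k]→L[ℝ] 𝕜) (S : Set X) : Prop :=
  ∀ e ∈ atlas E X, ContDiffOn ℝ ∞ (chartRep e α) (e.target ∩ e.symm ⁻¹' S)

/-- The de Rham differential: at `x` it is the pull-back under the preferred chart at `x` of the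
exterior derivative of the chart expression of `α`. -/
def extD (α : X → E [⋀^Fin k]→L[ℝ] 𝕜) (x : X) : E [⋀^Fin (k + 1)]→L[ℝ] 𝕜 :=
  (extDeriv (chartRep (chartAt E x) α) (chartAt E x x)).compContinuousLinearMap
    (chartDeriv (chartAt E x) x)

/-- The form `df ∧ α`, that is,
`(df ∧ α)_x (v₀, …, v_k) = ∑ i, (-1) ^ i * df_x(v_i) * α_x (v₀, …, v̂_i, …, v_k)`. -/
def dWedge (f : X → ℝ) (α : X → E [⋀^Fin k]→L[ℝ] 𝕜) (x : X) : E [⋀^Fin (k + 1)]→L[ℝ] 𝕜 :=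
  .alternatizeUncurryFin
    ((dFun f x).smulRight (α x))

lemma chartRep_add (e : OpenPartialHomeomorph X E) (α η : X → E [⋀^Fin k]→L[ℝ] 𝕜) :
    chartRep e (α + η) = chartRep e α + chartRep e η := by
  ext y v; simp [chartRep]

lemma chartRep_smul (e : OpenPartialHomeomorph X E) (c : 𝕜) (α : X → E [⋀^Fin k]→L[ℝ] 𝕜) :
    chartRep e (c • α) = c • chartRep e α := by
  ext y v; simp [chartRep]

lemma chartRep_zero (e : OpenPartialHomeomorph X E) :
    chartRep e (0 : X → E [⋀^Fin k]→L[ℝ] 𝕜) = 0 := by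
  ext y v; simp [chartRep]

lemma SmoothOn.add {α η : X → E [⋀^Fin k]→L[ℝ] 𝕜} {S : Set X} (hα : SmoothOn α S)
    (hη : SmoothOn η S) : SmoothOn (α + η) S := fun e he => by
  rw [chartRep_add]; exact (hα e he).add (hη e he)

lemma SmoothOn.smul {α : X → E [⋀^Fin k]→L[ℝ] 𝕜} {S : Set X} (hα : SmoothOn α S) (c : 𝕜) :
    SmoothOn (c • α) S := fun e he => by
  rw [chartRep_smul]; exact (hα e he).const_smul c

lemma SmoothOn.zero (S : Set X) : SmoothOn (0 : X → E [⋀^Fin k]→L[ℝ] 𝕜) S := fun e he => by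
  rw [chartRep_zero]; exact contDiffOn_const

lemma SmoothOn.mono {α : X → E [⋀^Fin k]→L[ℝ] 𝕜} {S T : Set X} (hα : SmoothOn α T) (h : S ⊆ T) :
    SmoothOn α S := fun e he =>
  (hα e he).mono (inter_subset_inter_right _ (preimage_mono h))

lemma isOpen_chart_set (e : OpenPartialHomeomorph X E) {S : Set X} (hS : IsOpen S) :
    IsOpen (e.target ∩ e.symm ⁻¹' S) :=
  e.symm.isOpen_inter_preimage hS

lemma SmoothOn.congr {α η : X → E [⋀^Fin k]→L[ℝ] 𝕜} {S : Set X} (hα : SmoothOn α S)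
    (h : ∀ x ∈ S, η x = α x) : SmoothOn η S := fun e he =>
  (hα e he).congr fun y hy => by simp only [chartRep]; rw [h _ hy.2]

lemma SmoothOn.of_locally {α : X → E [⋀^Fin k]→L[ℝ] 𝕜} {S : Set X}
    (h : ∀ x ∈ S, ∃ W, IsOpen W ∧ x ∈ W ∧ SmoothOn α W) : SmoothOn α S := by
  intro e he y hy
  obtain ⟨W, hW, hyW, hs⟩ := h _ hy.2
  exact ((hs e he).contDiffAt ((isOpen_chart_set e hW).mem_nhds ⟨hy.1, hyW⟩)).contDiffWithinAt

lemma extD_congr {α η : X → E [⋀^Fin k]→L[ℝ] 𝕜} {S : Set X} (hS : IsOpen S)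
    (h : ∀ x ∈ S, η x = α x) {x : X} (hx : x ∈ S) : extD η x = extD α x := by
  have : chartRep (chartAt E x) η =ᶠ[𝓝 (chartAt E x x)] chartRep (chartAt E x) α := by
    filter_upwards [(isOpen_chart_set (chartAt E x) hS).mem_nhds
      ⟨mem_chart_target E x, by simpa using hx⟩] with y hy
    simp only [chartRep]; rw [h _ hy.2]
  simp only [extD]; rw [this.extDeriv_eq]

variable [IsManifold 𝓘(ℝ, E) ∞ X]

lemma two_le_infty : minSmoothness ℝ 2 ≤ (∞ : WithTop ℕ∞) := by
  rw [minSmoothness_of_isRCLikeNormedField]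
  exact WithTop.coe_le_coe.2 le_top

section transition
variable {e e' : OpenPartialHomeomorph X E}


lemma mem_max (he : e ∈ atlas E X) : e ∈ IsManifold.maximalAtlas 𝓘(ℝ, E) ∞ X :=
  IsManifold.subset_maximalAtlas he

lemma contDiffAt_transition (he : e ∈ atlas E X) (he' : e' ∈ atlas E X) {y : E}
    (hy : y ∈ e.target) (hy' : e.symm y ∈ e'.source) :
    ContDiffAt ℝ ∞ (e' ∘ e.symm) y := by
  rw [← contMDiffAt_iff_contDiffAt]
  exact (contMDiffAt_of_mem_maximalAtlas (mem_max he') hy').comp y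
    (contMDiffAt_symm_of_mem_maximalAtlas (mem_max he) hy)

lemma chartRep_transition (he : e ∈ atlas E X) (he' : e' ∈ atlas E X)
    (α : X → E [⋀^Fin k]→L[ℝ] 𝕜) {y : E} (hy : y ∈ e.target) (hy' : e.symm y ∈ e'.source) :
    chartRep e α =ᶠ[𝓝 y] fun z => (chartRep e' α ((e' ∘ e.symm) z)).compContinuousLinearMap
      (fderiv ℝ (e' ∘ e.symm) z) := by
  have hO : IsOpen (e.target ∩ e.symm ⁻¹' e'.source) := isOpen_chart_set e e'.open_source
  filter_upwards [hO.mem_nhds ⟨hy, hy'⟩] with z hz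
  have hlin : chartSymmDeriv e z =
      chartSymmDeriv e' ((e' ∘ e.symm) z) ∘L
        fderiv ℝ (e' ∘ e.symm) z := by
    have h1 : MDifferentiableAt 𝓘(ℝ, E) 𝓘(ℝ, E) e'.symm ((e' ∘ e.symm) z) :=
      (contMDiffAt_symm_of_mem_maximalAtlas (mem_max he') (e'.map_source hz.2)).mdifferentiableAt
        (by simp)
    have h2 : MDifferentiableAt 𝓘(ℝ, E) 𝓘(ℝ, E) (e' ∘ e.symm) z :=
      ((contDiffAt_transition he he' hz.1 hz.2).differentiableAt (by simp)).mdifferentiableAt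
    have h3 : mfderiv 𝓘(ℝ, E) 𝓘(ℝ, E) (e'.symm ∘ (e' ∘ e.symm)) z =
        chartSymmDeriv e' ((e' ∘ e.symm) z) ∘L fderiv ℝ (e' ∘ e.symm) z := by
      rw [← mfderiv_eq_fderiv]; exact mfderiv_comp z h1 h2
    refine Eq.trans ?_ h3
    refine Filter.EventuallyEq.mfderiv_eq ?_
    filter_upwards [hO.mem_nhds hz] with w hw
    exact (e'.left_inv hw.2).symm
  have hpt : e'.symm ((e' ∘ e.symm) z) = e.symm z := e'.left_inv hz.2
  ext v
  simp only [chartRep]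
  rw [hlin, hpt]
  rfl

lemma extD_chartRep {S : Set X} (hS : IsOpen S) {α : X → E [⋀^Fin k]→L[ℝ] 𝕜} (hα : SmoothOn α S)
    (he : e ∈ atlas E X) {y : E} (hy : y ∈ e.target) (hyS : e.symm y ∈ S) :
    chartRep e (extD α) y = extDeriv (chartRep e α) y := by
  set x := e.symm y with hx
  set e' := chartAt E x with he'
  have he'a : e' ∈ atlas E X := chart_mem_atlas E x
  have hxs : x ∈ e'.source := mem_chart_source E x
  have hφ := contDiffAt_transition he he'a hy hxs
  rw [(chartRep_transition he he'a α hy hxs).extDeriv_eq]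
  have hd : DifferentiableAt ℝ (chartRep e' α) ((e' ∘ e.symm) y) :=
    ((hα e' he'a).contDiffAt ((isOpen_chart_set e' hS).mem_nhds
      ⟨e'.map_source hxs, by
        change e'.symm (e' x) ∈ S
        rwa [e'.left_inv hxs]⟩)).differentiableAt (by simp)
  rw [extDeriv_pullback (r := ∞) hd hφ two_le_infty]
  have h1 : MDifferentiableAt 𝓘(ℝ, E) 𝓘(ℝ, E) e' (e.symm y) :=
    (contMDiffAt_of_mem_maximalAtlas (mem_max he'a) hxs).mdifferentiableAt (by simp)
  have h2 : MDifferentiableAt 𝓘(ℝ, E) 𝓘(ℝ, E) e.symm y :=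
    (contMDiffAt_symm_of_mem_maximalAtlas (mem_max he) hy).mdifferentiableAt (by simp)
  have h3 : fderiv ℝ (e' ∘ e.symm) y = chartDeriv e' x ∘L chartSymmDeriv e y := by
    rw [← mfderiv_eq_fderiv]; exact mfderiv_comp y h1 h2
  rw [h3]
  rfl

end transition

lemma SmoothOn.extD {S : Set X} (hS : IsOpen S) {α : X → E [⋀^Fin k]→L[ℝ] 𝕜}
    (hα : SmoothOn α S) : SmoothOn (extD α) S := by
  intro e he
  have h : ContDiffOn ℝ ∞ (extDeriv (chartRep e α)) (e.target ∩ e.symm ⁻¹' S) := by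
    have := (hα e he).fderiv_of_isOpen (m := ∞) (isOpen_chart_set e hS) (by simp)
    exact (ContinuousAlternatingMap.alternatizeUncurryFinCLM ℝ E 𝕜).contDiff.comp_contDiffOn this
  exact h.congr fun y hy => extD_chartRep hS hα he hy.1 hy.2

lemma SmoothOn.differentiableAt {S : Set X} (hS : IsOpen S) {α : X → E [⋀^Fin k]→L[ℝ] 𝕜}
    (hα : SmoothOn α S) {x : X} (hx : x ∈ S) :
    DifferentiableAt ℝ (chartRep (chartAt E x) α) (chartAt E x x) :=
  ((hα _ (chart_mem_atlas E x)).contDiffAt ((isOpen_chart_set _ hS).mem_nhds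
      ⟨mem_chart_target E x, by simpa using hx⟩)).differentiableAt (by simp)

lemma extD_add {S : Set X} (hS : IsOpen S) {α η : X → E [⋀^Fin k]→L[ℝ] 𝕜}
    (hα : SmoothOn α S) (hη : SmoothOn η S) {x : X} (hx : x ∈ S) :
    TameForms.extD (α + η) x = TameForms.extD α x + TameForms.extD η x := by
  simp only [TameForms.extD]
  rw [chartRep_add, extDeriv_add (hα.differentiableAt hS hx) (hη.differentiableAt hS hx)]
  ext v; simp

lemma extD_smul {S : Set X} (hS : IsOpen S) {α : X → E [⋀^Fin k]→L[ℝ] 𝕜}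
    (hα : SmoothOn α S) (c : 𝕜) {x : X} (hx : x ∈ S) :
    TameForms.extD (c • α) x = c • TameForms.extD α x := by
  simp only [TameForms.extD]
  rw [chartRep_smul, extDeriv, fderiv_const_smul (hα.differentiableAt hS hx),
    ContinuousAlternatingMap.alternatizeUncurryFin_smul]
  ext v; simp [extDeriv]

lemma extD_extD {S : Set X} (hS : IsOpen S) {α : X → E [⋀^Fin k]→L[ℝ] 𝕜}
    (hα : SmoothOn α S) {x : X} (hx : x ∈ S) :
    TameForms.extD (TameForms.extD α) x = 0 := by
  have he := chart_mem_atlas E x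
  have hxS : (chartAt E x).symm (chartAt E x x) ∈ S := by simpa using hx
  have hN := (isOpen_chart_set (chartAt E x) hS).mem_nhds ⟨mem_chart_target E x, hxS⟩
  have h : chartRep (chartAt E x) (TameForms.extD α) =ᶠ[𝓝 (chartAt E x x)]
      extDeriv (chartRep (chartAt E x) α) := by
    filter_upwards [hN] with y hy using extD_chartRep hS hα he hy.1 hy.2
  rw [TameForms.extD, h.extDeriv_eq,
    extDeriv_extDeriv_apply (r := ∞) ((hα _ he).contDiffAt hN) two_le_infty]
  ext v; simp

lemma chartRep_dWedge {f : X → ℝ} (hf : ContMDiff 𝓘(ℝ, E) 𝓘(ℝ, ℝ) ∞ f)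
    (α : X → E [⋀^Fin k]→L[ℝ] 𝕜) {e : OpenPartialHomeomorph X E} (he : e ∈ atlas E X) {y : E}
    (hy : y ∈ e.target) :
    chartRep e (dWedge f α) y = .alternatizeUncurryFin
      ((fderiv ℝ (f ∘ e.symm) y).smulRight (chartRep e α y)) := by
  have h1 : MDifferentiableAt 𝓘(ℝ, E) 𝓘(ℝ, ℝ) f (e.symm y) :=
    (hf _).mdifferentiableAt (by simp)
  have h2 : MDifferentiableAt 𝓘(ℝ, E) 𝓘(ℝ, E) e.symm y :=
    (contMDiffAt_symm_of_mem_maximalAtlas (mem_max he) hy).mdifferentiableAt (by simp)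
  have h3 : fderiv ℝ (f ∘ e.symm) y = dFun f (e.symm y) ∘L chartSymmDeriv e y := by
    rw [← mfderiv_eq_fderiv]; exact mfderiv_comp y h1 h2
  rw [h3]
  ext v
  simp +unfoldPartialApp [chartRep, dWedge, ContinuousAlternatingMap.alternatizeUncurryFin_apply,
    Function.comp_def, Fin.removeNth]

lemma contDiffOn_comp_symm {f : X → ℝ} (hf : ContMDiff 𝓘(ℝ, E) 𝓘(ℝ, ℝ) ∞ f)
    {e : OpenPartialHomeomorph X E} (he : e ∈ atlas E X) :
    ContDiffOn ℝ ∞ (f ∘ e.symm) e.target := by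
  rw [← contMDiffOn_iff_contDiffOn]
  exact hf.comp_contMDiffOn (contMDiffOn_symm_of_mem_maximalAtlas (mem_max he))

lemma SmoothOn.dWedge {f : X → ℝ} (hf : ContMDiff 𝓘(ℝ, E) 𝓘(ℝ, ℝ) ∞ f) {S : Set X}
    {α : X → E [⋀^Fin k]→L[ℝ] 𝕜} (hα : SmoothOn α S) :
    SmoothOn (dWedge f α) S := by
  intro e he
  have h1 : ContDiffOn ℝ ∞ (fderiv ℝ (f ∘ e.symm)) (e.target ∩ e.symm ⁻¹' S) :=
    ((contDiffOn_comp_symm hf he).fderiv_of_isOpen (m := ∞) e.open_target (by simp)).mono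
      inter_subset_left
  have h3 : ContDiff ℝ ∞ (ContinuousAlternatingMap.alternatizeUncurryFinCLM (n := k) ℝ E 𝕜) :=
    ContinuousLinearMap.contDiff _
  have h2 := h3.comp_contDiffOn (h1.smulRight (hα e he))
  exact h2.congr fun y hy => chartRep_dWedge hf α he hy.1

lemma SmoothOn.smul_fun {f : X → ℝ} (hf : ContMDiff 𝓘(ℝ, E) 𝓘(ℝ, ℝ) ∞ f) {S : Set X}
    {α : X → E [⋀^Fin k]→L[ℝ] 𝕜} (hα : SmoothOn α S) :
    SmoothOn (fun x => f x • α x) S := by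
  intro e he
  refine (((contDiffOn_comp_symm hf he).mono inter_subset_left).smul (hα e he)).congr ?_
  intro y hy
  ext v; simp [chartRep]

lemma dFun_eq {f : X → ℝ} (hf : ContMDiff 𝓘(ℝ, E) 𝓘(ℝ, ℝ) ∞ f)
    {e : OpenPartialHomeomorph X E} (he : e ∈ atlas E X) {x : X} (hxs : x ∈ e.source) :
    DifferentiableAt ℝ (f ∘ e.symm) (e x) ∧
      dFun f x = fderiv ℝ (f ∘ e.symm) (e x) ∘L chartDeriv e x := by
  have hxt := e.map_source hxs
  have hf' : DifferentiableAt ℝ (f ∘ e.symm) (e x) :=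
    ((contDiffOn_comp_symm hf he).contDiffAt
      (e.open_target.mem_nhds hxt)).differentiableAt (by simp)
  have h1 : MDifferentiableAt 𝓘(ℝ, E) 𝓘(ℝ, E) e x :=
    (contMDiffAt_of_mem_maximalAtlas (mem_max he) hxs).mdifferentiableAt (by simp)
  have h3 : mfderiv 𝓘(ℝ, E) 𝓘(ℝ, ℝ) ((f ∘ e.symm) ∘ e) x =
      fderiv ℝ (f ∘ e.symm) (e x) ∘L chartDeriv e x := by
    rw [← mfderiv_eq_fderiv]; exact mfderiv_comp x hf'.mdifferentiableAt h1
  refine ⟨hf', Eq.trans (Filter.EventuallyEq.mfderiv_eq ?_) h3⟩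
  filter_upwards [e.open_source.mem_nhds hxs] with w hw
  simp [e.left_inv hw]

lemma dFun_pow {f : X → ℝ} (hf : ContMDiff 𝓘(ℝ, E) 𝓘(ℝ, ℝ) ∞ f) (N : ℕ) (x : X) :
    f x • dFun (E := E) (fun z => f z ^ N) x = ((N : ℝ) * f x ^ N) • dFun (E := E) f x := by
  obtain ⟨hd, h⟩ := dFun_eq hf (chart_mem_atlas E x) (mem_chart_source E x)
  have hfN : ContMDiff 𝓘(ℝ, E) 𝓘(ℝ, ℝ) ∞ (fun z => f z ^ N) := hf.pow N
  obtain ⟨-, hN⟩ := dFun_eq hfN (chart_mem_atlas E x) (mem_chart_source E x)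
  have hc : (fun z => f z ^ N) ∘ (chartAt E x).symm
      = fun y => (f ∘ (chartAt E x).symm) y ^ N := rfl
  rw [h, hN, hc, fderiv_fun_pow N hd]
  ext v
  rcases N with _ | N
  · simp
  · simp [pow_succ]
    ring

lemma extD_smul_fun {f : X → ℝ} (hf : ContMDiff 𝓘(ℝ, E) 𝓘(ℝ, ℝ) ∞ f) {S : Set X} (hS : IsOpen S)
    {α : X → E [⋀^Fin k]→L[ℝ] 𝕜} (hα : SmoothOn α S) {x : X} (hx : x ∈ S) :
    TameForms.extD (fun z => f z • α z) x
      = f x • TameForms.extD α x + TameForms.dWedge f α x := by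
  have hα' := hα.differentiableAt hS hx
  unfold TameForms.extD
  have he := chart_mem_atlas E x
  have hxs := mem_chart_source E x
  generalize chartAt E x = e at *
  have hxt := e.map_source hxs
  obtain ⟨hf', hid⟩ := dFun_eq hf he hxs
  have h0 : chartRep e (fun z => f z • α z) = fun y => (f ∘ e.symm) y • chartRep e α y := by
    ext y v; simp [chartRep]
  have h1 : MDifferentiableAt 𝓘(ℝ, E) 𝓘(ℝ, E) e x :=
    (contMDiffAt_of_mem_maximalAtlas (mem_max he) hxs).mdifferentiableAt (by simp)
  have h2 : MDifferentiableAt 𝓘(ℝ, E) 𝓘(ℝ, E) e.symm (e x) :=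
    (contMDiffAt_symm_of_mem_maximalAtlas (mem_max he) hxt).mdifferentiableAt (by simp)
  have hid1 : chartSymmDeriv e (e x) ∘L chartDeriv e x = ContinuousLinearMap.id ℝ E := by
    have h3 : mfderiv 𝓘(ℝ, E) 𝓘(ℝ, E) (e.symm ∘ e) x =
        chartSymmDeriv e (e x) ∘L chartDeriv e x := mfderiv_comp x h2 h1
    rw [← h3]
    refine Eq.trans (Filter.EventuallyEq.mfderiv_eq (f := id) ?_) mfderiv_id
    filter_upwards [e.open_source.mem_nhds hxs] with w hw
    exact e.left_inv hw
  have hid2 : (chartRep e α (e x)).compContinuousLinearMap (chartDeriv e x) = α x := by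
    ext v
    have hv : ∀ u, chartSymmDeriv e (e x) (chartDeriv e x u) = u := fun u =>
      DFunLike.congr_fun hid1 u
    simp [chartRep, Function.comp_def, hv, e.left_inv hxs]
  rw [h0, extDeriv, fderiv_fun_smul hf' hα', ContinuousAlternatingMap.alternatizeUncurryFin_add]
  ext v
  conv_rhs => rw [TameForms.dWedge, hid, ← hid2]
  simp +unfoldPartialApp [extDeriv, ContinuousAlternatingMap.alternatizeUncurryFin_apply,
    Function.comp_def, Fin.removeNth, e.left_inv hxs]

end Forms


section Complexes

open TopologicalSpace CategoryTheory Opposite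

universe u

variable {E : Type} [NormedAddCommGroup E] [NormedSpace ℝ E]
  {X : Type u} [TopologicalSpace X] [ChartedSpace E X]
  (𝕜 : Type) [RCLike 𝕜]

/-- Not necessarily smooth `k`-forms on `V ∩ U`; these are the raw sections over `V` of `j_*` of
the sheaf of forms on `U`, for the inclusion `j : U → X`. -/
abbrev Sec (E : Type) [NormedAddCommGroup E] [NormedSpace ℝ E] (U : Opens X) (k : ℕ)
    (V : Opens X) : Type u :=
  (V ⊓ U : Opens X) → E [⋀^Fin k]→L[ℝ] 𝕜

variable {𝕜} {U : Opens X} {k : ℕ}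

open Classical in
/-- Extension of a form by zero from `V ∩ U` to `X`. -/
def extZero {V : Opens X} (α : Sec 𝕜 E U k V) (x : X) : E [⋀^Fin k]→L[ℝ] 𝕜 :=
  if h : x ∈ V ⊓ U then α ⟨x, h⟩ else 0

/-- Restriction of forms from `W ∩ U` to `V ∩ U` for `V ⊆ W`. -/
def restrict {V W : Opens X} (h : V ≤ W) : Sec 𝕜 E U k W →ₗ[𝕜] Sec 𝕜 E U k V where
  toFun α x := α ⟨x.1, h x.2.1, x.2.2⟩
  map_add' _ _ := rfl
  map_smul' _ _ := rfl

/-- The de Rham differential of a form on `V ∩ U`. -/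
def dSec {V : Opens X} (α : Sec 𝕜 E U k V) : Sec 𝕜 E U (k + 1) V :=
  fun x => extD (extZero α) x

lemma extZero_apply {V : Opens X} (α : Sec 𝕜 E U k V) {x : X} (h : x ∈ V ⊓ U) :
    extZero α x = α ⟨x, h⟩ := dif_pos h

lemma extZero_add {V : Opens X} (α β : Sec 𝕜 E U k V) :
    extZero (α + β) = extZero α + extZero β := by
  ext1 x; by_cases h : x ∈ V ⊓ U <;> simp [extZero, h]

lemma extZero_smul {V : Opens X} (c : 𝕜) (α : Sec 𝕜 E U k V) :
    extZero (c • α) = c • extZero α := by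
  ext1 x
  by_cases h : x ∈ V ⊓ U
  · simp [extZero, h]
  · simp only [extZero, h, Pi.smul_apply, dif_neg, not_false_iff]
    ext v
    simp

lemma extZero_zero {V : Opens X} : extZero (0 : Sec 𝕜 E U k V) = 0 := by
  ext1 x; by_cases h : x ∈ V ⊓ U <;> simp [extZero, h]

lemma extZero_restrict {V W : Opens X} (h : V ≤ W) (α : Sec 𝕜 E U k W) {x : X} (hx : x ∈ V) :
    extZero (restrict h α) x = extZero α x := by
  by_cases hU : x ∈ U
  · rw [extZero_apply _ ⟨hx, hU⟩, extZero_apply _ ⟨h hx, hU⟩]; rfl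
  · simp [extZero, hU]

lemma extZero_dSec {V : Opens X} (α : Sec 𝕜 E U k V) {x : X} (h : x ∈ V ⊓ U) :
    extZero (dSec α) x = extD (extZero α) x := by
  rw [extZero_apply _ h]; rfl

lemma dSec_restrict {V W : Opens X} (h : V ≤ W) (α : Sec 𝕜 E U k W) :
    dSec (restrict h α) = restrict h (dSec α) := by
  ext1 x
  exact extD_congr (S := (V : Set X)) V.isOpen (fun z hz => extZero_restrict h α hz) x.2.1

variable [IsManifold 𝓘(ℝ, E) ∞ X]

variable (𝕜 E U) in
/-- A presheaf of subcomplexes of the de Rham complex `j_* 𝒜_U`: for all `k` and all open `V` a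
space of smooth `k`-forms on `V ∩ U`, stable under restriction and under the de Rham
differential. -/
structure FormPresheaf where
  /-- the sections over `V` -/
  sec (k : ℕ) (V : Opens X) : Submodule 𝕜 (Sec 𝕜 E U k V)
  smooth {k : ℕ} {V : Opens X} {α : Sec 𝕜 E U k V} :
    α ∈ sec k V → SmoothOn (extZero α) (V ⊓ U : Opens X)
  restrict_mem {k : ℕ} {V W : Opens X} (h : V ≤ W) {α : Sec 𝕜 E U k W} :
    α ∈ sec k W → restrict h α ∈ sec k V
  d_mem {k : ℕ} {V : Opens X} {α : Sec 𝕜 E U k V} : α ∈ sec k V → dSec α ∈ sec (k + 1) V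

variable (𝕜 E U) in
/-- A sheaf of subcomplexes of the de Rham complex `j_* 𝒜_U`: moreover, membership of a form is a
local condition. -/
structure FormSheaf extends FormPresheaf E 𝕜 U where
  local_mem {k : ℕ} {V : Opens X} {α : Sec 𝕜 E U k V} :
    (∀ x ∈ V, ∃ (W : Opens X) (h : W ≤ V), x ∈ W ∧ restrict h α ∈ sec k W) → α ∈ sec k V

namespace FormPresheaf

variable (K L : FormPresheaf E 𝕜 U)

/-- The de Rham differential on sections over `V`. -/
def d (k : ℕ) (V : Opens X) : K.sec k V →ₗ[𝕜] K.sec (k + 1) V where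
  toFun α := ⟨dSec α.1, K.d_mem α.2⟩
  map_add' α β := by
    ext1; ext1 x
    change extD (extZero (α.1 + β.1)) x = extD (extZero α.1) x + extD (extZero β.1) x
    rw [extZero_add, extD_add (V ⊓ U).isOpen (K.smooth α.2) (K.smooth β.2) x.2]
  map_smul' c α := by
    ext1; ext1 x
    change extD (extZero (c • α.1)) x = c • extD (extZero α.1) x
    rw [extZero_smul, extD_smul (V ⊓ U).isOpen (K.smooth α.2) c x.2]

lemma d_d (k : ℕ) (V : Opens X) (α : K.sec k V) : K.d (k + 1) V (K.d k V α) = 0 := by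
  ext1; ext1 x
  change extD (extZero (dSec α.1)) x = 0
  rw [extD_congr (V ⊓ U).isOpen (fun z hz => extZero_dSec α.1 hz) x.2]
  exact extD_extD (V ⊓ U).isOpen (K.smooth α.2) x.2

/-- The cochain complex of sections over `V`. -/
def complexAt (V : Opens X) : CochainComplex (AddCommGrpCat.{u}) ℕ :=
  CochainComplex.of (fun k => AddCommGrpCat.of (K.sec k V)) (fun k => AddCommGrpCat.ofHom (K.d k V).toAddMonoidHom)
    (fun k => by ext1; ext1 α; exact K.d_d k V α)

variable {K L} in
/-- The inclusion of complexes of sections over `V`. -/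
def inclAt (V : Opens X) (h : ∀ k, K.sec k V ≤ L.sec k V) : K.complexAt V ⟶ L.complexAt V :=
  CochainComplex.ofHom (fun k => AddCommGrpCat.ofHom (Submodule.inclusion (h k)).toAddMonoidHom)
    (fun k => by simp only [complexAt, CochainComplex.of_d]; rfl)

/-- The presheaf of forms of degree `k`. -/
def presheaf (k : ℕ) : TopCat.Presheaf (AddCommGrpCat.{u}) (TopCat.of X) where
  obj V := AddCommGrpCat.of (K.sec k V.unop)
  map f := AddCommGrpCat.ofHom
    ((restrict f.unop.le).restrict (fun _ hα => K.restrict_mem f.unop.le hα)).toAddMonoidHom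
  map_id _ := rfl
  map_comp _ _ := rfl

end FormPresheaf

namespace FormSheaf

variable (K L : FormSheaf E 𝕜 U)

lemma isSheaf (k : ℕ) : (K.presheaf k).IsSheaf := by
  rw [TopCat.Presheaf.isSheaf_iff_isSheafUniqueGluing]
  intro ι V sf hsf
  have hcomp : ∀ i j (x : X) (hi : x ∈ V i ⊓ U) (hj : x ∈ V j ⊓ U),
      (sf i).1 ⟨x, hi⟩ = (sf j).1 ⟨x, hj⟩ := by
    intro i j x hi hj
    have := congrArg (fun s => s.1 ⟨x, ⟨hi.1, hj.1⟩, hi.2⟩) (hsf i j)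
    exact this
  have hex : ∀ x : (iSup V ⊓ U : Opens X), ∃ i, x.1 ∈ V i := fun x => by
    simpa using x.2.1
  let g : Sec 𝕜 E U k (iSup V) := fun x => (sf (hex x).choose).1 ⟨x, (hex x).choose_spec, x.2.2⟩
  have hg : ∀ i, restrict (le_iSup V i) g = (sf i).1 := fun i => by
    ext1 x
    exact hcomp _ _ _ _ _
  have hgm : g ∈ K.sec k (iSup V) := K.local_mem fun x hx => by
    obtain ⟨i, hi⟩ := Opens.mem_iSup.1 hx
    exact ⟨V i, le_iSup V i, hi, by rw [hg]; exact (sf i).2⟩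
  refine ⟨⟨g, hgm⟩, fun i => Subtype.ext (hg i), fun s hs => Subtype.ext ?_⟩
  ext1 x
  obtain ⟨i, hi⟩ := hex x
  have h1 : restrict (le_iSup V i) s.1 = (sf i).1 := congrArg Subtype.val (hs i)
  exact congrFun (h1.trans (hg i).symm) ⟨x, hi, x.2.2⟩

/-- The sheaf of forms of degree `k`. -/
def sheaf (k : ℕ) : TopCat.Sheaf (AddCommGrpCat.{u}) (TopCat.of X) :=
  ⟨K.presheaf k, K.isSheaf k⟩

/-- The de Rham differential as a morphism of sheaves. -/
def dHom (k : ℕ) : K.sheaf k ⟶ K.sheaf (k + 1) :=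
  ObjectProperty.homMk
    { app := fun V => AddCommGrpCat.ofHom (K.d k V.unop).toAddMonoidHom
      naturality := fun V W f => by
        ext1; ext1 α
        exact Subtype.ext (dSec_restrict f.unop.le α.1) }

/-- The complex of sheaves of forms with the de Rham differential. -/
def complex : CochainComplex (TopCat.Sheaf (AddCommGrpCat.{u}) (TopCat.of X)) ℕ :=
  CochainComplex.of K.sheaf K.dHom (fun k => by
    refine ObjectProperty.hom_ext _ ?_
    ext V α
    exact K.d_d k V.unop α)

variable {K L} in
/-- The inclusion of complexes of sheaves. -/
def incl (h : ∀ k V, K.sec k V ≤ L.sec k V) : K.complex ⟶ L.complex :=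
  CochainComplex.ofHom
    (fun k => ObjectProperty.homMk
      { app := fun V => AddCommGrpCat.ofHom (Submodule.inclusion (h k V.unop)).toAddMonoidHom
        naturality := fun _ _ _ => rfl })
    (fun k => by simp only [complex, CochainComplex.of_d]; rfl)

end FormSheaf

end Complexes

section Tame

open TopologicalSpace CategoryTheory Opposite

universe u

variable {E : Type} [NormedAddCommGroup E] [NormedSpace ℝ E]
  {X : Type u} [TopologicalSpace X] [ChartedSpace E X]
  {𝕜 : Type} [RCLike 𝕜] {k : ℕ}

/-- The open set `X ∖ Y` of points where `μ` does not vanish. -/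
def nonzeroLocus (μ : C^∞⟮𝓘(ℝ, E), X; 𝓘(ℝ, ℝ), ℝ⟯) : Opens X :=
  ⟨{x | μ x ≠ 0}, isOpen_ne_fun μ.contMDiff.continuous continuous_const⟩

/-- With `Y = {μ = 0}`: the form `β` on `W ∖ Y` extends to a smooth form on the open set `W`. -/
def Extends (μ : X → ℝ) (β : X → E [⋀^Fin k]→L[ℝ] 𝕜) (W : Set X) : Prop :=
  ∃ ζ : X → E [⋀^Fin k]→L[ℝ] 𝕜, SmoothOn ζ W ∧ ∀ z ∈ W, μ z ≠ 0 → ζ z = β z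

/-- The form `β` extends to a smooth form on some open neighbourhood of `x`. -/
def ExtendsNear (μ : X → ℝ) (β : X → E [⋀^Fin k]→L[ℝ] 𝕜) (x : X) : Prop :=
  ∃ W, IsOpen W ∧ x ∈ W ∧ Extends μ β W

lemma Extends.add {μ : X → ℝ} {β γ : X → E [⋀^Fin k]→L[ℝ] 𝕜} {W : Set X}
    (hβ : Extends μ β W) (hγ : Extends μ γ W) : Extends μ (β + γ) W := by
  obtain ⟨ζ, hζ, h⟩ := hβ
  obtain ⟨ξ, hξ, h'⟩ := hγ
  exact ⟨ζ + ξ, hζ.add hξ, fun z hz h0 => by simp [h z hz h0, h' z hz h0]⟩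

lemma Extends.smul {μ : X → ℝ} {β : X → E [⋀^Fin k]→L[ℝ] 𝕜} {W : Set X}
    (hβ : Extends μ β W) (c : 𝕜) : Extends μ (c • β) W := by
  obtain ⟨ζ, hζ, h⟩ := hβ
  exact ⟨c • ζ, hζ.smul c, fun z hz h0 => by simp [h z hz h0]⟩

lemma Extends.zero (μ : X → ℝ) (W : Set X) : Extends μ (0 : X → E [⋀^Fin k]→L[ℝ] 𝕜) W :=
  ⟨0, SmoothOn.zero W, fun _ _ _ => rfl⟩

lemma Extends.mono {μ : X → ℝ} {β : X → E [⋀^Fin k]→L[ℝ] 𝕜} {V W : Set X}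
    (hβ : Extends μ β W) (h : V ⊆ W) : Extends μ β V := by
  obtain ⟨ζ, hζ, h'⟩ := hβ
  exact ⟨ζ, hζ.mono h, fun z hz => h' z (h hz)⟩

lemma Extends.congr {μ : X → ℝ} {β γ : X → E [⋀^Fin k]→L[ℝ] 𝕜} {W : Set X}
    (hβ : Extends μ β W) (h : ∀ z ∈ W, μ z ≠ 0 → γ z = β z) : Extends μ γ W := by
  obtain ⟨ζ, hζ, h'⟩ := hβ
  exact ⟨ζ, hζ, fun z hz h0 => (h' z hz h0).trans (h z hz h0).symm⟩

lemma ExtendsNear.add {μ : X → ℝ} {β γ : X → E [⋀^Fin k]→L[ℝ] 𝕜} {x : X}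
    (hβ : ExtendsNear μ β x) (hγ : ExtendsNear μ γ x) : ExtendsNear μ (β + γ) x := by
  obtain ⟨W, hW, hx, h⟩ := hβ
  obtain ⟨W', hW', hx', h'⟩ := hγ
  exact ⟨W ∩ W', hW.inter hW', ⟨hx, hx'⟩,
    (h.mono inter_subset_left).add (h'.mono inter_subset_right)⟩

lemma ExtendsNear.smul {μ : X → ℝ} {β : X → E [⋀^Fin k]→L[ℝ] 𝕜} {x : X}
    (hβ : ExtendsNear μ β x) (c : 𝕜) : ExtendsNear μ (c • β) x := by
  obtain ⟨W, hW, hx, h⟩ := hβ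
  exact ⟨W, hW, hx, h.smul c⟩

lemma ExtendsNear.zero (μ : X → ℝ) (x : X) :
    ExtendsNear μ (0 : X → E [⋀^Fin k]→L[ℝ] 𝕜) x :=
  ⟨univ, isOpen_univ, mem_univ x, Extends.zero μ univ⟩

lemma ExtendsNear.congr {μ : X → ℝ} {β γ : X → E [⋀^Fin k]→L[ℝ] 𝕜} {x : X} {V : Set X}
    (hβ : ExtendsNear μ β x) (hV : IsOpen V) (hx : x ∈ V)
    (h : ∀ z ∈ V, μ z ≠ 0 → γ z = β z) : ExtendsNear μ γ x := by
  obtain ⟨W, hW, hxW, h'⟩ := hβ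
  exact ⟨W ∩ V, hW.inter hV, ⟨hxW, hx⟩,
    (h'.mono inter_subset_left).congr fun z hz => h z hz.2⟩

variable [IsManifold 𝓘(ℝ, E) ∞ X]

lemma Extends.pow_le {μ : C^∞⟮𝓘(ℝ, E), X; 𝓘(ℝ, ℝ), ℝ⟯} {α : X → E [⋀^Fin k]→L[ℝ] 𝕜} {W : Set X}
    {N M : ℕ} (hα : Extends μ (fun z => μ z ^ N • α z) W) (h : N ≤ M) :
    Extends μ (fun z => μ z ^ M • α z) W := by
  obtain ⟨ζ, hζ, h'⟩ := hα
  refine ⟨fun z => μ z ^ (M - N) • ζ z,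
    hζ.smul_fun (f := fun z => μ z ^ (M - N)) (μ.contMDiff.pow _), fun z hz h0 => ?_⟩
  simp only [h' z hz h0, smul_smul, ← pow_add, Nat.sub_add_cancel h]

lemma Extends.extD {μ : C^∞⟮𝓘(ℝ, E), X; 𝓘(ℝ, ℝ), ℝ⟯} {α : X → E [⋀^Fin k]→L[ℝ] 𝕜} {W : Set X}
    (hW : IsOpen W) (hs : SmoothOn α (W ∩ nonzeroLocus μ)) {N : ℕ}
    (hα : Extends μ (fun z => μ z ^ N • α z) W) :
    Extends μ (fun z => μ z ^ (N + 1) • extD α z) W := by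
  obtain ⟨ζ, hζ, h⟩ := hα
  have hO : IsOpen (W ∩ (nonzeroLocus μ : Set X)) := hW.inter (nonzeroLocus μ).isOpen
  have hμ : ContMDiff 𝓘(ℝ, E) 𝓘(ℝ, ℝ) ∞ μ := μ.contMDiff
  have hμN : ContMDiff 𝓘(ℝ, E) 𝓘(ℝ, ℝ) ∞ (fun z => μ z ^ N) := hμ.pow N
  refine ⟨(fun z => μ z • TameForms.extD ζ z) + (-(N : 𝕜)) • dWedge μ ζ,
    ((hζ.extD hW).smul_fun hμ).add ((hζ.dWedge hμ).smul _), fun z hz h0 => ?_⟩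
  have h1 : TameForms.extD ζ z = μ z ^ N • TameForms.extD α z + dWedge (fun z => μ z ^ N) α z := by
    rw [← extD_smul_fun hμN hO hs ⟨hz, h0⟩]
    exact extD_congr hO (fun w hw => h w hw.1 hw.2) ⟨hz, h0⟩
  have h2 : μ z • dWedge (fun z => μ z ^ N) α z = (N : 𝕜) • dWedge μ ζ z := by
    have h3 : ∀ v : E, μ z * dFun (E := E) (fun z => μ z ^ N) z v = N * μ z ^ N * dFun μ z v :=
      fun v => DFunLike.congr_fun (dFun_pow hμ N z) v
    ext v
    simp only [dWedge, h z hz h0, ContinuousAlternatingMap.alternatizeUncurryFin_apply,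
      ContinuousAlternatingMap.smul_apply, ContinuousLinearMap.smulRight_apply, Finset.smul_sum]
    refine Finset.sum_congr rfl fun i _ => ?_
    simp only [RCLike.real_smul_eq_coe_mul, smul_eq_mul, zsmul_eq_mul]
    have := congrArg (fun t : ℝ => (t : 𝕜)) (h3 (v i))
    push_cast at this ⊢
    linear_combination ((-1) ^ (i : ℕ) * (α z) (i.removeNth v)) * this
  change μ z • TameForms.extD ζ z + (-(N : 𝕜)) • dWedge μ ζ z = μ z ^ (N + 1) • TameForms.extD α z
  rw [h1, smul_add, h2, smul_smul, pow_succ']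
  ext v
  simp

lemma dWedge_add (f : X → ℝ) (α β : X → E [⋀^Fin k]→L[ℝ] 𝕜) :
    dWedge f (α + β) = dWedge f α + dWedge f β := by
  ext x v
  simp [dWedge, ContinuousAlternatingMap.alternatizeUncurryFin_apply, Finset.sum_add_distrib]

lemma dWedge_smul (f : X → ℝ) (c : 𝕜) (α : X → E [⋀^Fin k]→L[ℝ] 𝕜) :
    dWedge f (c • α) = c • dWedge f α := by
  ext x v
  simp only [dWedge, ContinuousAlternatingMap.alternatizeUncurryFin_apply, Pi.smul_apply,
    ContinuousAlternatingMap.smul_apply, ContinuousLinearMap.smulRight_apply, Finset.smul_sum]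
  refine Finset.sum_congr rfl fun i _ => ?_
  simp only [RCLike.real_smul_eq_coe_mul, smul_eq_mul, zsmul_eq_mul]
  ring

lemma dWedge_zero (f : X → ℝ) : dWedge f (0 : X → E [⋀^Fin k]→L[ℝ] 𝕜) = 0 := by
  ext x v
  simp [dWedge, ContinuousAlternatingMap.alternatizeUncurryFin_apply]

lemma fun_smul_add (g : X → ℝ) (α β : X → E [⋀^Fin k]→L[ℝ] 𝕜) :
    (fun z => g z • (α + β) z) = (fun z => g z • α z) + fun z => g z • β z := by
  ext1 z; simp

lemma fun_smul_smul (g : X → ℝ) (c : 𝕜) (α : X → E [⋀^Fin k]→L[ℝ] 𝕜) :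
    (fun z => g z • (c • α) z) = c • fun z => g z • α z := by
  ext z v
  simp [RCLike.real_smul_eq_coe_mul, mul_left_comm]

lemma fun_smul_zero (g : X → ℝ) :
    (fun z => g z • (0 : X → E [⋀^Fin k]→L[ℝ] 𝕜) z) = 0 := by
  ext z v; simp

variable (𝕜) (μ : C^∞⟮𝓘(ℝ, E), X; 𝓘(ℝ, ℝ), ℝ⟯)

/-- The presheaf of complexes `V ↦ 𝒜_μ(V)`: the smooth forms `α` on `V ∖ Y`, `Y = {μ = 0}`, such
that for some integer `N` the form `μ ^ N α` extends to a smooth form on `V`. -/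
def polarPresheaf : FormPresheaf E 𝕜 (nonzeroLocus μ) where
  sec k V :=
    { carrier := {α | SmoothOn (extZero α) (V ⊓ nonzeroLocus μ : Opens X) ∧
        ∃ N : ℕ, Extends μ (fun z => μ z ^ N • extZero α z) V}
      add_mem' := by
        rintro α β ⟨hα, N, hN⟩ ⟨hβ, M, hM⟩
        refine ⟨by rw [extZero_add]; exact hα.add hβ, max N M, ?_⟩
        rw [extZero_add, fun_smul_add]
        exact (hN.pow_le (le_max_left _ _)).add (hM.pow_le (le_max_right _ _))
      zero_mem' := by
        refine ⟨by rw [extZero_zero]; exact SmoothOn.zero _, 0, ?_⟩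
        rw [extZero_zero, fun_smul_zero]
        exact Extends.zero _ _
      smul_mem' := by
        rintro c α ⟨hα, N, hN⟩
        refine ⟨by rw [extZero_smul]; exact hα.smul c, N, ?_⟩
        rw [extZero_smul, fun_smul_smul]
        exact hN.smul c }
  smooth hα := hα.1
  restrict_mem {k V W} h {α} hα := by
    obtain ⟨hα, N, hN⟩ := hα
    refine ⟨(hα.mono (T := (W ⊓ nonzeroLocus μ : Opens X)) fun z hz =>
        (⟨h hz.1, hz.2⟩ : z ∈ W ⊓ nonzeroLocus μ)).congr
      fun z hz => extZero_restrict h α hz.1, N, (hN.mono h).congr fun z hz _ => ?_⟩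
    rw [extZero_restrict h α hz]
  d_mem {k V α} hα := by
    obtain ⟨hα, N, hN⟩ := hα
    refine ⟨(hα.extD (V ⊓ nonzeroLocus μ).isOpen).congr fun z hz => extZero_dSec α hz, N + 1,
      (hN.extD V.isOpen hα).congr fun z hz h0 => ?_⟩
    rw [extZero_dSec α ⟨hz, h0⟩]

/-- The complex of sheaves `𝒜_{X,μ} = ⋃_N 𝒜_{X,μ,N}` (union of subsheaves of `j_* 𝒜_{X ∖ Y}`): its
sections over `V` are the smooth forms `α` on `V ∖ Y`, `Y = {μ = 0}`, such that every point of `V`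
has a neighbourhood on which, for some integer `N`, `μ ^ N α` extends to a smooth form. -/
def polarSheaf : FormSheaf E 𝕜 (nonzeroLocus μ) where
  sec k V :=
    { carrier := {α | SmoothOn (extZero α) (V ⊓ nonzeroLocus μ : Opens X) ∧
        ∀ x ∈ V, ∃ N : ℕ, ExtendsNear μ (fun z => μ z ^ N • extZero α z) x}
      add_mem' := by
        rintro α β ⟨hα, hN⟩ ⟨hβ, hM⟩
        refine ⟨by rw [extZero_add]; exact hα.add hβ, fun x hx => ?_⟩
        obtain ⟨N, W, hW, hxW, h⟩ := hN x hx
        obtain ⟨M, W', hW', hxW', h'⟩ := hM x hx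
        refine ⟨max N M, ?_⟩
        rw [extZero_add, fun_smul_add]
        exact ExtendsNear.add ⟨W, hW, hxW, h.pow_le (le_max_left _ _)⟩
          ⟨W', hW', hxW', h'.pow_le (le_max_right _ _)⟩
      zero_mem' := by
        refine ⟨by rw [extZero_zero]; exact SmoothOn.zero _, fun x _ => ⟨0, ?_⟩⟩
        rw [extZero_zero, fun_smul_zero]
        exact ExtendsNear.zero _ _
      smul_mem' := by
        rintro c α ⟨hα, hN⟩
        refine ⟨by rw [extZero_smul]; exact hα.smul c, fun x hx => ?_⟩
        obtain ⟨N, hN⟩ := hN x hx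
        refine ⟨N, ?_⟩
        rw [extZero_smul, fun_smul_smul]
        exact hN.smul c }
  smooth hα := hα.1
  restrict_mem {k V W} h {α} hα := by
    obtain ⟨hα, hN⟩ := hα
    refine ⟨(hα.mono (T := (W ⊓ nonzeroLocus μ : Opens X)) fun z hz =>
        (⟨h hz.1, hz.2⟩ : z ∈ W ⊓ nonzeroLocus μ)).congr
      fun z hz => extZero_restrict h α hz.1, fun x hx => ?_⟩
    obtain ⟨N, hN⟩ := hN x (h hx)
    refine ⟨N, hN.congr V.isOpen hx fun z hz _ => ?_⟩
    rw [extZero_restrict h α hz]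
  d_mem {k V α} hα := by
    obtain ⟨hα, hN⟩ := hα
    refine ⟨(hα.extD (V ⊓ nonzeroLocus μ).isOpen).congr fun z hz => extZero_dSec α hz,
      fun x hx => ?_⟩
    obtain ⟨N, W, hW, hxW, h⟩ := hN x hx
    refine ⟨N + 1, W ∩ V, hW.inter V.isOpen, ⟨hxW, hx⟩,
      ((h.mono inter_subset_left).extD (hW.inter V.isOpen)
        (hα.mono fun z hz => ⟨hz.1.2, hz.2⟩)).congr fun z hz h0 => ?_⟩
    rw [extZero_dSec α ⟨hz.2, h0⟩]
  local_mem {k V α} hα := by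
    refine ⟨SmoothOn.of_locally fun x hx => ?_, fun x hx => ?_⟩
    · obtain ⟨W, h, hxW, hs, -⟩ := hα x hx.1
      exact ⟨_, (W ⊓ nonzeroLocus μ).isOpen, ⟨hxW, hx.2⟩,
        hs.congr fun z hz => (extZero_restrict h α hz.1).symm⟩
    · obtain ⟨W, h, hxW, -, hN⟩ := hα x hx
      obtain ⟨N, hN⟩ := hN x hxW
      refine ⟨N, hN.congr W.isOpen hxW fun z hz _ => ?_⟩
      rw [extZero_restrict h α hz]

/-- `F_p 𝒜_μ(V)`: the forms `α ∈ 𝒜_μ(V)` such that `μ ^ p α` and `μ ^ (p - 1) dμ ∧ α` extend to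
smooth forms on `V`. -/
def tamePresheafSec (p : ℤ) (k : ℕ) (V : Opens X) : Submodule 𝕜 (Sec 𝕜 E (nonzeroLocus μ) k V) where
  carrier := {α | α ∈ (polarPresheaf 𝕜 μ).sec k V ∧
    Extends μ (fun z => μ z ^ p • extZero α z) V ∧
    Extends μ (fun z => μ z ^ (p - 1) • dWedge μ (extZero α) z) V}
  add_mem' := by
    rintro α β ⟨hα, h1, h2⟩ ⟨hβ, h3, h4⟩
    refine ⟨add_mem hα hβ, ?_, ?_⟩
    · rw [extZero_add, fun_smul_add]; exact h1.add h3
    · rw [extZero_add, dWedge_add, fun_smul_add]; exact h2.add h4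
  zero_mem' := by
    refine ⟨zero_mem _, ?_, ?_⟩
    · rw [extZero_zero, fun_smul_zero]; exact Extends.zero _ _
    · rw [extZero_zero, dWedge_zero, fun_smul_zero]; exact Extends.zero _ _
  smul_mem' := by
    rintro c α ⟨hα, h1, h2⟩
    refine ⟨Submodule.smul_mem _ c hα, ?_, ?_⟩
    · rw [extZero_smul, fun_smul_smul]; exact h1.smul c
    · rw [extZero_smul, dWedge_smul, fun_smul_smul]; exact h2.smul c

/-- Sections over `V` of `F_p 𝒜_{X,μ}`: the sections `α` of `𝒜_{X,μ}` such that `μ ^ p α` and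
`μ ^ (p - 1) dμ ∧ α` belong to the subsheaf `𝒜_X` of `j_* 𝒜_{X ∖ Y}`, that is, extend to smooth
forms near every point of `V`. -/
def tameSheafSec (p : ℤ) (k : ℕ) (V : Opens X) : Submodule 𝕜 (Sec 𝕜 E (nonzeroLocus μ) k V) where
  carrier := {α | α ∈ (polarSheaf 𝕜 μ).sec k V ∧ ∀ x ∈ V,
    ExtendsNear μ (fun z => μ z ^ p • extZero α z) x ∧
    ExtendsNear μ (fun z => μ z ^ (p - 1) • dWedge μ (extZero α) z) x}
  add_mem' := by
    rintro α β ⟨hα, h⟩ ⟨hβ, h'⟩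
    refine ⟨add_mem hα hβ, fun x hx => ⟨?_, ?_⟩⟩
    · rw [extZero_add, fun_smul_add]; exact (h x hx).1.add (h' x hx).1
    · rw [extZero_add, dWedge_add, fun_smul_add]; exact (h x hx).2.add (h' x hx).2
  zero_mem' := by
    refine ⟨zero_mem _, fun x hx => ⟨?_, ?_⟩⟩
    · rw [extZero_zero, fun_smul_zero]; exact ExtendsNear.zero _ _
    · rw [extZero_zero, dWedge_zero, fun_smul_zero]; exact ExtendsNear.zero _ _
  smul_mem' := by
    rintro c α ⟨hα, h⟩
    refine ⟨Submodule.smul_mem _ c hα, fun x hx => ⟨?_, ?_⟩⟩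
    · rw [extZero_smul, fun_smul_smul]; exact (h x hx).1.smul c
    · rw [extZero_smul, dWedge_smul, fun_smul_smul]; exact (h x hx).2.smul c

lemma dWedge_congr {f : X → ℝ} {α β : X → E [⋀^Fin k]→L[ℝ] 𝕜} {x : X} (h : α x = β x) :
    dWedge f α x = dWedge f β x := by
  simp only [dWedge, h]

/-- `F_p 𝒜_μ(V)`, `V ⊆ X` open, as a presheaf of complexes, given that the spaces `F_p 𝒜_μ(V)` are
preserved by the de Rham differential. -/
def tamePresheaf (p : ℤ)
    (hd : ∀ (k : ℕ) (V : Opens X), ∀ α ∈ tamePresheafSec 𝕜 μ p k V,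
      dSec α ∈ tamePresheafSec 𝕜 μ p (k + 1) V) :
    FormPresheaf E 𝕜 (nonzeroLocus μ) where
  sec := tamePresheafSec 𝕜 μ p
  smooth hα := hα.1.1
  restrict_mem {k V W} h {α} hα := by
    refine ⟨(polarPresheaf 𝕜 μ).restrict_mem h hα.1, (hα.2.1.mono h).congr fun z hz _ => ?_,
      (hα.2.2.mono h).congr fun z hz _ => ?_⟩
    · rw [extZero_restrict h α hz]
    · rw [dWedge_congr 𝕜 (extZero_restrict h α hz)]
  d_mem hα := hd _ _ _ hα

/-- `F_p 𝒜_{X,μ}` as a subcomplex of sheaves of `𝒜_{X,μ}`, given that it is preserved by the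
de Rham differential. -/
def tameSheaf (p : ℤ)
    (hd : ∀ (k : ℕ) (V : Opens X), ∀ α ∈ tameSheafSec 𝕜 μ p k V,
      dSec α ∈ tameSheafSec 𝕜 μ p (k + 1) V) :
    FormSheaf E 𝕜 (nonzeroLocus μ) where
  sec := tameSheafSec 𝕜 μ p
  smooth hα := hα.1.1
  restrict_mem {k V W} h {α} hα := by
    refine ⟨(polarSheaf 𝕜 μ).restrict_mem h hα.1, fun x hx =>
      ⟨(hα.2 x (h hx)).1.congr V.isOpen hx fun z hz _ => ?_,
        (hα.2 x (h hx)).2.congr V.isOpen hx fun z hz _ => ?_⟩⟩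
    · rw [extZero_restrict h α hz]
    · rw [dWedge_congr 𝕜 (extZero_restrict h α hz)]
  d_mem hα := hd _ _ _ hα
  local_mem {k V α} hα := by
    refine ⟨(polarSheaf 𝕜 μ).local_mem fun x hx => ?_, fun x hx => ?_⟩
    · obtain ⟨W, h, hxW, hs⟩ := hα x hx
      exact ⟨W, h, hxW, hs.1⟩
    · obtain ⟨W, h, hxW, hs⟩ := hα x hx
      refine ⟨(hs.2 x hxW).1.congr W.isOpen hxW fun z hz _ => ?_,
        (hs.2 x hxW).2.congr W.isOpen hxW fun z hz _ => ?_⟩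
      · rw [extZero_restrict h α hz]
      · rw [dWedge_congr 𝕜 (extZero_restrict h α hz)]

end Tame

section MorseBott

open TopologicalSpace

/-- `Y` is a closed (embedded, smooth) submanifold of codimension `m` of the `n`-manifold `X`: it is
closed and every point of `Y` lies in the domain of a smooth chart of `X` in which `Y` is given by
the vanishing of the first `m` coordinates. -/
structure IsClosedSubmanifold (n : ℕ) {X : Type*} [TopologicalSpace X]
    [ChartedSpace (EuclideanSpace ℝ (Fin n)) X] (Y : Set X) (m : ℕ) : Prop where
  isClosed : IsClosed Y
  exists_chart : ∀ y ∈ Y, ∃ e ∈ IsManifold.maximalAtlas (𝓡 n) ∞ X, y ∈ e.source ∧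
    ∀ x ∈ e.source, (x ∈ Y ↔ ∀ i : Fin n, (i : ℕ) < m → e x i = 0)

/-- The Hessian of `f` at `x`, computed in the preferred chart at `x`. It is used at critical points
of `f` only, where its rank does not depend on the chart. -/
def hessian {E : Type*} [NormedAddCommGroup E] [NormedSpace ℝ E] {X : Type*} [TopologicalSpace X]
    [ChartedSpace E X] (f : X → ℝ) (x : X) : E →L[ℝ] E →L[ℝ] ℝ :=
  fderiv ℝ (fderiv ℝ (f ∘ (chartAt E x).symm)) (chartAt E x x)

/-- `μ` is a nonnegative Morse–Bott function with zero set `Y` of codimension `m`: it is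
nonnegative, vanishes exactly on `Y`, and its Hessian has rank `m` at the points of `Y`. -/
structure IsNonnegMorseBott {E : Type*} [NormedAddCommGroup E] [NormedSpace ℝ E] {X : Type*}
    [TopologicalSpace X] [ChartedSpace E X] (μ : C^∞⟮𝓘(ℝ, E), X; 𝓘(ℝ, ℝ), ℝ⟯) (Y : Set X)
    (m : ℕ) : Prop where
  nonneg : ∀ x, 0 ≤ μ x
  eq_zero_iff : ∀ x, μ x = 0 ↔ x ∈ Y
  rank_hessian : ∀ x ∈ Y, Module.finrank ℝ (LinearMap.range (hessian (E := E) μ x).toLinearMap) = m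

/-- The function `x₁² + ⋯ + x_m²` on `ℝⁿ`. -/
def normSq (n m : ℕ) :
    C^∞⟮𝓡 n, EuclideanSpace ℝ (Fin n); 𝓘(ℝ, ℝ), ℝ⟯ :=
  ⟨fun x => ∑ i ∈ Finset.univ.filter (fun i : Fin n => (i : ℕ) < m), x i ^ 2, by
    rw [contMDiff_iff_contDiff]; fun_prop⟩

/-- The open ball of radius `R` in `ℝⁿ` centered at the origin. -/
def openBall (n : ℕ) (R : ℝ) : Opens (EuclideanSpace ℝ (Fin n)) :=
  ⟨Metric.ball 0 R, Metric.isOpen_ball⟩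

end MorseBott

end TameForms

end

universe u

open TameForms

/-!
Write `Y` for the zero set of `μ`. For `r ≥ 1` the formula
`d(μʳ α) = μʳ dα + r μʳ⁻¹ dμ ∧ α` shows that a form `α` is tame if and only if both `μʳ α` and
`μʳ dα` extend smoothly across `Y` (`tameOn_iff`). Hence tame forms are stable under `d`, and all
that has to be proved is the following: locally, a form with poles along `Y` whose differential is
tame is the sum of a tame form and of the differential of a form with poles
(`exists_tameOn_sub_extD`, and `tameOn_of_extD_zero` in degree zero). Applied to closed forms, this
says that the inclusion is surjective on cohomology. Applied to `α` with `dα = β` tame, it says that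
`β` is the differential of a tame form, so the inclusion is injective on cohomology
(`quasiIso_of_mono_of_cover`, `FormSheaf.quasiIso_incl`, `FormPresheaf.quasiIso_inclAt`).

By the Morse–Bott lemma (`exists_morseBott_chart`) one can assume that `μ = x₁² + ⋯ + x_m²` with
`m = 2 r`. The nonnegativity of `μ` makes the Hessian positive definite in the normal directions;
Taylor's formula with integral remainder writes `μ` as a quadratic form in `x₁, …, x_m` with smooth
coefficients, and a smooth square root of its matrix provides the new coordinates.

For this `μ` the order of a pole is lowered one step at a time, from `p + 1` to `p` for `p ≥ r`. In
the variables `x₁, …, x_m` put `δ = ∑ ι_{∂ᵢ} ∂ᵢ`, let `ε` be the contraction with the Euler field,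
`q` the degree of a form, and `θ = dμ / μ ∧ ·`. The operator `K = μ δ + (4 p + 2) ε` does not
increase the order of poles. If `w` has a pole of order at most `p + 1` and `dw` one of order at most
`p`, then, modulo poles of order at most `p`,
`d (K w) = 2 p (2 q - (2 p + 2 + m) + ε θ) w`
(`homotopy_identity`, `homotopy_mem`). Here `(ε θ)² = 2 ε θ`, and forms with lower poles that are
of the shape `w' - ε θ w`, with `w'` subject to the same conditions as `w`, are mapped by `ε θ` to
exact forms up to lower poles. So the operator on the right acts like a diagonalizable one, with
eigenvalues `2 p (2 j - 2 p - 2 - m)` and `2 p (2 j - 2 p - m)` on forms of degree `j`, the latter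
only for `j < m`. These are nonzero because `2 p ≥ m`, so `w` is exact up to a form with lower poles
(`RadialOps.mem_W_of_pure`, `RadialOps.exists_lower_pole`). The variables along `Y` are then added
one by one, splitting forms into the parts with and without the new differential
(`CoordOps.exists_lower_pole`). This part is algebra and is carried out for abstract operators that
satisfy the commutation relations; `euclideanOps` are the operators on differential forms.

For `r = 0` the set `Y` is open and closed, so both complexes consist of all smooth forms on the
complement of `Y`: the condition on poles is void (`TameOn.of_dichotomy`).
-/

noncomputable section

namespace TameForms

/-! ### The operators in the variables transverse to the zero set -/

section Algebra

/-- Abstract form of the operators acting on forms in the coordinates transverse to `Y`, where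
`μ = x₁² + ⋯ + x_m²`: `d` is the exterior derivative `∑ dxᵢ ∧ ∂ᵢ`, `δ` the operator `∑ ι_{∂ᵢ} ∂ᵢ`,
`ε` the contraction with the Euler field `∑ xᵢ ∂ᵢ`, `t` the exterior product with
`∑ xᵢ dxᵢ = dμ / 2`, `q` the operator of degree in the `dxᵢ`, and `u` the multiplication by
`1 / μ`. The submodule `A` stands for the forms which extend smoothly across `Y`. -/
structure RadialOps (M : Type*) [AddCommGroup M] [Module ℝ M] (m : ℕ) where
  d : Module.End ℝ M
  δ : Module.End ℝ M
  ε : Module.End ℝ M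
  t : Module.End ℝ M
  q : Module.End ℝ M
  μ : Module.End ℝ M
  u : Module.End ℝ M
  A : Submodule ℝ M
  d_d : ∀ w, d (d w) = 0
  ε_ε : ∀ w, ε (ε w) = 0
  t_t : ∀ w, t (t w) = 0
  d_μ : ∀ w, d (μ w) = μ (d w) + (2 : ℝ) • t w
  δ_μ : ∀ w, δ (μ w) = μ (δ w) + (2 : ℝ) • ε w
  ε_t : ∀ w, ε (t w) = μ w - t (ε w)
  t_δ : ∀ w, t (δ w) = (m : ℝ) • w + (d (ε w) + ε (d w)) - (2 : ℝ) • q w - δ (t w)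
  q_d : ∀ w, q (d w) = d (q w) + d w
  q_δ : ∀ w, q (δ w) = δ (q w) - δ w
  q_ε : ∀ w, q (ε w) = ε (q w) - ε w
  q_t : ∀ w, q (t w) = t (q w) + t w
  q_μ : ∀ w, q (μ w) = μ (q w)
  t_μ : ∀ w, t (μ w) = μ (t w)
  ε_μ : ∀ w, ε (μ w) = μ (ε w)
  u_μ : ∀ w, u (μ w) = w
  μ_u : ∀ w, μ (u w) = w
  q_spec : ∀ w, (∏ j ∈ Finset.range (m + 1), (Polynomial.X - Polynomial.C (j : ℝ))).aeval q w = 0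
  d_mem : ∀ w ∈ A, d w ∈ A
  δ_mem : ∀ w ∈ A, δ w ∈ A
  ε_mem : ∀ w ∈ A, ε w ∈ A
  t_mem : ∀ w ∈ A, t w ∈ A
  q_mem : ∀ w ∈ A, q w ∈ A

namespace RadialOps

variable {M : Type*} [AddCommGroup M] [Module ℝ M] {m : ℕ} (O : RadialOps M m)

lemma μ_injective : Function.Injective O.μ := fun a b h => by
  rw [← O.u_μ a, h, O.u_μ]

/-- Follows from `ε t + t ε = μ`. -/
lemma μ_mem {w : M} (h : w ∈ O.A) : O.μ w ∈ O.A := by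
  have h1 := O.ε_t w
  rw [eq_sub_iff_add_eq] at h1
  rw [← h1]
  exact add_mem (O.ε_mem _ (O.t_mem _ h)) (O.t_mem _ (O.ε_mem _ h))

lemma t_u (w : M) : O.t (O.u w) = O.u (O.t w) :=
  O.μ_injective (by rw [← O.t_μ, O.μ_u, O.μ_u])

lemma ε_u (w : M) : O.ε (O.u w) = O.u (O.ε w) :=
  O.μ_injective (by rw [← O.ε_μ, O.μ_u, O.μ_u])

lemma d_u (w : M) : O.d (O.u w) = O.u (O.d w) - (2 : ℝ) • O.u (O.u (O.t w)) := by
  apply O.μ_injective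
  have h := O.d_μ (O.u w)
  rw [O.μ_u, O.t_u] at h
  simp only [map_sub, map_smul, O.μ_u]
  rw [h]; module

lemma δ_u (w : M) : O.δ (O.u w) = O.u (O.δ w) - (2 : ℝ) • O.u (O.u (O.ε w)) := by
  apply O.μ_injective
  have h := O.δ_μ (O.u w)
  rw [O.μ_u, O.ε_u] at h
  simp only [map_sub, map_smul, O.μ_u]
  rw [h]; module

/-- The exterior product with `dμ / μ`. -/
def θ : Module.End ℝ M := (2 : ℝ) • (O.u * O.t)

lemma θ_apply (w : M) : O.θ w = (2 : ℝ) • O.u (O.t w) := rfl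

/-- The Lie derivative along the Euler field, by Cartan's formula. -/
def L : Module.End ℝ M := O.d * O.ε + O.ε * O.d

lemma L_apply (w : M) : O.L w = O.d (O.ε w) + O.ε (O.d w) := rfl

/-- The forms with a pole of order at most `p` along `Y`. -/
def G (p : ℕ) : Submodule ℝ M := O.A.comap (O.μ ^ p)

lemma mem_G {p : ℕ} {w : M} : w ∈ O.G p ↔ (O.μ ^ p) w ∈ O.A := Iff.rfl

lemma mem_G_succ {p : ℕ} {w : M} : w ∈ O.G (p + 1) ↔ O.μ w ∈ O.G p := by
  rw [mem_G, mem_G, pow_succ]; rfl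

lemma G_le_succ (p : ℕ) : O.G p ≤ O.G (p + 1) := fun w hw => by
  rw [mem_G, pow_succ']; exact O.μ_mem hw

lemma commute_pow {T : Module.End ℝ M} (h : ∀ w, T (O.μ w) = O.μ (T w)) (p : ℕ) (w : M) :
    T ((O.μ ^ p) w) = (O.μ ^ p) (T w) := by
  have h1 : Commute T O.μ := LinearMap.ext h
  exact LinearMap.congr_fun (h1.pow_right p) w

lemma ε_mem_G {p : ℕ} {w : M} (h : w ∈ O.G p) : O.ε w ∈ O.G p := by
  rw [mem_G, ← O.commute_pow O.ε_μ]; exact O.ε_mem _ h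

lemma q_mem_G {p : ℕ} {w : M} (h : w ∈ O.G p) : O.q w ∈ O.G p := by
  rw [mem_G, ← O.commute_pow O.q_μ]; exact O.q_mem _ h

lemma d_μ_pow (p : ℕ) (w : M) :
    O.d ((O.μ ^ p) w) = (O.μ ^ p) (O.d w + (p : ℝ) • O.θ w) := by
  induction p generalizing w with
  | zero => simp
  | succ p ih =>
    rw [pow_succ, Module.End.mul_apply, ih, Module.End.mul_apply]
    congr 1
    simp only [θ_apply, map_add, map_smul, O.d_μ, O.t_μ, O.u_μ, O.μ_u, Nat.cast_add, Nat.cast_one]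
    module

lemma δ_μ_pow (p : ℕ) (w : M) :
    O.δ ((O.μ ^ p) w) = (O.μ ^ p) (O.δ w + (p : ℝ) • (2 : ℝ) • O.u (O.ε w)) := by
  induction p generalizing w with
  | zero => simp
  | succ p ih =>
    rw [pow_succ, Module.End.mul_apply, ih, Module.End.mul_apply]
    congr 1
    simp only [map_add, map_smul, O.δ_μ, O.ε_μ, O.u_μ, O.μ_u, Nat.cast_add, Nat.cast_one]
    module

lemma d_add_θ_mem_G {p : ℕ} {w : M} (h : w ∈ O.G p) : O.d w + (p : ℝ) • O.θ w ∈ O.G p := by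
  rw [mem_G, ← d_μ_pow]; exact O.d_mem _ h

/-- `μ δ` does not increase the order of the pole. -/
lemma μδ_mem_G {p : ℕ} {w : M} (h : w ∈ O.G p) : O.μ (O.δ w) ∈ O.G p := by
  have h1 : O.δ w + (p : ℝ) • (2 : ℝ) • O.u (O.ε w) ∈ O.G p := by
    rw [mem_G, ← δ_μ_pow]; exact O.δ_mem _ h
  have h2 := sub_mem (O.mem_G_succ.1 (O.G_le_succ _ h1))
    (Submodule.smul_mem _ ((p : ℝ) * 2) (O.ε_mem_G h))
  convert h2 using 1
  simp only [map_add, map_smul, O.μ_u]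
  module

lemma L_mem_G {p : ℕ} {w : M} (h : w ∈ O.G p) : O.L w ∈ O.G p := by
  have h1 := O.d_add_θ_mem_G (O.ε_mem_G h)
  have h2 := O.ε_mem_G (O.d_add_θ_mem_G h)
  have h3 := sub_mem (add_mem h1 h2) (Submodule.smul_mem _ ((p : ℝ) * 2) h)
  convert h3 using 1
  simp only [L_apply, θ_apply, map_add, map_smul, O.ε_u, O.ε_t, map_sub, O.u_μ]
  module

/-- The operator `μ δ + (4 p - 2) ε` of degree `-1`; it preserves the order of poles, and acts
modulo lower poles as a homotopy between zero and a diagonalizable operator. -/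
def K (p : ℝ) : Module.End ℝ M := O.μ * O.δ + (4 * p - 2) • O.ε

lemma K_apply (p : ℝ) (w : M) : O.K p w = O.μ (O.δ w) + (4 * p - 2) • O.ε w := rfl

lemma K_mem_G {p : ℕ} {w : M} (c : ℝ) (h : w ∈ O.G p) : O.K c w ∈ O.G p :=
  add_mem (O.μδ_mem_G h) (Submodule.smul_mem _ _ (O.ε_mem_G h))

/-- The factor of `μ` on the right is `μ⁻ᵖ d δ (μᵖ w) + μ⁻ᵖ δ (μᵖ w')` with
`w' = μ¹⁻ᵖ d (μᵖ⁻¹ w) = dw + (p - 1) dμ / μ ∧ w`. Hence if `w` and `w'` have poles of order at most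
`p`, then the right-hand side has a pole of order at most `p - 1`. -/
lemma homotopy_identity (p : ℝ) (w : M) :
    O.d (O.K p w) + O.K p (O.d w)
      - (2 * (p - 1)) • ((2 : ℝ) • O.q w - (2 * p + m) • w + O.ε (O.θ w))
    = O.μ ((O.d (O.δ w + p • (2 : ℝ) • O.u (O.ε w))
        + p • O.θ (O.δ w + p • (2 : ℝ) • O.u (O.ε w)))
      + (O.δ (O.d w + (p - 1) • O.θ w) + p • (2 : ℝ) • O.u (O.ε (O.d w + (p - 1) • O.θ w)))) := by
  simp only [K_apply, θ_apply, map_add, map_sub, map_smul, O.d_μ, O.d_u, O.δ_u, O.t_u, O.ε_u,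
    O.t_δ, O.ε_t, O.μ_u, O.u_μ]
  module

end RadialOps
end Algebra

/-! ### Lowering the order of a pole -/

section Algebra
namespace RadialOps

variable {M : Type*} [AddCommGroup M] [Module ℝ M] {m : ℕ} (O : RadialOps M m)

lemma ε_L (w : M) : O.ε (O.L w) = O.L (O.ε w) := by
  simp only [L_apply, map_add, O.ε_ε, map_zero, zero_add, add_zero]

lemma d_θ (w : M) : O.d (O.θ w) = -O.θ (O.d w) := by
  -- `d t + t d = 0` follows by applying `d d = 0` to `μ w`
  have h := O.d_d (O.μ w)
  simp only [O.d_μ, map_add, map_smul, O.d_d, map_zero, zero_add] at h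
  have h1 : O.d (O.t w) = - O.t (O.d w) := by
    rw [← smul_add] at h
    rw [eq_neg_iff_add_eq_zero, add_comm]
    exact (smul_eq_zero.1 h).resolve_left two_ne_zero
  simp only [θ_apply, map_smul, O.d_u, O.t_t, h1, map_neg, map_zero, smul_zero, sub_zero, smul_neg]

lemma ε_θ_ε (w : M) : O.ε (O.θ (O.ε w)) = (2 : ℝ) • O.ε w := by
  simp only [θ_apply, map_smul, O.ε_u, O.ε_t, O.ε_ε, O.u_μ, map_zero, sub_zero]

/-- The forms `d η + g` where `η` has a pole of order at most `p + 1` and `g` has one of order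
at most `p`. -/
def W (p : ℕ) : Submodule ℝ M := (O.G (p + 1)).map O.d ⊔ O.G p

lemma mem_W {p : ℕ} {w : M} : w ∈ O.W p ↔ ∃ η ∈ O.G (p + 1), w - O.d η ∈ O.G p := by
  simp only [W, Submodule.mem_sup, Submodule.mem_map]
  constructor
  · rintro ⟨_, ⟨η, hη, rfl⟩, g, hg, rfl⟩
    exact ⟨η, hη, by simpa using hg⟩
  · rintro ⟨η, hη, h⟩
    exact ⟨_, ⟨η, hη, rfl⟩, _, h, by simp⟩

lemma d_mem_W {p : ℕ} {w : M} (h : w ∈ O.G (p + 1)) : O.d w ∈ O.W p :=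
  le_sup_left (a := (O.G (p + 1)).map O.d) ⟨w, h, rfl⟩

lemma G_le_W (p : ℕ) : O.G p ≤ O.W p := le_sup_right

/-- The forms `w` with a pole of order at most `p + 1` such that `d w` has a pole of order at
most `p`. -/
def Z (p : ℕ) : Submodule ℝ M := O.G (p + 1) ⊓ (O.G p).comap O.d

/-- For `w ∈ Z` the product `dμ / μ ∧ w` has no pole of order `p + 2`: `μᵖ⁺¹ dw` and
`d (μᵖ⁺¹ w)` are smooth. -/
lemma θ_mem_of_mem_Z {p : ℕ} {w : M} (h : w ∈ O.Z p) : O.θ w ∈ O.G (p + 1) := by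
  have h1 := sub_mem (O.d_add_θ_mem_G h.1) (O.G_le_succ p h.2)
  rw [add_sub_cancel_left] at h1
  refine (Submodule.smul_mem_iff _ ?_).1 h1
  positivity

/-- For `w ∈ Z` the homotopy identity holds modulo poles of order at most `p` with the term
`K (dw)` omitted. -/
lemma homotopy_mem {p : ℕ} {w : M} (h : w ∈ O.Z p) :
    O.d (O.K (p + 1) w) - (2 * p : ℝ) •
      ((2 : ℝ) • O.q w - (2 * p + 2 + m : ℝ) • w + O.ε (O.θ w)) ∈ O.G p := by
  have h1 := O.homotopy_identity (p + 1) w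
  have h2 : O.δ w + ((p + 1 : ℕ) : ℝ) • (2 : ℝ) • O.u (O.ε w) ∈ O.G (p + 1) := by
    rw [mem_G, ← δ_μ_pow]; exact O.δ_mem _ h.1
  have h3 := O.d_add_θ_mem_G h2
  have h4 := sub_mem (O.d_add_θ_mem_G h.1) (O.θ_mem_of_mem_Z h)
  have h5 := show O.δ _ ∈ O.A from O.δ_mem _ h4
  rw [δ_μ_pow, ← mem_G] at h5
  have h6 := O.mem_G_succ.1 (add_mem h3 h5)
  have e : O.d w + ((p + 1 : ℕ) : ℝ) • O.θ w - O.θ w = O.d w + ((p : ℝ) + 1 - 1) • O.θ w := by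
    push_cast; module
  rw [e] at h6
  push_cast at h6
  rw [← h1] at h6
  have h7 := sub_mem h6 (O.K_mem_G (p + 1) h.2)
  convert h7 using 1
  module

/-- For a form `w ∈ Z` of pure degree `j` in the `dxᵢ`, applying the homotopy identity to `w` and
then to `w₁ = d (K w) / 2 p - (2 j - 2 p - 2 - m) w`, which is `ε θ w` up to lower poles, expresses
a nonzero multiple of `w` by exact forms and forms with lower poles. -/
lemma mem_W_of_pure {p j : ℕ} (hp : 1 ≤ p) (hm : m ≤ 2 * p) (hj : j ≤ m) {w : M} (h : w ∈ O.Z p)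
    (hq : O.q w = (j : ℝ) • w) (htop : j = m → O.t w = 0) : w ∈ O.W p := by
  have hp0 : (p : ℝ) ≠ 0 := by positivity
  obtain ⟨a, ha⟩ : ∃ a : ℝ, a = 2 * j - (2 * p + 2 + m) := ⟨_, rfl⟩
  have ha0 : a ≠ 0 := by
    have h1 : (j : ℝ) ≤ m := by exact_mod_cast hj
    have h2 : (m : ℝ) ≤ 2 * p := by exact_mod_cast hm
    rw [ha]; apply ne_of_lt; linarith
  have key : ∀ v ∈ O.Z p, O.q v = (j : ℝ) • v →
      O.d (O.K (p + 1) v) - (2 * p : ℝ) • (a • v + O.ε (O.θ v)) ∈ O.G p := by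
    intro v hv hqv
    have h1 := O.homotopy_mem hv
    rw [hqv] at h1
    convert h1 using 3
    rw [ha]; module
  have hR := key w h hq
  have hdK : O.d (O.K (p + 1) w) ∈ O.W p := O.d_mem_W (O.K_mem_G _ h.1)
  -- in the top degree `j = m` the term `ε θ w` vanishes, and the factor `a + 2` is not needed
  rcases eq_or_lt_of_le hj with hjm | hjm
  · have h1 : O.θ w = 0 := by simp [θ_apply, htop hjm]
    rw [h1, map_zero, add_zero] at hR
    have h2 := sub_mem hdK (O.G_le_W _ hR)
    rw [sub_sub_cancel, smul_smul] at h2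
    exact (Submodule.smul_mem_iff _ (by positivity)).1 h2
  have ha2 : a + 2 ≠ 0 := by
    have h1 : (j : ℝ) < m := by exact_mod_cast hjm
    have h2 : (m : ℝ) ≤ 2 * p := by exact_mod_cast hm
    rw [ha]; apply ne_of_lt; linarith
  set w₁ := (2 * p : ℝ)⁻¹ • O.d (O.K (p + 1) w) - a • w with hw₁
  obtain ⟨g, hg⟩ : ∃ g, g = w₁ - O.ε (O.θ w) := ⟨_, rfl⟩
  have hgG : g ∈ O.G p := by
    have h1 := Submodule.smul_mem _ (2 * p : ℝ)⁻¹ hR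
    convert h1 using 1
    rw [smul_sub, smul_smul, inv_mul_cancel₀ (by positivity)]
    rw [hg, hw₁]; module
  have hdw₁ : O.d w₁ = -a • O.d w := by
    rw [hw₁, map_sub, map_smul, map_smul, O.d_d]; module
  have hw₁Z : w₁ ∈ O.Z p := by
    constructor
    · have h1 := add_mem (O.G_le_succ _ hgG) (O.ε_mem_G (O.θ_mem_of_mem_Z h))
      rwa [hg, sub_add_cancel] at h1
    · change O.d w₁ ∈ O.G p
      rw [hdw₁]; exact Submodule.smul_mem _ _ h.2
  have hqK : O.q (O.K (p + 1) w) = ((j : ℝ) - 1) • O.K (p + 1) w := by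
    simp only [K_apply, map_add, map_smul, O.q_μ, O.q_δ, O.q_ε, hq, map_sub]
    module
  have hqw₁ : O.q w₁ = (j : ℝ) • w₁ := by
    rw [hw₁]
    simp only [map_sub, map_smul, O.q_d, hqK, hq]
    module
  have hR₁ := key w₁ hw₁Z hqw₁
  have hεw : O.ε (O.θ w) = w₁ - g := by rw [hg]; abel
  -- `(ε θ)² = 2 ε θ` makes `w₁` an eigenvector of `ε θ` with eigenvalue `2`, up to `g`
  have hτ : O.ε (O.θ w₁) = (2 : ℝ) • w₁ - (2 : ℝ) • g + O.ε (O.θ g) := by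
    have : w₁ = O.ε (O.θ w) + g := by rw [hg]; abel
    conv_lhs => rw [this, map_add, map_add, ε_θ_ε, hεw]
    module
  -- `θ dw` has a pole of order at most `p`, since `d dw = 0`
  have hθd : O.θ (O.d w) ∈ O.G p := by
    have h1 := O.d_add_θ_mem_G h.2
    rw [O.d_d, zero_add] at h1
    exact (Submodule.smul_mem_iff _ hp0).1 h1
  have hθg : (p : ℝ) • O.θ g - O.L (O.θ w) ∈ O.G p := by
    have h1 := O.d_add_θ_mem_G hgG
    have h2 : O.d g = O.d w₁ - (O.L (O.θ w) + O.ε (O.θ (O.d w))) := by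
      rw [hg, map_sub, L_apply, d_θ, map_neg]; abel
    have h3 := sub_mem (add_mem h1 (O.ε_mem_G hθd)) hw₁Z.2
    convert h3 using 1
    rw [h2]; abel
  -- `g` occurs through `ε θ g`, and `p ε θ g` is `L (ε θ w) = L w₁ - L g` up to lower poles
  have hεθg : O.ε (O.θ g) ∈ O.W p := by
    have h1 := O.G_le_W p (O.ε_mem_G hθg)
    rw [map_sub, map_smul, ε_L, hεw, map_sub] at h1
    have h2 := O.G_le_W p (O.L_mem_G hgG)
    have h3 : O.L w₁ ∈ O.W p :=
      add_mem (O.d_mem_W (O.ε_mem_G hw₁Z.1)) (O.G_le_W p (O.ε_mem_G hw₁Z.2))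
    have h4 := add_mem h1 (sub_mem h3 h2)
    rw [sub_add_cancel] at h4
    exact (Submodule.smul_mem_iff _ hp0).1 h4
  have hw₁W : w₁ ∈ O.W p := by
    have h1 := sub_mem (O.d_mem_W (O.K_mem_G (p + 1) hw₁Z.1)) (O.G_le_W p hR₁)
    rw [sub_sub_cancel] at h1
    have h2 := (Submodule.smul_mem_iff _ (by positivity)).1 h1
    have h3 := add_mem (sub_mem h2 hεθg) (Submodule.smul_mem _ (2 : ℝ) (O.G_le_W p hgG))
    refine (Submodule.smul_mem_iff _ ha2).1 ?_
    convert h3 using 1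
    rw [hτ]; module
  refine (Submodule.smul_mem_iff _ ha0).1 ?_
  have h1 := sub_mem (Submodule.smul_mem _ (2 * p : ℝ)⁻¹ hdK) hw₁W
  rwa [hw₁, sub_sub_cancel] at h1

/-- The submodule `Z` is stable under `q`, hence splits into eigenspaces of `q`. -/
lemma q_mem_Z {p : ℕ} {w : M} (h : w ∈ O.Z p) : O.q w ∈ O.Z p := by
  refine ⟨O.q_mem_G h.1, ?_⟩
  change O.d (O.q w) ∈ O.G p
  rw [← add_sub_cancel_right (O.d (O.q w)) (O.d w), ← O.q_d]
  exact sub_mem (O.q_mem_G h.2) h.2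

open Polynomial in
/-- If a submodule `W` contains all eigenvectors in a `q`-stable submodule `Z`, with eigenvalues in
`s`, then it contains all vectors of `Z` killed by `∏ j ∈ s, (q - j)`. -/
lemma mem_of_eigenvectors {M : Type*} [AddCommGroup M] [Module ℝ M] {q : Module.End ℝ M}
    {Z W : Submodule ℝ M} (hZ : ∀ w ∈ Z, q w ∈ Z) (s : Finset ℕ)
    (hW : ∀ j ∈ s, ∀ w ∈ Z, q w = (j : ℝ) • w → w ∈ W) (w : M) (hw : w ∈ Z)
    (h0 : (∏ j ∈ s, (X - C (j : ℝ))).aeval q w = 0) : w ∈ W := by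
  have hZf : ∀ f : ℝ[X], ∀ v ∈ Z, f.aeval q v ∈ Z := by
    intro f
    induction f using Polynomial.induction_on' with
    | add f g hf hg =>
      intro v hv; rw [map_add]; exact add_mem (hf v hv) (hg v hv)
    | monomial k c =>
      intro v hv
      have : ∀ k, (q ^ k) v ∈ Z := by
        intro k
        induction k with
        | zero => exact hv
        | succ k ih => rw [pow_succ']; exact hZ _ ih
      rw [aeval_monomial]
      exact Submodule.smul_mem _ c (this k)
  induction s using Finset.induction_on generalizing w with
  | empty => simp at h0; rw [h0]; exact zero_mem _
  | insert a s ha ih =>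
    have ih' := ih fun j hj => hW j (Finset.mem_insert_of_mem hj)
    set P := ∏ j ∈ s, (X - C (j : ℝ)) with hP
    rw [Finset.prod_insert ha] at h0
    have hc : P.eval (a : ℝ) ≠ 0 := by
      rw [hP, eval_prod, Finset.prod_ne_zero_iff]
      intro j hj
      simp only [eval_sub, eval_X, eval_C, sub_ne_zero]
      rintro h
      exact ha (by rw [Nat.cast_injective h]; exact hj)
    obtain ⟨Q, hQ⟩ : (X - C (a : ℝ)) ∣ P - C (P.eval (a : ℝ)) := by
      rw [dvd_iff_isRoot]; simp
    have h1 : ((X - C (a : ℝ)) * Q).aeval q w ∈ W := by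
      refine ih' _ (hZf _ _ hw) ?_
      rw [← Module.End.mul_apply, ← map_mul,
        show P * ((X - C (a : ℝ)) * Q) = Q * ((X - C (a : ℝ)) * P) by ring, map_mul,
        Module.End.mul_apply, h0, map_zero]
    have h2 : P.aeval q w ∈ W := by
      refine hW a (Finset.mem_insert_self _ _) _ (hZf _ _ hw) ?_
      rw [map_mul, Module.End.mul_apply] at h0
      simp only [map_sub, aeval_X, aeval_C, LinearMap.sub_apply, sub_eq_zero] at h0
      exact h0
    rw [← hQ] at h1
    have h3 := sub_mem h2 h1
    simp only [map_sub, aeval_C, LinearMap.sub_apply, sub_sub_cancel] at h3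
    exact (Submodule.smul_mem_iff _ hc).1 h3

open Polynomial in
/-- Modulo exact forms the order of a pole can be lowered, from `p + 1` to `p`, as long as
`p ≥ 1` and `2 p ≥ m`. -/
theorem exists_lower_pole {p : ℕ} (hp : 1 ≤ p) (hm : m ≤ 2 * p) {w : M} (h : w ∈ O.G (p + 1))
    (hd : O.d w ∈ O.G p) : ∃ η ∈ O.G (p + 1), w - O.d η ∈ O.G p := by
  rw [← mem_W]
  -- split `w` into the parts of degree `0, …, m` in the `dxᵢ`
  refine mem_of_eigenvectors (fun w hw => O.q_mem_Z hw) (Finset.range (m + 1)) ?_ w ⟨h, hd⟩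
    (O.q_spec w)
  intro j hj v hv hqv
  refine O.mem_W_of_pure hp hm (Nat.lt_succ_iff.1 (Finset.mem_range.1 hj)) hv hqv ?_
  -- a form of degree `m` in the `dxᵢ` is killed by `t`: else `m + 1` would be an eigenvalue of `q`
  rintro rfl
  have hqt : O.q (O.t v) = ((j : ℝ) + 1) • O.t v := by
    rw [O.q_t, hqv, map_smul]; module
  have h0 := O.q_spec (O.t v)
  rw [Module.End.aeval_apply_of_mem_apply_eq_smul hqt] at h0
  refine (smul_eq_zero.1 h0).resolve_left ?_
  rw [eval_prod, ← ne_eq, Finset.prod_ne_zero_iff]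
  intro i hi
  simp only [eval_sub, eval_X, eval_C]
  have h1 : (i : ℝ) ≤ j := by exact_mod_cast Nat.lt_succ_iff.1 (Finset.mem_range.1 hi)
  linarith

end RadialOps
end Algebra

/-! ### Adding the variables along the zero set -/

section Algebra

/-- Abstract form of the operators on differential forms in coordinates `xᵢ`, `i ∈ I`: `D i` is the
partial derivative `∂ᵢ`, `e i` the exterior product with `dxᵢ`, `c i` the contraction with `∂ᵢ`,
`x i` the multiplication by `xᵢ`, and `u` the inverse of the multiplication by
`μ = ∑ i ∈ T, xᵢ²`. The submodule `A` stands for the forms which extend smoothly across the zero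
set of `μ`. -/
structure CoordOps (I : Type*) [DecidableEq I] (M : Type*) [AddCommGroup M] [Module ℝ M]
    (T : Finset I) where
  D : I → Module.End ℝ M
  e : I → Module.End ℝ M
  c : I → Module.End ℝ M
  x : I → Module.End ℝ M
  u : Module.End ℝ M
  A : Submodule ℝ M
  D_D : ∀ i j w, D i (D j w) = D j (D i w)
  e_e : ∀ i j w, e i (e j w) = -e j (e i w)
  c_c : ∀ i j w, c i (c j w) = -c j (c i w)
  c_e : ∀ i j w, c i (e j w) = (if i = j then w else 0) - e j (c i w)
  D_e : ∀ i j w, D i (e j w) = e j (D i w)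
  D_c : ∀ i j w, D i (c j w) = c j (D i w)
  D_x : ∀ i j w, D i (x j w) = x j (D i w) + (if i = j then w else 0)
  x_x : ∀ i j w, x i (x j w) = x j (x i w)
  e_x : ∀ i j w, e i (x j w) = x j (e i w)
  c_x : ∀ i j w, c i (x j w) = x j (c i w)
  u_μ : ∀ w, u (∑ i ∈ T, x i (x i w)) = w
  μ_u : ∀ w, ∑ i ∈ T, x i (x i (u w)) = w
  D_mem : ∀ i, ∀ w ∈ A, D i w ∈ A
  e_mem : ∀ i, ∀ w ∈ A, e i w ∈ A
  c_mem : ∀ i, ∀ w ∈ A, c i w ∈ A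
  x_mem : ∀ i, ∀ w ∈ A, x i w ∈ A

namespace CoordOps

variable {I : Type*} [DecidableEq I] {M : Type*} [AddCommGroup M] [Module ℝ M] {T : Finset I}
  (O : CoordOps I M T)

/-- The exterior derivative in the variables of `S`. -/
def d (S : Finset I) : Module.End ℝ M := ∑ i ∈ S, O.e i * O.D i

/-- The number operator: the degree of forms in the `dxᵢ`, `i ∈ S`. -/
def q (S : Finset I) : Module.End ℝ M := ∑ i ∈ S, O.e i * O.c i

/-- The multiplication by `μ`. -/
def μ : Module.End ℝ M := ∑ i ∈ T, O.x i * O.x i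

lemma d_apply (S : Finset I) (w : M) : O.d S w = ∑ i ∈ S, O.e i (O.D i w) := by
  simp [d, LinearMap.sum_apply]

lemma q_apply (S : Finset I) (w : M) : O.q S w = ∑ i ∈ S, O.e i (O.c i w) := by
  simp [q, LinearMap.sum_apply]

lemma μ_apply (w : M) : O.μ w = ∑ i ∈ T, O.x i (O.x i w) := by
  simp [μ, LinearMap.sum_apply]

lemma eq_zero_of_eq_neg {v : M} (h : v = -v) : v = 0 := by
  have h1 : (2 : ℝ) • v = 0 := by
    rw [two_smul]; nth_rewrite 1 [h]; simp
  exact (smul_eq_zero.1 h1).resolve_left two_ne_zero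

lemma e_self (i : I) (w : M) : O.e i (O.e i w) = 0 := eq_zero_of_eq_neg (O.e_e i i w)

lemma c_self (i : I) (w : M) : O.c i (O.c i w) = 0 := eq_zero_of_eq_neg (O.c_c i i w)

/-- A double sum over an antisymmetric family vanishes. -/
lemma sum_sum_eq_zero (S : Finset I) (f : I → I → M) (h : ∀ i j, f i j = -f j i) :
    ∑ i ∈ S, ∑ j ∈ S, f i j = 0 := by
  refine eq_zero_of_eq_neg ?_
  conv_lhs => rw [Finset.sum_comm]
  rw [← Finset.sum_neg_distrib]
  refine Finset.sum_congr rfl fun i _ => ?_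
  rw [← Finset.sum_neg_distrib]
  exact Finset.sum_congr rfl fun j _ => h j i

/-- If `a` and `b` agree on the range of `n` and `b` commutes with `n`, then all polynomials in `a`
and `b` agree on the range of `n`. -/
lemma aeval_mul_of_commute {R : Type*} [Ring R] [Algebra ℝ R] {a b n : R} (hab : a * n = b * n)
    (hb : Commute b n) (f : Polynomial ℝ) : f.aeval a * n = f.aeval b * n := by
  have h : ∀ k, a ^ k * n = b ^ k * n := by
    intro k
    induction k with
    | zero => simp
    | succ k ih =>
      rw [pow_succ', mul_assoc, ih, (hb.pow_left k).eq, ← mul_assoc, hab, mul_assoc,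
        ← (hb.pow_left k).eq, ← mul_assoc, ← pow_succ']
  induction f using Polynomial.induction_on' with
  | add f g hf hg => simp only [map_add, add_mul, hf, hg]
  | monomial k c => simp only [Polynomial.aeval_monomial, mul_assoc, h]

/-- The operator `dxᵢ ∧ ι_{∂ᵢ}` is the projection to the forms divisible by `dxᵢ`. -/
lemma n_n (i : I) (w : M) : O.e i (O.c i (O.e i (O.c i w))) = O.e i (O.c i w) := by
  rw [O.c_e, O.c_self]; simp

lemma n_comm {i j : I} (h : i ≠ j) (w : M) :
    O.e i (O.c i (O.e j (O.c j w))) = O.e j (O.c j (O.e i (O.c i w))) := by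
  rw [O.c_e, O.c_e, if_neg h, if_neg h.symm, O.c_c i j]
  simp only [zero_sub, map_neg]
  rw [O.e_e i j, neg_neg]

open Polynomial in
/-- The eigenvalues of the number operator are `0, …, |S|`: it is a sum of `|S|` commuting
idempotents. -/
lemma q_spec (S : Finset I) :
    (∏ j ∈ Finset.range (S.card + 1), (X - C (j : ℝ))).aeval (O.q S) = 0 := by
  induction S using Finset.induction_on with
  | empty => simp [q]
  | insert a S ha ih =>
    set n : Module.End ℝ M := O.e a * O.c a with hn
    have hnn : n * n = n := LinearMap.ext fun w => O.n_n a w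
    have hq : O.q (insert a S) = O.q S + n := by
      rw [q, Finset.sum_insert ha, add_comm]; rfl
    have hc : Commute (O.q S) n := by
      refine Commute.sum_left _ _ _ fun i hi => LinearMap.ext fun w => ?_
      exact O.n_comm (by rintro rfl; exact ha hi) w
    rw [Finset.card_insert_of_notMem ha]
    set P := ∏ j ∈ Finset.range (S.card + 1), (X - C (j : ℝ)) with hP
    -- `q` equals `O.q S + 1` on the range of `n` and `O.q S` on the range of `1 - n`
    have h1 := aeval_mul_of_commute (a := O.q (insert a S)) (b := O.q S + 1) (n := n)
      (by rw [hq, add_mul, add_mul, hnn, one_mul]) (hc.add_left (Commute.one_left n))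
      (∏ j ∈ Finset.range (S.card + 1 + 1), (X - C (j : ℝ)))
    have h2 := aeval_mul_of_commute (a := O.q (insert a S)) (b := O.q S) (n := 1 - n)
      (by rw [hq, add_mul, mul_sub n, hnn, mul_one, sub_self, add_zero])
      ((Commute.one_right _).sub_right hc)
      (∏ j ∈ Finset.range (S.card + 1 + 1), (X - C (j : ℝ)))
    have h3 : (∏ j ∈ Finset.range (S.card + 1 + 1), (X - C (j : ℝ))).aeval (O.q S) = 0 := by
      rw [Finset.prod_range_succ, map_mul, ih, zero_mul]
    have h4 : (∏ j ∈ Finset.range (S.card + 1 + 1), (X - C (j : ℝ))).aeval (O.q S + 1) = 0 := by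
      have : O.q S + 1 = aeval (O.q S) (X + 1 : ℝ[X]) := by simp
      rw [this, ← aeval_comp, prod_comp, Finset.prod_range_succ']
      have h5 : ∏ k ∈ Finset.range (S.card + 1), (X - C ((k + 1 : ℕ) : ℝ)).comp (X + 1) = P := by
        rw [hP]
        refine Finset.prod_congr rfl fun k _ => ?_
        simp
      rw [h5, map_mul, ih, zero_mul]
    rw [h4, zero_mul] at h1
    rw [h3, zero_mul] at h2
    have h5 := congrArg₂ (· + ·) h1 h2
    simp only [← mul_add, add_sub_cancel, mul_one, add_zero] at h5
    exact h5

lemma q_e {S : Finset I} {i : I} (h : i ∈ S) (w : M) :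
    O.q S (O.e i w) = O.e i (O.q S w) + O.e i w := by
  have h1 : ∀ j, O.e j (O.c j (O.e i w)) = O.e i (O.e j (O.c j w)) + if j = i then O.e j w else 0 := by
    intro j
    rw [O.c_e, map_sub, O.e_e j i, apply_ite (O.e j), map_zero]; abel
  simp only [q_apply, h1, Finset.sum_add_distrib, map_sum, Finset.sum_ite_eq', if_pos h]

lemma q_c {S : Finset I} {i : I} (h : i ∈ S) (w : M) :
    O.q S (O.c i w) = O.c i (O.q S w) - O.c i w := by
  have h1 : ∀ j, O.e j (O.c j (O.c i w)) = O.c i (O.e j (O.c j w)) - if i = j then O.c j w else 0 := by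
    intro j
    rw [O.c_e, O.c_c j i, map_neg]; abel
  simp only [q_apply, h1, Finset.sum_sub_distrib, map_sum, Finset.sum_ite_eq, if_pos h]

lemma q_x (S : Finset I) (i : I) (w : M) : O.q S (O.x i w) = O.x i (O.q S w) := by
  simp only [q_apply, map_sum, O.c_x, O.e_x]

lemma q_D (S : Finset I) (i : I) (w : M) : O.q S (O.D i w) = O.D i (O.q S w) := by
  simp only [q_apply, map_sum, O.D_c, O.D_e]

lemma D_μ {i : I} (h : i ∈ T) (w : M) : O.D i (O.μ w) = O.μ (O.D i w) + (2 : ℝ) • O.x i w := by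
  have h1 : ∀ j, O.D i (O.x j (O.x j w))
      = O.x j (O.x j (O.D i w)) + (2 : ℝ) • if i = j then O.x j w else 0 := by
    intro j
    rw [O.D_x, O.D_x, map_add]
    split_ifs <;> simp [two_smul]
    abel
  simp only [μ_apply, map_sum, h1, Finset.sum_add_distrib, ← Finset.smul_sum, Finset.sum_ite_eq,
    if_pos h]

lemma D_μ_of_notMem {i : I} (h : i ∉ T) (w : M) : O.D i (O.μ w) = O.μ (O.D i w) := by
  simp only [μ_apply, map_sum]
  refine Finset.sum_congr rfl fun j hj => ?_
  have : i ≠ j := by rintro rfl; exact h hj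
  simp [O.D_x, this]

lemma μ_e (i : I) (w : M) : O.μ (O.e i w) = O.e i (O.μ w) := by
  simp only [μ_apply, map_sum, O.e_x]

lemma μ_c (i : I) (w : M) : O.μ (O.c i w) = O.c i (O.μ w) := by
  simp only [μ_apply, map_sum, O.c_x]

lemma μ_x (i : I) (w : M) : O.μ (O.x i w) = O.x i (O.μ w) := by
  simp only [μ_apply, map_sum, O.x_x _ i]

lemma sum_sum_add (S : Finset I) (f g : I → I → M) (a : I → M)
    (h : ∀ i j, f i j = g i j + if i = j then a i else 0) :
    ∑ i ∈ S, ∑ j ∈ S, f i j = ∑ i ∈ S, ∑ j ∈ S, g i j + ∑ i ∈ S, a i := by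
  rw [← Finset.sum_add_distrib]
  refine Finset.sum_congr rfl fun i hi => ?_
  simp only [h, Finset.sum_add_distrib, Finset.sum_ite_eq, if_pos hi]

/-- The operators in the variables `xᵢ`, `i ∈ T`, transverse to the zero set of `μ`. -/
def radial : RadialOps M T.card where
  d := O.d T
  δ := ∑ i ∈ T, O.c i * O.D i
  ε := ∑ i ∈ T, O.x i * O.c i
  t := ∑ i ∈ T, O.x i * O.e i
  q := O.q T
  μ := O.μ
  u := O.u
  A := O.A
  d_d w := by
    simp only [d_apply, map_sum, O.D_e]
    exact sum_sum_eq_zero _ _ fun i j => by rw [O.e_e, O.D_D]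
  ε_ε w := by
    simp only [LinearMap.sum_apply, Module.End.mul_apply, map_sum, O.c_x]
    exact sum_sum_eq_zero _ _ fun i j => by rw [O.c_c, O.x_x, map_neg, map_neg]
  t_t w := by
    simp only [LinearMap.sum_apply, Module.End.mul_apply, map_sum, O.e_x]
    exact sum_sum_eq_zero _ _ fun i j => by rw [O.e_e, O.x_x, map_neg, map_neg]
  d_μ w := by
    simp only [LinearMap.sum_apply, Module.End.mul_apply, d_apply, Finset.smul_sum, map_sum,
      ← Finset.sum_add_distrib]
    exact Finset.sum_congr rfl fun i hi => by rw [O.D_μ hi, map_add, map_smul, O.μ_e, O.e_x]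
  δ_μ w := by
    simp only [LinearMap.sum_apply, Module.End.mul_apply, Finset.smul_sum, map_sum,
      ← Finset.sum_add_distrib]
    exact Finset.sum_congr rfl fun i hi => by rw [O.D_μ hi, map_add, map_smul, O.μ_c, O.c_x]
  ε_t w := by
    rw [eq_sub_iff_add_eq]
    simp only [LinearMap.sum_apply, Module.End.mul_apply, map_sum, μ_apply]
    rw [add_comm, Finset.sum_comm, ← Finset.sum_add_distrib]
    simp only [← Finset.sum_add_distrib]
    refine (sum_sum_add T _ (fun _ _ => 0) (fun i => O.x i (O.x i w)) fun i j => ?_).trans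
      (by simp)
    rw [O.c_x, O.e_x, O.c_e, O.x_x j i]
    by_cases h : i = j
    · subst h; simp
    · simp [h, Ne.symm h]
  t_δ w := by
    rw [eq_sub_iff_add_eq, eq_sub_iff_add_eq]
    simp only [LinearMap.sum_apply, Module.End.mul_apply, map_sum, d_apply, q_apply]
    have h1 := sum_sum_add T (fun i j => O.x i (O.e i (O.c j (O.D j w)))
        + O.c j (O.D j (O.x i (O.e i w)))) (fun _ _ => 0)
        (fun i => O.x i (O.D i w) + (w - O.e i (O.c i w))) fun i j => by
      rw [O.D_x, map_add, O.c_x, O.D_e, O.c_e]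
      by_cases h : i = j
      · subst h; simp only [if_true, O.c_e, map_sub, zero_add]; abel
      · simp [h, Ne.symm h]
    have h2 := sum_sum_add T (fun i j => O.e i (O.D i (O.x j (O.c j w)))
        + O.x j (O.c j (O.e i (O.D i w)))) (fun _ _ => 0)
        (fun i => O.x i (O.D i w) + O.e i (O.c i w)) fun i j => by
      rw [O.D_x, map_add, O.e_x, O.D_c, O.c_e]
      by_cases h : i = j
      · subst h; simp [add_comm]
      · simp [h, Ne.symm h]
    simp only [Finset.sum_add_distrib, Finset.sum_const_zero, zero_add, Finset.sum_sub_distrib,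
      Finset.sum_const] at h1 h2
    rw [Finset.sum_comm (f := fun i j => O.e i (O.D i (O.x j (O.c j w))))] at h2
    rw [Finset.sum_comm (f := fun i j => O.x j (O.e j (O.c i (O.D i w)))), h1, h2, ← Nat.cast_smul_eq_nsmul ℝ]
    module
  q_d w := by
    simp only [d_apply, map_sum, ← Finset.sum_add_distrib]
    exact Finset.sum_congr rfl fun i hi => by rw [O.q_e hi, O.q_D]
  q_δ w := by
    simp only [LinearMap.sum_apply, Module.End.mul_apply, map_sum, ← Finset.sum_sub_distrib]
    exact Finset.sum_congr rfl fun i hi => by rw [O.q_c hi, O.q_D]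
  q_ε w := by
    simp only [LinearMap.sum_apply, Module.End.mul_apply, map_sum, ← Finset.sum_sub_distrib]
    exact Finset.sum_congr rfl fun i hi => by rw [O.q_x, O.q_c hi, map_sub]
  q_t w := by
    simp only [LinearMap.sum_apply, Module.End.mul_apply, map_sum, ← Finset.sum_add_distrib]
    exact Finset.sum_congr rfl fun i hi => by rw [O.q_x, O.q_e hi, map_add]
  q_μ w := by
    simp only [μ_apply, map_sum, O.q_x]
  t_μ w := by
    simp only [LinearMap.sum_apply, Module.End.mul_apply, map_sum, O.μ_x, O.μ_e]
  ε_μ w := by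
    simp only [LinearMap.sum_apply, Module.End.mul_apply, map_sum, O.μ_x, O.μ_c]
  u_μ w := by rw [μ_apply]; exact O.u_μ w
  μ_u w := by rw [μ_apply]; exact O.μ_u w
  q_spec w := by rw [O.q_spec]; rfl
  d_mem w hw := by
    rw [d_apply]; exact sum_mem fun i _ => O.e_mem i _ (O.D_mem i _ hw)
  δ_mem w hw := by
    rw [LinearMap.sum_apply]; exact sum_mem fun i _ => O.c_mem i _ (O.D_mem i _ hw)
  ε_mem w hw := by
    rw [LinearMap.sum_apply]; exact sum_mem fun i _ => O.x_mem i _ (O.c_mem i _ hw)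
  t_mem w hw := by
    rw [LinearMap.sum_apply]; exact sum_mem fun i _ => O.x_mem i _ (O.e_mem i _ hw)
  q_mem w hw := by
    rw [q_apply]; exact sum_mem fun i _ => O.e_mem i _ (O.c_mem i _ hw)

/-- The forms with a pole of order at most `p`. -/
def G (p : ℕ) : Submodule ℝ M := O.radial.G p

lemma e_mem_G {p : ℕ} (i : I) {w : M} (h : w ∈ O.G p) : O.e i w ∈ O.G p := by
  change (O.μ ^ p) (O.e i w) ∈ O.A
  have h1 := O.radial.commute_pow (T := O.e i) (fun w => (O.μ_e i w).symm) p w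
  rw [show (O.μ ^ p) (O.e i w) = _ from h1.symm]
  exact O.e_mem i _ h

lemma c_mem_G {p : ℕ} (i : I) {w : M} (h : w ∈ O.G p) : O.c i w ∈ O.G p := by
  change (O.μ ^ p) (O.c i w) ∈ O.A
  have h1 := O.radial.commute_pow (T := O.c i) (fun w => (O.μ_c i w).symm) p w
  rw [show (O.μ ^ p) (O.c i w) = _ from h1.symm]
  exact O.c_mem i _ h

lemma D_mem_G {p : ℕ} {i : I} (hi : i ∉ T) {w : M} (h : w ∈ O.G p) : O.D i w ∈ O.G p := by
  change (O.μ ^ p) (O.D i w) ∈ O.A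
  have h1 := O.radial.commute_pow (T := O.D i) (fun w => O.D_μ_of_notMem hi w) p w
  rw [show (O.μ ^ p) (O.D i w) = _ from h1.symm]
  exact O.D_mem i _ h

lemma d_insert {S : Finset I} {a : I} (ha : a ∉ S) (w : M) :
    O.d (insert a S) w = O.d S w + O.e a (O.D a w) := by
  rw [d_apply, d_apply, Finset.sum_insert ha, add_comm]

lemma d_e_c {S : Finset I} {a : I} (ha : a ∉ S) (w : M) :
    O.d S (O.e a (O.c a w)) = O.e a (O.c a (O.d S w)) := by
  simp only [d_apply, map_sum]
  refine Finset.sum_congr rfl fun i hi => ?_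
  have : a ≠ i := by rintro rfl; exact ha hi
  rw [O.D_e, O.D_c, O.c_e, if_neg this, zero_sub, map_neg, O.e_e a i, neg_neg]

/-- The order of a pole can be lowered modulo exact forms, for the exterior derivative in a set of
variables containing the transverse ones. The remaining variables are added one at a time, splitting
forms into the part divisible by `dx_a` and the part not involving `dx_a`. -/
theorem exists_lower_pole {p : ℕ} (hp : 1 ≤ p) (hm : T.card ≤ 2 * p) (S : Finset I)
    (hS : Disjoint T S) {w : M} (h : w ∈ O.G (p + 1)) (hd : O.d (T ∪ S) w ∈ O.G p) :
    ∃ η ∈ O.G (p + 1), w - O.d (T ∪ S) η ∈ O.G p := by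
  induction S using Finset.induction_on generalizing w with
  | empty =>
    rw [Finset.union_empty] at *
    exact O.radial.exists_lower_pole hp hm h hd
  | insert a S ha ih =>
    have hTS : Disjoint T S := hS.mono_right (Finset.subset_insert _ _)
    have haT : a ∉ T := fun h => Finset.disjoint_left.1 hS h (Finset.mem_insert_self _ _)
    have haTS : a ∉ T ∪ S := by simp [ha, haT]
    rw [Finset.union_insert] at *
    have ih := fun w => @ih hTS w
    set d := O.d (T ∪ S) with hd_def
    have hdi : ∀ v, O.d (insert a (T ∪ S)) v = d v + O.e a (O.D a v) := O.d_insert haTS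
    set n : Module.End ℝ M := O.e a * O.c a with hn
    have hdn : ∀ v, d (n v) = n (d v) := O.d_e_c haTS
    have hnG : ∀ {q : ℕ} {v}, v ∈ O.G q → n v ∈ O.G q := fun h => O.e_mem_G a (O.c_mem_G a h)
    have hne : ∀ v, n (O.e a v) = O.e a v := fun v => by
      simp [hn, O.c_e, O.e_self]
    have hen : ∀ v, O.e a (n v) = 0 := fun v => O.e_self a _
    have hDn : ∀ v, O.D a (n v) = n (O.D a v) := fun v => by
      simp [hn, O.D_e, O.D_c]
    have hnn : ∀ v, n (n v) = n v := O.n_n a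
    -- the part of `w` not involving `dx_a`
    obtain ⟨η₀, hη₀, h0⟩ := ih (w - n w) (sub_mem h (hnG h)) (by
      have h1 := sub_mem hd (hnG hd)
      rw [hdi, map_add, hne] at h1
      rw [map_sub, hdn]
      convert h1 using 1
      abel)
    have hη₀' : η₀ - n η₀ ∈ O.G (p + 1) := sub_mem hη₀ (hnG hη₀)
    obtain ⟨w₁, hw₁⟩ : ∃ w₁, w₁ = w - O.d (insert a (T ∪ S)) (η₀ - n η₀) := ⟨_, rfl⟩
    have hw₁G : w₁ - n w₁ ∈ O.G p := by
      have h1 := sub_mem h0 (hnG h0)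
      convert h1 using 1
      simp only [hw₁, hdi, map_sub, map_add, hdn, hne, hnn]
      abel
    have hdd : ∀ S v, O.d S (O.d S v) = 0 := fun S v => by
      simp only [d_apply, map_sum, O.D_e]
      exact sum_sum_eq_zero _ _ fun i j => by rw [O.e_e, O.D_D]
    have hdw₁ : O.d (insert a (T ∪ S)) w₁ ∈ O.G p := by
      rw [hw₁, map_sub, hdd, sub_zero]; exact hd
    have hnw₁ : n w₁ ∈ O.G (p + 1) := by
      have h1 : n w - n (O.d (insert a (T ∪ S)) (η₀ - n η₀)) = n w - O.e a (O.D a (η₀ - n η₀)) := by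
        rw [hdi, map_add, hne, map_sub d, hdn, map_sub n (d η₀), hnn, sub_self, zero_add]
      rw [hw₁, map_sub, h1]
      exact sub_mem (hnG h) (O.e_mem_G a (O.D_mem_G haT hη₀'))
    -- the part of `w₁` divisible by `dx_a`
    obtain ⟨η₁, hη₁, h1⟩ := ih (n w₁) hnw₁ (by
      have h1 := hnG hdw₁
      have h2 := O.e_mem_G a (O.D_mem_G haT hw₁G)
      have h3 := sub_mem h1 h2
      rw [hdi, map_add, hne] at h3
      rw [hdn]
      convert h3 using 1
      rw [map_sub, map_sub, hDn, hen]
      abel)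
    refine ⟨η₀ - n η₀ + n η₁, add_mem hη₀' (hnG hη₁), ?_⟩
    have h2 := add_mem hw₁G (hnG h1)
    convert h2 using 1
    rw [map_add, ← sub_sub, ← hw₁, hdi (n η₁), hDn, hen, hdn, map_sub, hnn]
    abel

/-- A form whose differential has a pole of order at most `r`, `|T| ≤ 2 r`, differs from a form with
a pole of order at most `r` by an exact form. -/
theorem exists_reduction [Fintype I] {r : ℕ} (hr : 1 ≤ r) (hm : T.card ≤ 2 * r) (k : ℕ) {w : M}
    (h : w ∈ O.G (r + k)) (hd : O.d Finset.univ w ∈ O.G r) :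
    ∃ η ∈ O.G (r + k), w - O.d Finset.univ η ∈ O.G r := by
  have hmono : ∀ k, O.G r ≤ O.G (r + k) := by
    intro k
    induction k with
    | zero => exact le_rfl
    | succ k ih => exact ih.trans (O.radial.G_le_succ _)
  have hdd : ∀ v, O.d Finset.univ (O.d Finset.univ v) = 0 := fun v => by
    simp only [d_apply, map_sum, O.D_e]
    exact sum_sum_eq_zero _ _ fun i j => by rw [O.e_e, O.D_D]
  induction k generalizing w with
  | zero => exact ⟨0, zero_mem _, by simpa using h⟩
  | succ k ih =>
    have hu : T ∪ Tᶜ = Finset.univ := Finset.union_compl T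
    obtain ⟨η, hη, h1⟩ := O.exists_lower_pole (p := r + k) (by omega) (by omega) Tᶜ
      disjoint_compl_right h (by rw [hu]; exact hmono k hd)
    rw [hu] at h1
    obtain ⟨η', hη', h2⟩ := ih h1 (by rw [map_sub, hdd, sub_zero]; exact hd)
    refine ⟨η + η', add_mem hη (O.radial.G_le_succ _ hη'), ?_⟩
    rwa [map_add, ← sub_sub]

end CoordOps
end Algebra

/-! ### Exterior products and contractions -/

section Exterior

variable {E : Type*} [NormedAddCommGroup E] [NormedSpace ℝ E]
  {F : Type*} [NormedAddCommGroup F] [NormedSpace ℝ F] {k : ℕ}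

open ContinuousAlternatingMap

/-- The exterior product with a linear form. -/
def extMul (φ : E →L[ℝ] ℝ) : (E [⋀^Fin k]→L[ℝ] F) →L[ℝ] E [⋀^Fin (k + 1)]→L[ℝ] F :=
  alternatizeUncurryFinCLM ℝ E F ∘L ContinuousLinearMap.smulRightL ℝ E _ φ

lemma extMul_eq (φ : E →L[ℝ] ℝ) (α : E [⋀^Fin k]→L[ℝ] F) :
    extMul φ α = .alternatizeUncurryFin (φ.smulRight α) := rfl

lemma extMul_apply (φ : E →L[ℝ] ℝ) (α : E [⋀^Fin k]→L[ℝ] F) (v : Fin (k + 1) → E) :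
    extMul φ α v = ∑ i : Fin (k + 1), (-1 : ℤ) ^ (i : ℕ) • φ (v i) • α (i.removeNth v) := by
  rw [extMul_eq, alternatizeUncurryFin_apply]; rfl

/-- The contraction with a vector. -/
def contr (v : E) : (E [⋀^Fin (k + 1)]→L[ℝ] F) →L[ℝ] E [⋀^Fin k]→L[ℝ] F :=
  ContinuousLinearMap.apply ℝ _ v ∘L curryLeftLI.toContinuousLinearMap

lemma contr_apply (v : E) (α : E [⋀^Fin (k + 1)]→L[ℝ] F) (w : Fin k → E) :
    contr v α w = α (Matrix.vecCons v w) := rfl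

lemma contr_eq (v : E) (α : E [⋀^Fin (k + 1)]→L[ℝ] F) : contr v α = α.curryLeft v := rfl

lemma extMul_extMul (φ ψ : E →L[ℝ] ℝ) (α : E [⋀^Fin k]→L[ℝ] F) :
    extMul φ (extMul ψ α) = -extMul ψ (extMul φ α) := by
  have h := alternatizeUncurryFin_alternatizeUncurryFinCLM_comp_of_symmetric
    (f := φ.smulRight (ψ.smulRight α) + ψ.smulRight (φ.smulRight α)) fun x y => by
      simp [smul_smul, mul_comm, add_comm]
  have h1 : alternatizeUncurryFinCLM ℝ E F ∘L
      (φ.smulRight (ψ.smulRight α) + ψ.smulRight (φ.smulRight α))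
      = φ.smulRight (extMul ψ α) + ψ.smulRight (extMul φ α) := by
    ext1 x
    simp [extMul_eq, alternatizeUncurryFinCLM_apply]
  rw [h1, alternatizeUncurryFin_add] at h
  exact eq_neg_of_add_eq_zero_left h

lemma contr_contr (u v : E) (α : E [⋀^Fin (k + 2)]→L[ℝ] F) :
    contr u (contr v α) = -contr v (contr u α) := by
  have h := curryLeft_same α (u + v)
  simp only [map_add, curryLeft_add, _root_.add_apply, curryLeft_same, zero_add,
    add_zero] at h
  rw [eq_neg_iff_add_eq_zero, add_comm]
  simpa only [contr_eq, add_comm] using h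

lemma contr_extMul (v : E) (φ : E →L[ℝ] ℝ) (α : E [⋀^Fin (k + 1)]→L[ℝ] F) :
    contr v (extMul φ α) = φ v • α - extMul φ (contr v α) := by
  ext w
  change extMul φ α (Matrix.vecCons v w) = φ v • α w - extMul φ (contr v α) w
  rw [extMul_apply, extMul_apply, Fin.sum_univ_succ, sub_eq_add_neg, ← Finset.sum_neg_distrib]
  congr 1
  · simp [Matrix.vecCons]
  · refine Finset.sum_congr rfl fun i _ => ?_
    have h1 : i.succ.removeNth (Matrix.vecCons v w) = Matrix.vecCons v (i.removeNth w) := by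
      ext1 j
      cases j using Fin.cases <;> simp [Fin.removeNth]
    rw [h1, contr_apply]
    simp [pow_succ]

lemma contr_extMul_zero (v : E) (φ : E →L[ℝ] ℝ) (α : E [⋀^Fin 0]→L[ℝ] F) :
    contr v (extMul φ α) = φ v • α := by
  ext w
  rw [contr_apply, extMul_apply, Fin.sum_univ_succ]
  simp only [Finset.univ_eq_empty, Finset.sum_empty, add_zero]
  simp [Matrix.vecCons]

/-- The exterior derivative in coordinates: `dα = ∑ dxᵢ ∧ ∂ᵢ α`. -/
lemma extDeriv_eq_sum {n : ℕ} (α : EuclideanSpace ℝ (Fin n) → EuclideanSpace ℝ (Fin n) [⋀^Fin k]→L[ℝ] F)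
    (x : EuclideanSpace ℝ (Fin n)) :
    extDeriv α x = ∑ i, extMul (EuclideanSpace.proj i)
      (fderiv ℝ α x (EuclideanSpace.single i 1)) := by
  have h : fderiv ℝ α x = ∑ i, (EuclideanSpace.proj i : EuclideanSpace ℝ (Fin n) →L[ℝ] ℝ).smulRight
      (fderiv ℝ α x (EuclideanSpace.single i 1)) := by
    ext1 y
    conv_lhs => rw [← (EuclideanSpace.basisFun (Fin n) ℝ).sum_repr y]
    simp
  rw [extDeriv]
  conv_lhs => rw [h]
  rw [← alternatizeUncurryFinCLM_apply, _root_.map_sum]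
  rfl

end Exterior

/-! ### Operators on smooth functions -/

section SmoothFun

variable {E : Type*} [NormedAddCommGroup E] [NormedSpace ℝ E]
  {F F' : Type*} [NormedAddCommGroup F] [NormedSpace ℝ F]
  [NormedAddCommGroup F'] [NormedSpace ℝ F'] {U : Set E}

/-- The smooth functions on the set `U`, as functions which vanish outside `U`. -/
def smoothFun (U : Set E) (F : Type*) [NormedAddCommGroup F] [NormedSpace ℝ F] :
    Submodule ℝ (E → F) where
  carrier := {f | ContDiffOn ℝ ∞ f U ∧ ∀ x ∉ U, f x = 0}
  add_mem' hf hg := ⟨hf.1.add hg.1, fun x hx => by simp [hf.2 x hx, hg.2 x hx]⟩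
  zero_mem' := ⟨contDiffOn_const, fun _ _ => rfl⟩
  smul_mem' c f hf := ⟨contDiffOn_const.smul hf.1, fun x hx => by simp [hf.2 x hx]⟩

namespace smoothFun

lemma ext' {f g : smoothFun U F} (h : ∀ x ∈ U, f.1 x = g.1 x) : f = g := by
  ext x
  by_cases hx : x ∈ U
  · exact h x hx
  · rw [f.2.2 x hx, g.2.2 x hx]

/-- A function which is smooth on `U`, modified to vanish outside `U`. -/
def mk (f : E → F) (hf : ContDiffOn ℝ ∞ f U) : smoothFun U F :=
  ⟨U.indicator f, hf.congr fun _ hx => indicator_of_mem hx f, fun _ hx => indicator_of_notMem hx f⟩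

lemma mk_apply {f : E → F} {hf : ContDiffOn ℝ ∞ f U} {x : E} (hx : x ∈ U) : (mk f hf).1 x = f x :=
  indicator_of_mem hx f

lemma differentiableAt (hU : IsOpen U) (f : smoothFun U F) {x : E} (hx : x ∈ U) :
    DifferentiableAt ℝ f.1 x :=
  (f.2.1.contDiffAt (hU.mem_nhds hx)).differentiableAt (by simp)

lemma contDiffOn_pd (hU : IsOpen U) (v : E) (f : smoothFun U F) :
    ContDiffOn ℝ ∞ (fun x => fderiv ℝ f.1 x v) U :=
  (f.2.1.fderiv_of_isOpen (m := ∞) hU (by simp)).clm_apply contDiffOn_const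

/-- The derivative in the direction of the vector `v`. -/
def pd (hU : IsOpen U) (v : E) : smoothFun U F →ₗ[ℝ] smoothFun U F where
  toFun f := mk (fun x => fderiv ℝ f.1 x v) (contDiffOn_pd hU v f)
  map_add' f g := ext' fun x hx => by
    change (mk _ _).1 x = (mk _ (contDiffOn_pd hU v f)).1 x + (mk _ (contDiffOn_pd hU v g)).1 x
    rw [mk_apply hx, mk_apply hx, mk_apply hx]
    change fderiv ℝ (f.1 + g.1) x v = _
    rw [fderiv_add (differentiableAt hU f hx) (differentiableAt hU g hx)]; rfl
  map_smul' c f := ext' fun x hx => by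
    change (mk _ _).1 x = c • (mk _ (contDiffOn_pd hU v f)).1 x
    rw [mk_apply hx, mk_apply hx]
    change fderiv ℝ (c • f.1) x v = _
    rw [fderiv_const_smul (differentiableAt hU f hx)]; rfl

lemma pd_apply (hU : IsOpen U) (v : E) (f : smoothFun U F) {x : E} (hx : x ∈ U) :
    (pd hU v f).1 x = fderiv ℝ f.1 x v := mk_apply (hf := contDiffOn_pd hU v f) hx

/-- The multiplication by a smooth real function. -/
def mul (g : E → ℝ) (hg : ContDiffOn ℝ ∞ g U) : smoothFun U F →ₗ[ℝ] smoothFun U F where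
  toFun f := ⟨fun x => g x • f.1 x, hg.smul f.2.1, fun x hx => by simp [f.2.2 x hx]⟩
  map_add' f h := by ext x; exact smul_add _ _ _
  map_smul' c f := by ext x; exact smul_comm _ _ _

lemma mul_apply (g : E → ℝ) (hg : ContDiffOn ℝ ∞ g U) (f : smoothFun U F) (x : E) :
    (mul g hg f).1 x = g x • f.1 x := rfl

/-- The composition with a continuous linear map of the target spaces. -/
def post (T : F →L[ℝ] F') : smoothFun U F →ₗ[ℝ] smoothFun U F' where
  toFun f := ⟨fun x => T (f.1 x), T.contDiff.comp_contDiffOn f.2.1, fun x hx => by simp [f.2.2 x hx]⟩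
  map_add' f h := by ext x; exact map_add T _ _
  map_smul' c f := by ext x; exact map_smul T _ _

lemma post_apply (T : F →L[ℝ] F') (f : smoothFun U F) (x : E) : (post T f).1 x = T (f.1 x) := rfl

lemma pd_pd (hU : IsOpen U) (u v : E) (f : smoothFun U F) :
    pd hU u (pd hU v f) = pd hU v (pd hU u f) := by
  have h : ∀ u v, ∀ x ∈ U, (pd hU u (pd hU v f)).1 x = fderiv ℝ (fderiv ℝ f.1) x u v := by
    intro u v x hx
    rw [pd_apply _ _ _ hx]
    have h1 : (pd hU v f).1 =ᶠ[𝓝 x] fun y => fderiv ℝ f.1 y v := by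
      filter_upwards [hU.mem_nhds hx] with y hy using pd_apply hU v f hy
    have h2 : DifferentiableAt ℝ (fderiv ℝ f.1) x :=
      ((f.2.1.fderiv_of_isOpen (m := ∞) hU (by simp)).contDiffAt
        (hU.mem_nhds hx)).differentiableAt (by simp)
    rw [h1.fderiv_eq, fderiv_clm_apply h2 (differentiableAt_const v)]
    simp
  refine ext' fun x hx => ?_
  rw [h u v x hx, h v u x hx]
  exact ((f.2.1.contDiffAt (hU.mem_nhds hx)).isSymmSndFDerivAt two_le_infty).eq u v

lemma pd_mul (hU : IsOpen U) (v : E) (g : E → ℝ) (hg : ContDiffOn ℝ ∞ g U)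
    (hg' : ContDiffOn ℝ ∞ (fun x => fderiv ℝ g x v) U) (f : smoothFun U F) :
    pd hU v (mul g hg f) = mul g hg (pd hU v f) + mul (fun x => fderiv ℝ g x v) hg' f := by
  refine ext' fun x hx => ?_
  change _ = (mul g hg (pd hU v f)).1 x + (mul (fun x => fderiv ℝ g x v) hg' f).1 x
  rw [mul_apply, mul_apply, pd_apply _ _ _ hx, pd_apply _ _ _ hx]
  have hgd : DifferentiableAt ℝ g x := (hg.contDiffAt (hU.mem_nhds hx)).differentiableAt (by simp)
  have h1 : (mul g hg f).1 = fun x => g x • f.1 x := rfl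
  rw [h1, fderiv_fun_smul hgd (differentiableAt hU f hx)]
  simp

lemma pd_post (hU : IsOpen U) (v : E) (T : F →L[ℝ] F') (f : smoothFun U F) :
    pd hU v (post T f) = post T (pd hU v f) := by
  refine ext' fun x hx => ?_
  rw [post_apply, pd_apply _ _ _ hx, pd_apply _ _ _ hx]
  have h1 : (post T f).1 = T ∘ f.1 := rfl
  rw [h1, fderiv_comp x T.differentiableAt (differentiableAt hU f hx)]
  simp

lemma mul_post (g : E → ℝ) (hg : ContDiffOn ℝ ∞ g U) (T : F →L[ℝ] F') (f : smoothFun U F) :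
    mul g hg (post T f) = post T (mul g hg f) := by
  ext x; exact (map_smul T _ _).symm

/-- The smooth functions on `U` which extend smoothly to the larger set `Ω`. -/
def extending (U Ω : Set E) (F : Type*) [NormedAddCommGroup F] [NormedSpace ℝ F] :
    Submodule ℝ (smoothFun U F) where
  carrier := {f | ∃ ζ, ContDiffOn ℝ ∞ ζ Ω ∧ ∀ x ∈ U, ζ x = f.1 x}
  add_mem' := by
    rintro f g ⟨ζ, hζ, h⟩ ⟨ξ, hξ, h'⟩
    exact ⟨ζ + ξ, hζ.add hξ, fun x hx => by simp [h x hx, h' x hx]⟩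
  zero_mem' := ⟨0, contDiffOn_const, fun _ _ => rfl⟩
  smul_mem' := by
    rintro c f ⟨ζ, hζ, h⟩
    exact ⟨c • ζ, contDiffOn_const.smul hζ, fun x hx => by simp [h x hx]⟩

lemma pd_mem {Ω : Set E} (hU : IsOpen U) (hΩ : IsOpen Ω) (v : E) {f : smoothFun U F}
    (hf : f ∈ extending U Ω F) : pd hU v f ∈ extending U Ω F := by
  obtain ⟨ζ, hζ, h⟩ := hf
  refine ⟨fun x => fderiv ℝ ζ x v,
    (hζ.fderiv_of_isOpen (m := ∞) hΩ (by simp)).clm_apply contDiffOn_const, fun x hx => ?_⟩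
  have h1 : ζ =ᶠ[𝓝 x] f.1 := by
    filter_upwards [hU.mem_nhds hx] with y hy using h y hy
  simp only [pd_apply _ _ _ hx, h1.fderiv_eq]

lemma mul_mem {Ω : Set E} (g : E → ℝ) (hg : ContDiffOn ℝ ∞ g U) (hg' : ContDiffOn ℝ ∞ g Ω)
    {f : smoothFun U F} (hf : f ∈ extending U Ω F) : mul g hg f ∈ extending U Ω F := by
  obtain ⟨ζ, hζ, h⟩ := hf
  exact ⟨fun x => g x • ζ x, hg'.smul hζ, fun x hx => by simp only [mul_apply, h x hx]⟩

lemma post_mem {Ω : Set E} (T : F →L[ℝ] F') {f : smoothFun U F} (hf : f ∈ extending U Ω F) :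
    post T f ∈ extending U Ω F' := by
  obtain ⟨ζ, hζ, h⟩ := hf
  exact ⟨fun x => T (ζ x), T.contDiff.comp_contDiffOn hζ, fun x hx => by simp only [post_apply, h x hx]⟩

end smoothFun
end SmoothFun

/-! ### The operators on differential forms on a punctured domain -/

section Graded

variable {N : ℕ → Type*} [∀ k, AddCommGroup (N k)] [∀ k, Module ℝ (N k)]

/-- The operator on a graded module which is `f k` in degree `k`. -/
def degZero (f : ∀ k, N k →ₗ[ℝ] N k) : Module.End ℝ (∀ k, N k) :=
  LinearMap.pi fun k => f k ∘ₗ LinearMap.proj k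

/-- The operator of degree `1` on a graded module which is `f k` on degree `k`. -/
def degUp (f : ∀ k, N k →ₗ[ℝ] N (k + 1)) : Module.End ℝ (∀ k, N k) :=
  LinearMap.pi fun
    | 0 => 0
    | k + 1 => f k ∘ₗ LinearMap.proj k

/-- The operator of degree `-1` on a graded module which is `f k` on degree `k + 1`. -/
def degDown (f : ∀ k, N (k + 1) →ₗ[ℝ] N k) : Module.End ℝ (∀ k, N k) :=
  LinearMap.pi fun k => f k ∘ₗ LinearMap.proj (k + 1)

lemma degZero_apply (f : ∀ k, N k →ₗ[ℝ] N k) (w : ∀ k, N k) (k : ℕ) :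
    degZero f w k = f k (w k) := rfl

lemma degUp_zero (f : ∀ k, N k →ₗ[ℝ] N (k + 1)) (w : ∀ k, N k) : degUp f w 0 = 0 := rfl

lemma degUp_succ (f : ∀ k, N k →ₗ[ℝ] N (k + 1)) (w : ∀ k, N k) (k : ℕ) :
    degUp f w (k + 1) = f k (w k) := rfl

lemma degDown_apply (f : ∀ k, N (k + 1) →ₗ[ℝ] N k) (w : ∀ k, N k) (k : ℕ) :
    degDown f w k = f k (w (k + 1)) := rfl

end Graded

section Euclidean

variable {n : ℕ} {F : Type*} [NormedAddCommGroup F] [NormedSpace ℝ F]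

/-- The indices of the first `m` coordinates. -/
def firstCoords (n m : ℕ) : Finset (Fin n) := Finset.univ.filter fun i : Fin n => (i : ℕ) < m

lemma card_firstCoords {n m : ℕ} (h : m ≤ n) : (firstCoords n m).card = m := by
  rw [firstCoords, Fin.card_filter_val_lt, min_eq_right h]

lemma normSq_apply (n m : ℕ) (x : EuclideanSpace ℝ (Fin n)) :
    normSq n m x = ∑ i ∈ firstCoords n m, x i ^ 2 := rfl

lemma contDiff_normSq (n m : ℕ) : ContDiff ℝ ∞ (normSq n m) :=
  contMDiff_iff_contDiff.1 (normSq n m).contMDiff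

/-- The points of `Ω` where `x₁² + ⋯ + x_m²` does not vanish. -/
def punctured (m : ℕ) (Ω : Set (EuclideanSpace ℝ (Fin n))) : Set (EuclideanSpace ℝ (Fin n)) :=
  Ω ∩ {x | normSq n m x ≠ 0}

lemma isOpen_punctured (m : ℕ) {Ω : Set (EuclideanSpace ℝ (Fin n))} (hΩ : IsOpen Ω) :
    IsOpen (punctured m Ω) :=
  hΩ.inter (isOpen_ne_fun (contDiff_normSq n m).continuous continuous_const)

lemma contDiff_coord (i : Fin n) : ContDiff ℝ ∞ fun x : EuclideanSpace ℝ (Fin n) => x i := by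
  fun_prop

lemma fderiv_coord (i j : Fin n) (x : EuclideanSpace ℝ (Fin n)) :
    fderiv ℝ (fun x : EuclideanSpace ℝ (Fin n) => x j) x (EuclideanSpace.single i 1)
      = if i = j then 1 else 0 := by
  have h : (fun x : EuclideanSpace ℝ (Fin n) => x j) = EuclideanSpace.proj (𝕜 := ℝ) j := rfl
  rw [h, ContinuousLinearMap.fderiv]
  simp [eq_comm]

open smoothFun in
lemma sum_coord_coord {m : ℕ} {U : Set (EuclideanSpace ℝ (Fin n))}
    (w : ∀ k : ℕ, smoothFun U (EuclideanSpace ℝ (Fin n) [⋀^Fin k]→L[ℝ] F)) (k : ℕ)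
    (x : EuclideanSpace ℝ (Fin n)) :
    ((∑ i ∈ firstCoords n m,
      (degZero fun _ => mul (fun x => x i) (contDiff_coord i).contDiffOn :
        Module.End ℝ (∀ k : ℕ, smoothFun U (EuclideanSpace ℝ (Fin n) [⋀^Fin k]→L[ℝ] F)))
      ((degZero fun _ => mul (fun x => x i) (contDiff_coord i).contDiffOn :
        Module.End ℝ (∀ k : ℕ, smoothFun U (EuclideanSpace ℝ (Fin n) [⋀^Fin k]→L[ℝ] F))) w)) k).1 x
    = normSq n m x • (w k).1 x := by
  rw [Finset.sum_apply, Submodule.coe_sum, Finset.sum_apply, normSq_apply, Finset.sum_smul]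
  refine Finset.sum_congr rfl fun i _ => ?_
  rw [degZero_apply, degZero_apply, mul_apply, mul_apply, smul_smul, sq]

open smoothFun in
/-- The operators on the graded module of forms which are smooth on the points of `Ω` where
`x₁² + ⋯ + x_m²` does not vanish. -/
def euclideanOps (F : Type*) [NormedAddCommGroup F] [NormedSpace ℝ F] (m : ℕ)
    {Ω : Set (EuclideanSpace ℝ (Fin n))} (hΩ : IsOpen Ω) :
    CoordOps (Fin n)
      (∀ k : ℕ, smoothFun (punctured m Ω) (EuclideanSpace ℝ (Fin n) [⋀^Fin k]→L[ℝ] F))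
      (firstCoords n m) where
  D i := degZero fun _ => pd (isOpen_punctured m hΩ) (EuclideanSpace.single i 1)
  e i := degUp fun _ => post (extMul (EuclideanSpace.proj i))
  c i := degDown fun _ => post (contr (EuclideanSpace.single i 1))
  x i := degZero fun _ => mul (fun x => x i) (contDiff_coord i).contDiffOn
  u := degZero fun _ => mul (fun x => (normSq n m x)⁻¹)
    ((contDiff_normSq n m).contDiffOn.inv fun x hx => hx.2)
  A := Submodule.pi univ fun k => extending (punctured m Ω) Ω _
  D_D i j w := by
    ext1 k; exact pd_pd (isOpen_punctured m hΩ) _ _ (w k)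
  e_e i j w := by
    ext1 k
    rcases k with _ | _ | k
    · simp [degUp_zero]
    · simp [degUp_zero, degUp_succ]
    · refine ext' fun x hx => ?_
      exact extMul_extMul _ _ _
  c_c i j w := by
    ext1 k
    refine ext' fun x hx => ?_
    exact contr_contr _ _ _
  c_e i j w := by
    ext1 k
    refine ext' fun x hx => ?_
    rcases k with _ | k
    · refine (contr_extMul_zero _ _ _).trans ?_
      split_ifs with h
      · subst h; simp [degUp_zero]
      · simp [degUp_zero, Ne.symm h]
    · refine (contr_extMul _ _ _).trans ?_
      split_ifs with h
      · subst h; simp [degUp_succ, degDown_apply, post_apply]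
      · simp [degUp_succ, degDown_apply, post_apply, Ne.symm h]
  D_e i j w := by
    ext1 k
    rcases k with _ | k
    · simp [degUp_zero, degZero_apply]
    · exact pd_post (isOpen_punctured m hΩ) _ _ (w k)
  D_c i j w := by
    ext1 k; exact pd_post (isOpen_punctured m hΩ) _ _ (w (k + 1))
  D_x i j w := by
    ext1 k
    have h : ContDiffOn ℝ ∞ (fun x => fderiv ℝ (fun x : EuclideanSpace ℝ (Fin n) => x j) x
        (EuclideanSpace.single i 1)) (punctured m Ω) := by
      simp only [fderiv_coord]; exact contDiffOn_const
    refine (pd_mul (isOpen_punctured m hΩ) _ _ (contDiff_coord j).contDiffOn h (w k)).trans ?_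
    refine congrArg₂ (· + ·) rfl (ext' fun x hx => ?_)
    rw [mul_apply, fderiv_coord]
    split_ifs <;> simp
  x_x i j w := by
    ext1 k
    refine ext' fun x hx => ?_
    exact smul_comm _ _ _
  e_x i j w := by
    ext1 k
    rcases k with _ | k
    · simp [degUp_zero, degZero_apply]
    · exact (mul_post _ (contDiff_coord j).contDiffOn _ (w k)).symm
  c_x i j w := by
    ext1 k; exact (mul_post _ (contDiff_coord j).contDiffOn _ (w (k + 1))).symm
  u_μ w := by
    ext1 k
    refine ext' fun x hx => ?_
    rw [degZero_apply, mul_apply, sum_coord_coord, smul_smul, inv_mul_cancel₀ hx.2, one_smul]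
  μ_u w := by
    ext1 k
    refine ext' fun x hx => ?_
    rw [sum_coord_coord, degZero_apply, mul_apply, smul_smul, mul_inv_cancel₀ hx.2, one_smul]
  D_mem i w hw k _ := pd_mem (isOpen_punctured m hΩ) hΩ _ (hw k (mem_univ k))
  e_mem i w hw k _ := by
    rcases k with _ | k
    · exact zero_mem _
    · exact post_mem _ (hw k (mem_univ k))
  c_mem i w hw k _ := post_mem _ (hw (k + 1) (mem_univ _))
  x_mem i w hw k _ := mul_mem _ (contDiff_coord i).contDiffOn (contDiff_coord i).contDiffOn (hw k (mem_univ k))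

open smoothFun in
/-- Poles of bounded order in the abstract formalism are poles of bounded order of all the
components. -/
lemma mem_G_euclideanOps {m p : ℕ} {Ω : Set (EuclideanSpace ℝ (Fin n))} (hΩ : IsOpen Ω)
    (w : ∀ k : ℕ, smoothFun (punctured m Ω) (EuclideanSpace ℝ (Fin n) [⋀^Fin k]→L[ℝ] F)) :
    w ∈ (euclideanOps F m hΩ).G p ↔ ∀ k, ∃ ζ, ContDiffOn ℝ ∞ ζ Ω ∧
      ∀ x ∈ punctured m Ω, ζ x = normSq n m x ^ p • (w k).1 x := by
  have h : ∀ p k x, ((((euclideanOps F m hΩ).μ ^ p) w) k).1 x = normSq n m x ^ p • (w k).1 x := by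
    intro p k x
    induction p with
    | zero => simp
    | succ p ih =>
      rw [pow_succ', Module.End.mul_apply, CoordOps.μ_apply, pow_succ', mul_smul, ← ih]
      exact sum_coord_coord _ k x
  change (∀ k, k ∈ univ → ∃ ζ, _ ∧ ∀ x ∈ punctured m Ω, _ = _) ↔ _
  simp only [mem_univ, true_imp_iff]
  refine forall_congr' fun k => exists_congr fun ζ => and_congr_right fun _ =>
    forall₂_congr fun x _ => ?_
  exact Eq.congr_right (h p k x)

open smoothFun in
/-- The operator `d` of the abstract formalism is the exterior derivative. -/
lemma d_euclideanOps {m : ℕ} {Ω : Set (EuclideanSpace ℝ (Fin n))} (hΩ : IsOpen Ω)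
    (w : ∀ k : ℕ, smoothFun (punctured m Ω) (EuclideanSpace ℝ (Fin n) [⋀^Fin k]→L[ℝ] F)) (k : ℕ)
    {x : EuclideanSpace ℝ (Fin n)} (hx : x ∈ punctured m Ω) :
    ((euclideanOps F m hΩ).d Finset.univ w (k + 1)).1 x = extDeriv (w k).1 x := by
  rw [CoordOps.d_apply, Finset.sum_apply, Submodule.coe_sum, Finset.sum_apply, extDeriv_eq_sum]
  refine Finset.sum_congr rfl fun i _ => ?_
  change extMul _ ((pd (isOpen_punctured m hΩ) _ (w k)).1 x) = _
  rw [pd_apply _ _ _ hx]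

lemma d_euclideanOps_zero {m : ℕ} {Ω : Set (EuclideanSpace ℝ (Fin n))} (hΩ : IsOpen Ω)
    (w : ∀ k : ℕ, smoothFun (punctured m Ω) (EuclideanSpace ℝ (Fin n) [⋀^Fin k]→L[ℝ] F)) :
    (euclideanOps F m hΩ).d Finset.univ w 0 = 0 := by
  rw [CoordOps.d_apply, Finset.sum_apply]
  exact Finset.sum_eq_zero fun i _ => rfl

open smoothFun in
/-- A form `α` with a pole along the zero set of `μ = x₁² + ⋯ + x_m²` such that `μ ^ r dα` is smooth
differs by an exact form from a form which becomes smooth after multiplication by `μ ^ r`. The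
primitive `η` lives in the total graded module; only its component of degree one less than `α`
matters. -/
theorem exists_reduction_graded {m r : ℕ} (hm : m ≤ n) (hr : 1 ≤ r) (hmr : m ≤ 2 * r)
    {Ω : Set (EuclideanSpace ℝ (Fin n))} (hΩ : IsOpen Ω) {k : ℕ}
    {α : EuclideanSpace ℝ (Fin n) → EuclideanSpace ℝ (Fin n) [⋀^Fin k]→L[ℝ] F}
    (hα : ContDiffOn ℝ ∞ α (punctured m Ω)) {N : ℕ}
    (hN : ∃ ζ, ContDiffOn ℝ ∞ ζ Ω ∧ ∀ x ∈ punctured m Ω, ζ x = normSq n m x ^ N • α x)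
    (hd : ∃ ζ, ContDiffOn ℝ ∞ ζ Ω ∧ ∀ x ∈ punctured m Ω, ζ x = normSq n m x ^ r • extDeriv α x) :
    ∃ η ∈ (euclideanOps F m hΩ).G (r + N), ∃ ζ, ContDiffOn ℝ ∞ ζ Ω ∧ ∀ x ∈ punctured m Ω,
      ζ x = normSq n m x ^ r • (α x - ((euclideanOps F m hΩ).d Finset.univ η k).1 x) := by
  classical
  set O := euclideanOps F m hΩ with hO
  set w : ∀ k : ℕ, smoothFun (punctured m Ω) (EuclideanSpace ℝ (Fin n) [⋀^Fin k]→L[ℝ] F) :=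
    Pi.single k (mk α hα) with hw
  have hwk : w k = mk α hα := Pi.single_eq_same _ _
  have hw0 : ∀ j, j ≠ k → w j = 0 := fun j hj => Pi.single_eq_of_ne hj _
  have hwN : w ∈ O.G (r + N) := by
    rw [mem_G_euclideanOps]
    intro j
    by_cases hj : j = k
    · subst hj
      obtain ⟨ζ, hζ, h⟩ := hN
      refine ⟨fun x => normSq n m x ^ r • ζ x,
        ((contDiff_normSq n m).pow r).contDiffOn.smul hζ, fun x hx => ?_⟩
      simp only [hwk, mk_apply hx, h x hx, smul_smul, pow_add]
    · refine ⟨0, contDiffOn_const, fun x hx => ?_⟩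
      rw [hw0 j hj]; simp
  have hwd : O.d Finset.univ w ∈ O.G r := by
    rw [mem_G_euclideanOps]
    intro j
    rcases j with _ | j
    · refine ⟨0, contDiffOn_const, fun x hx => ?_⟩
      rw [hO, d_euclideanOps_zero]; simp
    by_cases hj : j = k
    · subst hj
      obtain ⟨ζ, hζ, h⟩ := hd
      refine ⟨ζ, hζ, fun x hx => ?_⟩
      have h1 : (w j).1 =ᶠ[𝓝 x] α := by
        filter_upwards [(isOpen_punctured m hΩ).mem_nhds hx] with y hy
        rw [hwk, mk_apply hy]
      rw [hO, d_euclideanOps hΩ w j hx, h1.extDeriv_eq, h x hx]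
    · refine ⟨0, contDiffOn_const, fun x hx => ?_⟩
      rw [hO, d_euclideanOps hΩ w j hx, hw0 j hj]
      simp [extDeriv, ← ContinuousAlternatingMap.alternatizeUncurryFinCLM_apply]
  obtain ⟨η, hη, h⟩ := O.exists_reduction hr (by rwa [card_firstCoords hm]) N hwN hwd
  obtain ⟨ζ, hζ, h⟩ := (mem_G_euclideanOps hΩ _).1 h k
  refine ⟨η, hη, ζ, hζ, fun x hx => ?_⟩
  rw [h x hx]
  change _ • ((w k).1 x - _) = _
  rw [hwk, mk_apply hx]

/-- In degree zero there are no exact forms: a function with a pole is no worse than its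
differential. -/
theorem exists_reduction_zero {m r : ℕ} (hm : m ≤ n) (hr : 1 ≤ r) (hmr : m ≤ 2 * r)
    {Ω : Set (EuclideanSpace ℝ (Fin n))} (hΩ : IsOpen Ω)
    {α : EuclideanSpace ℝ (Fin n) → EuclideanSpace ℝ (Fin n) [⋀^Fin 0]→L[ℝ] F}
    (hα : ContDiffOn ℝ ∞ α (punctured m Ω)) {N : ℕ}
    (hN : ∃ ζ, ContDiffOn ℝ ∞ ζ Ω ∧ ∀ x ∈ punctured m Ω, ζ x = normSq n m x ^ N • α x)
    (hd : ∃ ζ, ContDiffOn ℝ ∞ ζ Ω ∧ ∀ x ∈ punctured m Ω, ζ x = normSq n m x ^ r • extDeriv α x) :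
    ∃ ζ, ContDiffOn ℝ ∞ ζ Ω ∧ ∀ x ∈ punctured m Ω, ζ x = normSq n m x ^ r • α x := by
  obtain ⟨η, -, ζ, hζ, h⟩ := exists_reduction_graded hm hr hmr hΩ hα hN hd
  refine ⟨ζ, hζ, fun x hx => ?_⟩
  rw [h x hx, d_euclideanOps_zero]
  simp

/-- In positive degree, a form with a pole is, up to an exact form, no worse than its
differential. -/
theorem exists_reduction_succ {m r : ℕ} (hm : m ≤ n) (hr : 1 ≤ r) (hmr : m ≤ 2 * r)
    {Ω : Set (EuclideanSpace ℝ (Fin n))} (hΩ : IsOpen Ω) {k : ℕ}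
    {α : EuclideanSpace ℝ (Fin n) → EuclideanSpace ℝ (Fin n) [⋀^Fin (k + 1)]→L[ℝ] F}
    (hα : ContDiffOn ℝ ∞ α (punctured m Ω)) {N : ℕ}
    (hN : ∃ ζ, ContDiffOn ℝ ∞ ζ Ω ∧ ∀ x ∈ punctured m Ω, ζ x = normSq n m x ^ N • α x)
    (hd : ∃ ζ, ContDiffOn ℝ ∞ ζ Ω ∧ ∀ x ∈ punctured m Ω, ζ x = normSq n m x ^ r • extDeriv α x) :
    ∃ η : EuclideanSpace ℝ (Fin n) → EuclideanSpace ℝ (Fin n) [⋀^Fin k]→L[ℝ] F,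
      ContDiffOn ℝ ∞ η (punctured m Ω) ∧
      (∃ ζ, ContDiffOn ℝ ∞ ζ Ω ∧ ∀ x ∈ punctured m Ω, ζ x = normSq n m x ^ (r + N) • η x) ∧
      ∃ ζ, ContDiffOn ℝ ∞ ζ Ω ∧ ∀ x ∈ punctured m Ω,
        ζ x = normSq n m x ^ r • (α x - extDeriv η x) := by
  obtain ⟨η, hη, ζ, hζ, h⟩ := exists_reduction_graded hm hr hmr hΩ hα hN hd
  refine ⟨(η k).1, (η k).2.1, (mem_G_euclideanOps hΩ _).1 hη k, ζ, hζ, fun x hx => ?_⟩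
  rw [h x hx, d_euclideanOps hΩ η k hx]

end Euclidean

/-! ### Forms in charts of the maximal atlas -/

section Pullback

variable {E : Type*} [NormedAddCommGroup E] [NormedSpace ℝ E] [FiniteDimensional ℝ E]
  {F : Type*} [NormedAddCommGroup F] [NormedSpace ℝ F] [FiniteDimensional ℝ F] {k : ℕ}

/-- The pull-back of alternating forms depends smoothly on the form and on the linear map. -/
lemma _root_.ContDiffAt.compContinuousLinearMap {E' : Type*} [NormedAddCommGroup E']
    [NormedSpace ℝ E'] {β : E' → E [⋀^Fin k]→L[ℝ] F} {A : E' → E →L[ℝ] E} {y : E'}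
    (hβ : ContDiffAt ℝ ∞ β y) (hA : ContDiffAt ℝ ∞ A y) :
    ContDiffAt ℝ ∞ (fun z => (β z).compContinuousLinearMap (A z)) y := by
  let J : (E [⋀^Fin k]→L[ℝ] F) →L[ℝ] ContinuousMultilinearMap ℝ (fun _ : Fin k => E) F :=
    ContinuousAlternatingMap.toContinuousMultilinearMapCLM ℝ
  have hfin : FiniteDimensional ℝ (ContinuousMultilinearMap ℝ (fun _ : Fin k => E) F) :=
    FiniteDimensional.of_injective
      (ContinuousMultilinearMap.toMultilinearMapLinear :
        ContinuousMultilinearMap ℝ (fun _ : Fin k => E) F →ₗ[ℝ] _)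
      ContinuousMultilinearMap.toMultilinearMap_injective
  have hJ : Function.Injective J :=
    ContinuousAlternatingMap.toContinuousMultilinearMap_injective
  obtain ⟨g, hg⟩ := ContinuousLinearMap.HasLeftInverse.of_injective_of_finiteDimensional hJ
  let c := ContinuousMultilinearMap.compContinuousLinearMapContinuousMultilinear ℝ
    (fun _ : Fin k => E) (fun _ => E) F
  have h1 : ContDiffAt ℝ ∞ (fun z => c (fun _ => A z)) y :=
    c.contDiff.contDiffAt.comp y (contDiffAt_pi.2 fun _ => hA)
  have h2 : ContDiffAt ℝ ∞ (fun z => c (fun _ => A z) (J (β z))) y :=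
    h1.clm_apply (J.contDiff.contDiffAt.comp y hβ)
  have h3 := g.contDiff.contDiffAt.comp y h2
  refine h3.congr_of_eventuallyEq (Eventually.of_forall fun z => ?_)
  exact (hg _).symm

end Pullback

section MaximalAtlas

variable {E : Type} [NormedAddCommGroup E] [NormedSpace ℝ E]
  {X : Type*} [TopologicalSpace X] [ChartedSpace E X] [IsManifold 𝓘(ℝ, E) ∞ X]
  {𝕜 : Type} [RCLike 𝕜] {k : ℕ} {e e' : OpenPartialHomeomorph X E}

lemma contDiffAt_transition_max (he : e ∈ IsManifold.maximalAtlas 𝓘(ℝ, E) ∞ X)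
    (he' : e' ∈ IsManifold.maximalAtlas 𝓘(ℝ, E) ∞ X) {y : E}
    (hy : y ∈ e.target) (hy' : e.symm y ∈ e'.source) :
    ContDiffAt ℝ ∞ (e' ∘ e.symm) y := by
  rw [← contMDiffAt_iff_contDiffAt]
  exact (contMDiffAt_of_mem_maximalAtlas he' hy').comp y
    (contMDiffAt_symm_of_mem_maximalAtlas he hy)

/-- The expressions of a form in two charts are related by pull-back along the transition map. -/
lemma chartRep_transition_max (he : e ∈ IsManifold.maximalAtlas 𝓘(ℝ, E) ∞ X)
    (he' : e' ∈ IsManifold.maximalAtlas 𝓘(ℝ, E) ∞ X)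
    (α : X → E [⋀^Fin k]→L[ℝ] 𝕜) {y : E} (hy : y ∈ e.target) (hy' : e.symm y ∈ e'.source) :
    chartRep e α =ᶠ[𝓝 y] fun z => (chartRep e' α ((e' ∘ e.symm) z)).compContinuousLinearMap
      (fderiv ℝ (e' ∘ e.symm) z) := by
  have hO : IsOpen (e.target ∩ e.symm ⁻¹' e'.source) := isOpen_chart_set e e'.open_source
  filter_upwards [hO.mem_nhds ⟨hy, hy'⟩] with z hz
  have hlin : chartSymmDeriv e z =
      chartSymmDeriv e' ((e' ∘ e.symm) z) ∘L
        fderiv ℝ (e' ∘ e.symm) z := by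
    have h1 : MDifferentiableAt 𝓘(ℝ, E) 𝓘(ℝ, E) e'.symm ((e' ∘ e.symm) z) :=
      (contMDiffAt_symm_of_mem_maximalAtlas he' (e'.map_source hz.2)).mdifferentiableAt
        (by simp)
    have h2 : MDifferentiableAt 𝓘(ℝ, E) 𝓘(ℝ, E) (e' ∘ e.symm) z :=
      ((contDiffAt_transition_max he he' hz.1 hz.2).differentiableAt (by simp)).mdifferentiableAt
    have h3 : mfderiv 𝓘(ℝ, E) 𝓘(ℝ, E) (e'.symm ∘ (e' ∘ e.symm)) z =
        chartSymmDeriv e' ((e' ∘ e.symm) z) ∘L fderiv ℝ (e' ∘ e.symm) z := by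
      rw [← mfderiv_eq_fderiv]; exact mfderiv_comp z h1 h2
    refine Eq.trans ?_ h3
    refine Filter.EventuallyEq.mfderiv_eq ?_
    filter_upwards [hO.mem_nhds hz] with w hw
    exact (e'.left_inv hw.2).symm
  have hpt : e'.symm ((e' ∘ e.symm) z) = e.symm z := e'.left_inv hz.2
  ext v
  simp only [chartRep]
  rw [hlin, hpt]
  rfl

/-- The exterior derivative is computed by the expression of a form in any chart of the maximal
atlas. -/
lemma extD_chartRep_max {S : Set X} (hS : IsOpen S) {α : X → E [⋀^Fin k]→L[ℝ] 𝕜}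
    (hα : SmoothOn α S) (he : e ∈ IsManifold.maximalAtlas 𝓘(ℝ, E) ∞ X) {y : E}
    (hy : y ∈ e.target) (hyS : e.symm y ∈ S) :
    chartRep e (extD α) y = extDeriv (chartRep e α) y := by
  set x := e.symm y with hx
  set e' := chartAt E x with he'
  have he'a : e' ∈ IsManifold.maximalAtlas 𝓘(ℝ, E) ∞ X := mem_max (chart_mem_atlas E x)
  have hxs : x ∈ e'.source := mem_chart_source E x
  have hφ := contDiffAt_transition_max he he'a hy hxs
  rw [(chartRep_transition_max he he'a α hy hxs).extDeriv_eq]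
  have hd : DifferentiableAt ℝ (chartRep e' α) ((e' ∘ e.symm) y) := hα.differentiableAt hS hyS
  rw [extDeriv_pullback (r := ∞) hd hφ two_le_infty]
  have h1 : MDifferentiableAt 𝓘(ℝ, E) 𝓘(ℝ, E) e' (e.symm y) :=
    (contMDiffAt_of_mem_maximalAtlas he'a hxs).mdifferentiableAt (by simp)
  have h2 : MDifferentiableAt 𝓘(ℝ, E) 𝓘(ℝ, E) e.symm y :=
    (contMDiffAt_symm_of_mem_maximalAtlas he hy).mdifferentiableAt (by simp)
  have h3 : fderiv ℝ (e' ∘ e.symm) y = chartDeriv e' x ∘L chartSymmDeriv e y := by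
    rw [← mfderiv_eq_fderiv]; exact mfderiv_comp y h1 h2
  rw [h3]
  rfl

variable [FiniteDimensional ℝ E]

/-- Smoothness of a form can be checked in one chart of the maximal atlas. -/
lemma smoothOn_iff_chartRep (he : e ∈ IsManifold.maximalAtlas 𝓘(ℝ, E) ∞ X) {S : Set X}
    (hS : IsOpen S) (hSe : S ⊆ e.source) {α : X → E [⋀^Fin k]→L[ℝ] 𝕜} :
    SmoothOn α S ↔ ContDiffOn ℝ ∞ (chartRep e α) (e.target ∩ e.symm ⁻¹' S) := by
  have key : ∀ {e e' : OpenPartialHomeomorph X E} {y : E},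
      e ∈ IsManifold.maximalAtlas 𝓘(ℝ, E) ∞ X → e' ∈ IsManifold.maximalAtlas 𝓘(ℝ, E) ∞ X →
      y ∈ e.target → e.symm y ∈ S → e.symm y ∈ e'.source →
      ContDiffOn ℝ ∞ (chartRep e' α) (e'.target ∩ e'.symm ⁻¹' S) →
      ContDiffWithinAt ℝ ∞ (chartRep e α) (e.target ∩ e.symm ⁻¹' S) y := by
    intro e e' y he he' hy hyS hy' h
    have ht := contDiffAt_transition_max he he' hy hy'
    have hd : ContDiffAt ℝ ∞ (fderiv ℝ (e' ∘ e.symm)) y := ht.fderiv_right (m := ∞) (by simp)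
    have hmem : (e' ∘ e.symm) y ∈ e'.target ∩ e'.symm ⁻¹' S :=
      ⟨e'.map_source hy', by
        change e'.symm (e' (e.symm y)) ∈ S
        rwa [e'.left_inv hy']⟩
    have h1 : ContDiffAt ℝ ∞ (chartRep e' α) ((e' ∘ e.symm) y) :=
      (h _ hmem).contDiffAt ((isOpen_chart_set e' hS).mem_nhds hmem)
    have h2 := (h1.comp y ht).compContinuousLinearMap hd
    exact (h2.congr_of_eventuallyEq (chartRep_transition_max he he' α hy hy')).contDiffWithinAt
  constructor
  · intro h y hy
    exact key he (mem_max (chart_mem_atlas E (e.symm y))) hy.1 hy.2 (mem_chart_source E _)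
      (h _ (chart_mem_atlas E _))
  · intro h e' he' y hy
    exact key (mem_max he') he hy.1 hy.2 (hSe hy.2) h

/-- The form on the source of a chart `e` with the expression `η` in this chart. -/
def pullForm (e : OpenPartialHomeomorph X E) (η : E → E [⋀^Fin k]→L[ℝ] 𝕜) (x : X) :
    E [⋀^Fin k]→L[ℝ] 𝕜 :=
  (η (e x)).compContinuousLinearMap (chartDeriv e x)

lemma chartDeriv_chartSymmDeriv (he : e ∈ IsManifold.maximalAtlas 𝓘(ℝ, E) ∞ X) {y : E}
    (hy : y ∈ e.target) (v : E) : chartDeriv e (e.symm y) (chartSymmDeriv e y v) = v := by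
  have h1 : MDifferentiableAt 𝓘(ℝ, E) 𝓘(ℝ, E) e (e.symm y) :=
    (contMDiffAt_of_mem_maximalAtlas he (e.map_target hy)).mdifferentiableAt (by simp)
  have h2 : MDifferentiableAt 𝓘(ℝ, E) 𝓘(ℝ, E) e.symm y :=
    (contMDiffAt_symm_of_mem_maximalAtlas he hy).mdifferentiableAt (by simp)
  have h3 : mfderiv 𝓘(ℝ, E) 𝓘(ℝ, E) (e ∘ e.symm) y
      = chartDeriv e (e.symm y) ∘L chartSymmDeriv e y := mfderiv_comp y h1 h2
  have h4 : mfderiv 𝓘(ℝ, E) 𝓘(ℝ, E) (e ∘ e.symm) y = ContinuousLinearMap.id ℝ E := by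
    refine Eq.trans (Filter.EventuallyEq.mfderiv_eq (f := id) ?_) mfderiv_id
    filter_upwards [e.open_target.mem_nhds hy] with w hw
    exact e.right_inv hw
  exact DFunLike.congr_fun (h3.symm.trans h4) v

lemma chartSymmDeriv_chartDeriv (he : e ∈ IsManifold.maximalAtlas 𝓘(ℝ, E) ∞ X) {x : X}
    (hx : x ∈ e.source) (v : E) : chartSymmDeriv e (e x) (chartDeriv e x v) = v := by
  have h1 : MDifferentiableAt 𝓘(ℝ, E) 𝓘(ℝ, E) e x :=
    (contMDiffAt_of_mem_maximalAtlas he hx).mdifferentiableAt (by simp)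
  have h2 : MDifferentiableAt 𝓘(ℝ, E) 𝓘(ℝ, E) e.symm (e x) :=
    (contMDiffAt_symm_of_mem_maximalAtlas he (e.map_source hx)).mdifferentiableAt (by simp)
  have h3 : mfderiv 𝓘(ℝ, E) 𝓘(ℝ, E) (e.symm ∘ e) x
      = chartSymmDeriv e (e x) ∘L chartDeriv e x := mfderiv_comp x h2 h1
  have h4 : mfderiv 𝓘(ℝ, E) 𝓘(ℝ, E) (e.symm ∘ e) x = ContinuousLinearMap.id ℝ E := by
    refine Eq.trans (Filter.EventuallyEq.mfderiv_eq (f := id) ?_) mfderiv_id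
    filter_upwards [e.open_source.mem_nhds hx] with w hw
    exact e.left_inv hw
  exact DFunLike.congr_fun (h3.symm.trans h4) v

lemma chartRep_pullForm (he : e ∈ IsManifold.maximalAtlas 𝓘(ℝ, E) ∞ X)
    (η : E → E [⋀^Fin k]→L[ℝ] 𝕜) {y : E} (hy : y ∈ e.target) :
    chartRep e (pullForm e η) y = η y := by
  ext v
  simp only [chartRep, pullForm, ContinuousAlternatingMap.compContinuousLinearMap_apply,
    e.right_inv hy]
  congr 1
  ext1 i
  exact chartDeriv_chartSymmDeriv he hy (v i)

lemma pullForm_chartRep (he : e ∈ IsManifold.maximalAtlas 𝓘(ℝ, E) ∞ X)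
    (α : X → E [⋀^Fin k]→L[ℝ] 𝕜) {x : X} (hx : x ∈ e.source) :
    pullForm e (chartRep e α) x = α x := by
  ext v
  simp only [chartRep, pullForm, ContinuousAlternatingMap.compContinuousLinearMap_apply,
    e.left_inv hx]
  congr 1
  ext1 i
  exact chartSymmDeriv_chartDeriv he hx (v i)

lemma chartRep_smul_fun (f : X → ℝ) (α : X → E [⋀^Fin k]→L[ℝ] 𝕜) (y : E) :
    chartRep e (fun x => f x • α x) y = f (e.symm y) • chartRep e α y := rfl

lemma chartRep_sub (α β : X → E [⋀^Fin k]→L[ℝ] 𝕜) (y : E) :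
    chartRep e (α - β) y = chartRep e α y - chartRep e β y := rfl

/-- A form extends smoothly if and only if its expression in a chart does. -/
lemma extends_iff_chartRep (he : e ∈ IsManifold.maximalAtlas 𝓘(ℝ, E) ∞ X) {μ : X → ℝ} {W : Set X}
    (hW : IsOpen W) (hWe : W ⊆ e.source) {β : X → E [⋀^Fin k]→L[ℝ] 𝕜} :
    Extends μ β W ↔ ∃ ζ, ContDiffOn ℝ ∞ ζ (e.target ∩ e.symm ⁻¹' W) ∧
      ∀ y ∈ e.target ∩ e.symm ⁻¹' W, μ (e.symm y) ≠ 0 → ζ y = chartRep e β y := by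
  constructor
  · rintro ⟨ζ, hζ, h⟩
    refine ⟨chartRep e ζ, (smoothOn_iff_chartRep he hW hWe).1 hζ, fun y hy h0 => ?_⟩
    simp only [chartRep, h _ hy.2 h0]
  · rintro ⟨ζ, hζ, h⟩
    refine ⟨pullForm e ζ, (smoothOn_iff_chartRep he hW hWe).2
      (hζ.congr fun y hy => chartRep_pullForm he ζ hy.1), fun x hx h0 => ?_⟩
    have hxs := hWe hx
    rw [← pullForm_chartRep he β hxs]
    simp only [pullForm]
    rw [h (e x) ⟨e.map_source hxs, by simpa [e.left_inv hxs] using hx⟩ (by rwa [e.left_inv hxs])]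

end MaximalAtlas

/-! ### Poles of forms in a Morse–Bott chart -/

section LocalReduction

variable {n : ℕ} {X : Type*} [TopologicalSpace X] [ChartedSpace (EuclideanSpace ℝ (Fin n)) X]
  [IsManifold (𝓡 n) ∞ X] {𝕜 : Type} [RCLike 𝕜]
  {e : OpenPartialHomeomorph X (EuclideanSpace ℝ (Fin n))}

/-- A chart in which `μ` is a sum of squares identifies the complements of the zero sets. -/
lemma chart_punctured {m : ℕ} {μ : X → ℝ} (hμ : ∀ x ∈ e.source, μ x = normSq n m (e x))
    {W : Set X} : e.target ∩ e.symm ⁻¹' (W ∩ {x | μ x ≠ 0})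
      = punctured m (e.target ∩ e.symm ⁻¹' W) := by
  ext y
  constructor
  · rintro ⟨hy, hyW, h0⟩
    refine ⟨⟨hy, hyW⟩, ?_⟩
    have h0 : μ (e.symm y) ≠ 0 := h0
    rwa [hμ _ (e.map_target hy), e.right_inv hy] at h0
  · rintro ⟨⟨hy, hyW⟩, h0⟩
    refine ⟨hy, hyW, ?_⟩
    change μ (e.symm y) ≠ 0
    rwa [hμ _ (e.map_target hy), e.right_inv hy]

/-- In a chart in which `μ` is a sum of squares, a pole of order at most `p` of a form is a pole of
order at most `p` of its expression in the chart. -/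
lemma exists_extends_iff {m p k : ℕ} {μ : X → ℝ} (he : e ∈ IsManifold.maximalAtlas (𝓡 n) ∞ X)
    (hμ : ∀ x ∈ e.source, μ x = normSq n m (e x)) {W : Set X} (hW : IsOpen W) (hWe : W ⊆ e.source)
    (β : X → EuclideanSpace ℝ (Fin n) [⋀^Fin k]→L[ℝ] 𝕜) :
    Extends μ (fun x => μ x ^ p • β x) W ↔ ∃ ζ, ContDiffOn ℝ ∞ ζ (e.target ∩ e.symm ⁻¹' W) ∧
      ∀ y ∈ punctured m (e.target ∩ e.symm ⁻¹' W), ζ y = normSq n m y ^ p • chartRep e β y := by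
  rw [extends_iff_chartRep he hW hWe]
  refine exists_congr fun ζ => and_congr_right fun _ => ?_
  rw [← chart_punctured hμ]
  constructor
  · rintro h y ⟨hy, hyW, h0⟩
    rw [h y ⟨hy, hyW⟩ h0, chartRep_smul_fun (f := fun x => μ x ^ p), hμ _ (e.map_target hy),
      e.right_inv hy]
  · rintro h y ⟨hy, hyW⟩ h0
    rw [h y ⟨hy, hyW, h0⟩, chartRep_smul_fun (f := fun x => μ x ^ p), hμ _ (e.map_target hy),
      e.right_inv hy]

variable {m r : ℕ} {μ : C^∞⟮𝓡 n, X; 𝓘(ℝ, ℝ), ℝ⟯}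

/-- In the domain of a Morse–Bott chart, a function with poles whose differential has poles of order
at most `r` has itself poles of order at most `r`. -/
theorem local_reduction_zero (hm : m ≤ n) (hr : 1 ≤ r) (hmr : m ≤ 2 * r)
    (he : e ∈ IsManifold.maximalAtlas (𝓡 n) ∞ X)
    (hμ : ∀ x ∈ e.source, μ x = normSq n m (e x)) {W : Set X} (hW : IsOpen W) (hWe : W ⊆ e.source)
    {α : X → EuclideanSpace ℝ (Fin n) [⋀^Fin 0]→L[ℝ] 𝕜} (hα : SmoothOn α (W ∩ nonzeroLocus μ))
    {N : ℕ} (hN : Extends μ (fun x => μ x ^ N • α x) W)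
    (hd : Extends μ (fun x => μ x ^ r • extD α x) W) :
    Extends μ (fun x => μ x ^ r • α x) W := by
  have hWU : IsOpen (W ∩ nonzeroLocus μ : Set X) := hW.inter (nonzeroLocus μ).isOpen
  have hs := (smoothOn_iff_chartRep he hWU (inter_subset_left.trans hWe)).1 hα
  have hpun : e.target ∩ e.symm ⁻¹' (W ∩ nonzeroLocus μ) = _ := chart_punctured hμ
  rw [hpun] at hs
  rw [exists_extends_iff he hμ hW hWe] at hN hd ⊢
  refine exists_reduction_zero hm hr hmr (isOpen_chart_set e hW) hs hN ?_
  obtain ⟨ζ, hζ, h⟩ := hd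
  refine ⟨ζ, hζ, fun y hy => ?_⟩
  rw [h y hy]
  rw [← hpun] at hy
  rw [extD_chartRep_max hWU hα he hy.1 hy.2]

/-- In the domain of a Morse–Bott chart, a form with poles whose differential has poles of order at
most `r` has itself poles of order at most `r`, up to an exact form. -/
theorem local_reduction_succ (hm : m ≤ n) (hr : 1 ≤ r) (hmr : m ≤ 2 * r)
    (he : e ∈ IsManifold.maximalAtlas (𝓡 n) ∞ X)
    (hμ : ∀ x ∈ e.source, μ x = normSq n m (e x)) {W : Set X} (hW : IsOpen W) (hWe : W ⊆ e.source)
    {k : ℕ} {α : X → EuclideanSpace ℝ (Fin n) [⋀^Fin (k + 1)]→L[ℝ] 𝕜}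
    (hα : SmoothOn α (W ∩ nonzeroLocus μ))
    {N : ℕ} (hN : Extends μ (fun x => μ x ^ N • α x) W)
    (hd : Extends μ (fun x => μ x ^ r • extD α x) W) :
    ∃ η : X → EuclideanSpace ℝ (Fin n) [⋀^Fin k]→L[ℝ] 𝕜, SmoothOn η (W ∩ nonzeroLocus μ) ∧
      (∃ M : ℕ, Extends μ (fun x => μ x ^ M • η x) W) ∧
      Extends μ (fun x => μ x ^ r • (α - extD η) x) W := by
  have hWU : IsOpen (W ∩ nonzeroLocus μ : Set X) := hW.inter (nonzeroLocus μ).isOpen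
  have hs := (smoothOn_iff_chartRep he hWU (inter_subset_left.trans hWe)).1 hα
  have hpun : e.target ∩ e.symm ⁻¹' (W ∩ nonzeroLocus μ) = _ := chart_punctured hμ
  rw [hpun] at hs
  rw [exists_extends_iff he hμ hW hWe] at hN hd
  obtain ⟨ζ, hζ, h⟩ := hd
  obtain ⟨η, hη, ⟨ξ, hξ, hξ'⟩, ξ', hξs, hξ''⟩ := exists_reduction_succ hm hr hmr
    (isOpen_chart_set e hW) hs hN ⟨ζ, hζ, fun y hy => by
      rw [h y hy]
      rw [← hpun] at hy
      rw [extD_chartRep_max hWU hα he hy.1 hy.2]⟩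
  have hrep : ∀ y ∈ e.target, chartRep e (pullForm e η) y = η y :=
    fun y hy => chartRep_pullForm he η hy
  have hsη : SmoothOn (pullForm e η) (W ∩ nonzeroLocus μ) := by
    rw [smoothOn_iff_chartRep he hWU (inter_subset_left.trans hWe), hpun]
    exact hη.congr fun y hy => hrep y hy.1.1
  refine ⟨pullForm e η, hsη, ⟨r + N, ?_⟩, ?_⟩
  · rw [exists_extends_iff he hμ hW hWe]
    exact ⟨ξ, hξ, fun y hy => by rw [hrep y hy.1.1]; exact hξ' y hy⟩
  · rw [exists_extends_iff he hμ hW hWe]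
    refine ⟨ξ', hξs, fun y hy => ?_⟩
    rw [hξ'' y hy, chartRep_sub]
    rw [← hpun] at hy
    rw [extD_chartRep_max hWU hsη he hy.1 hy.2]
    have : chartRep e (pullForm e η) =ᶠ[𝓝 y] η := by
      filter_upwards [e.open_target.mem_nhds hy.1] with z hz using hrep z hz
    rw [this.extDeriv_eq]

end LocalReduction

/-! ### Analytic tools: parameter integrals, local inverses, square roots -/

section ParametricIntegral

open MeasureTheory Convolution

variable {P W : Type*} [NormedAddCommGroup P] [NormedSpace ℝ P] [NormedAddCommGroup W]
  [NormedSpace ℝ W]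

/-- Smooth dependence on parameters of an integral with weight `1 - t`. The integral is written as
a convolution of the weight with the integrand, cut off outside a compact set. -/
lemma contDiff_integral_one_sub_smul {g : P × ℝ → W} (hg : ContDiff ℝ ∞ g) :
    ContDiff ℝ ∞ fun z => ∫ t in (0 : ℝ)..1, (1 - t) • g (z, t) := by
  let b : ContDiffBump (0 : ℝ) := ⟨2, 3, by norm_num, by norm_num⟩
  let f : ℝ → ℝ := (Ioc (0 : ℝ) 1).indicator fun t => 1 - t
  let h : P → ℝ → W := fun z t => b t • g (z, -t)
  have hf : LocallyIntegrable f volume := by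
    refine Integrable.locallyIntegrable ?_
    refine IntegrableOn.integrable_indicator ?_ measurableSet_Ioc
    exact ((continuous_const.sub continuous_id).integrableOn_Icc (a := (0 : ℝ)) (b := 1)).mono_set
      Ioc_subset_Icc_self
  have hh : ContDiff ℝ ∞ (fun q : P × ℝ => h q.1 q.2) := by
    refine (b.contDiff.comp contDiff_snd).smul (hg.comp ?_)
    exact contDiff_fst.prodMk contDiff_snd.neg
  have key := contDiffOn_convolution_right_with_param (n := ⊤) (μ := volume)
    (ContinuousLinearMap.lsmul ℝ ℝ : ℝ →L[ℝ] W →L[ℝ] W) (s := (univ : Set P))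
    (k := Metric.closedBall (0 : ℝ) 3) (f := f) (g := h) isOpen_univ (isCompact_closedBall _ _)
    (fun z t _ ht => by
      have : b t = 0 := b.zero_of_le_dist (le_of_lt (by simpa using ht))
      simp [h, this]) hf (by
      exact hh.contDiffOn)
  rw [univ_prod_univ, contDiffOn_univ] at key
  have key2 := key.comp (contDiff_id.prodMk contDiff_const : ContDiff ℝ ∞ fun z : P => (z, (0 : ℝ)))
  convert! key2 using 2 with z
  simp only [Function.comp_def, convolution, id, zero_sub]
  rw [intervalIntegral.integral_of_le zero_le_one, ← integral_indicator measurableSet_Ioc]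
  refine integral_congr_ae (Eventually.of_forall fun t => ?_)
  by_cases ht : t ∈ Ioc (0 : ℝ) 1
  · have hb : b (-t) = 1 := b.one_of_mem_closedBall (by
      simp only [mem_closedBall_zero_iff, norm_neg, Real.norm_eq_abs]
      change |t| ≤ 2
      rw [abs_of_pos ht.1]; linarith [ht.2])
    simp [f, h, hb, indicator_of_mem ht, sub_smul]
  · simp [f, indicator_of_notMem ht]

end ParametricIntegral

section InverseFunction

/-- The inverse function theorem for smooth functions, with a local inverse that is smooth on its
whole domain. The source can be chosen in a given neighbourhood. -/
lemma exists_smooth_openPartialHomeomorph {E F : Type*} [NormedAddCommGroup E] [NormedSpace ℝ E]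
    [CompleteSpace E] [NormedAddCommGroup F] [NormedSpace ℝ F] {f : E → F} {z₀ : E}
    {f' : E ≃L[ℝ] F} (hf : ∀ᶠ z in 𝓝 z₀, ContDiffAt ℝ ∞ f z)
    (hf' : HasFDerivAt f (f' : E →L[ℝ] F) z₀) {P : E → Prop} (hP : ∀ᶠ z in 𝓝 z₀, P z) :
    ∃ Φ : OpenPartialHomeomorph E F, ⇑Φ = f ∧ z₀ ∈ Φ.source ∧ (∀ z ∈ Φ.source, P z) ∧
      (∀ z ∈ Φ.source, ContDiffAt ℝ ∞ f z) ∧ ∀ w ∈ Φ.target, ContDiffAt ℝ ∞ Φ.symm w := by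
  have hn : (∞ : WithTop ℕ∞) ≠ 0 := by simp
  have hz₀ := hf.self_of_nhds
  let Φ := hz₀.toOpenPartialHomeomorph f hf' hn
  have hinv : ∀ᶠ z in 𝓝 z₀, ∃ A : E ≃L[ℝ] F, (A : E →L[ℝ] F) = fderiv ℝ f z := by
    have hc : ContinuousAt (fderiv ℝ f) z₀ := (hz₀.fderiv_right (m := ∞) (by simp)).continuousAt
    rw [ContinuousAt, hf'.fderiv] at hc
    exact hc.eventually (ContinuousLinearEquiv.nhds f')
  obtain ⟨O, hO, hOo, hzO⟩ := eventually_nhds_iff.1 ((hf.and hinv).and hP)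
  refine ⟨Φ.restrOpen O hOo, rfl, ⟨hz₀.mem_toOpenPartialHomeomorph_source hf' hn, hzO⟩,
    fun z hz => (hO z hz.2).2, fun z hz => (hO z hz.2).1.1, fun w hw => ?_⟩
  have hs := (Φ.restrOpen O hOo).map_target hw
  obtain ⟨A, hA⟩ := (hO _ hs.2).1.2
  have hd := (hO _ hs.2).1.1
  refine (Φ.restrOpen O hOo).contDiffAt_symm (f₀' := A) hw ?_ hd
  rw [hA]
  exact (hd.differentiableAt hn).hasFDerivAt

end InverseFunction

section SquareRoot

variable {A : Type*} [NormedRing A] [NormedAlgebra ℝ A] [CompleteSpace A]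

/-- Square roots near the unit in a Banach algebra, by the inverse function theorem. -/
lemma exists_sqrt_near_one : ∃ ρ : A → A, (∀ᶠ a in 𝓝 (1 : A), ContDiffAt ℝ ∞ ρ a) ∧ ρ 1 = 1 ∧
    (∀ᶠ a in 𝓝 (1 : A), ρ a * ρ a = a) ∧ ∀ᶠ s in 𝓝 (1 : A), ρ (s * s) = s := by
  have hc : ContDiff ℝ ∞ (fun s : A => s * s) := contDiff_id.mul contDiff_id
  have hd : HasFDerivAt (fun s : A => s * s)
      ((ContinuousLinearEquiv.smulLeft (Units.mk0 (2 : ℝ) two_ne_zero) : A ≃L[ℝ] A) : A →L[ℝ] A)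
      1 := by
    refine ((hasFDerivAt_id (𝕜 := ℝ) (1 : A)).mul' (hasFDerivAt_id (1 : A))).congr_fderiv ?_
    ext s
    simp [two_smul]
  obtain ⟨Φ, hΦ, h1, -, -, hs⟩ := exists_smooth_openPartialHomeomorph
    (Eventually.of_forall fun z => hc.contDiffAt) hd (P := fun _ => True)
    (Eventually.of_forall fun _ => trivial)
  have hval : ∀ s, Φ s = s * s := fun s => congrFun hΦ s
  have h1t : (1 : A) ∈ Φ.target := by
    have := Φ.map_source h1
    rwa [hval, one_mul] at this
  refine ⟨Φ.symm, ?_, ?_, ?_, ?_⟩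
  · filter_upwards [Φ.open_target.mem_nhds h1t] with a ha using hs a ha
  · have := Φ.left_inv h1
    rwa [hval, one_mul] at this
  · filter_upwards [Φ.open_target.mem_nhds h1t] with a ha
    rw [← hval, Φ.right_inv ha]
  · filter_upwards [Φ.open_source.mem_nhds h1] with s hs
    rw [← hval, Φ.left_inv hs]

end SquareRoot

/-! ### The Morse–Bott lemma for nonnegative functions -/

section Normalization

/-- A positive definite symmetric bilinear form is the standard inner product in suitable linear
coordinates. -/
lemma exists_equiv_inner_of_posDef {F : Type*} [NormedAddCommGroup F] [InnerProductSpace ℝ F]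
    [FiniteDimensional ℝ F] (w : F →L[ℝ] F →L[ℝ] ℝ) (hs : ∀ u v, w u v = w v u)
    (hp : ∀ u, u ≠ 0 → 0 < w u u) : ∃ B : F ≃L[ℝ] F, ∀ u v, w u v = inner ℝ (B u) (B v) := by
  let w' : LinearMap.BilinForm ℝ F := LinearMap.mk₂ ℝ (fun u v => w u v)
    (by simp) (by simp) (by simp) (by simp)
  have hw' : ∀ u v, w' u v = w u v := fun u v => rfl
  obtain ⟨b, hb⟩ := LinearMap.BilinForm.exists_orthogonal_basis (B := w') ⟨fun u v => hs u v⟩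
  have hpos : ∀ i, 0 < w (b i) (b i) := fun i => hp _ (b.ne_zero i)
  let B : F ≃L[ℝ] F := (b.equiv ((stdOrthonormalBasis ℝ F).toBasis.isUnitSMul
    (w := fun i => √(w (b i) (b i))) fun i => (Real.sqrt_pos.2 (hpos i)).ne'.isUnit)
      (Equiv.refl _)).toContinuousLinearEquiv
  have hB : ∀ i, B (b i) = √(w (b i) (b i)) • stdOrthonormalBasis ℝ F i := fun i => by
    simp [B, Module.Basis.isUnitSMul_apply]
  refine ⟨B, ?_⟩
  let w'' : LinearMap.BilinForm ℝ F := LinearMap.mk₂ ℝ (fun u v => inner ℝ (B u) (B v))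
    (by simp [inner_add_left]) (by simp [inner_smul_left]) (by simp [inner_add_right])
    (by simp [inner_smul_right])
  have : w' = w'' := by
    refine LinearMap.BilinForm.ext_basis b fun i j => ?_
    change w (b i) (b j) = inner ℝ (B (b i)) (B (b j))
    rw [hB, hB, inner_smul_left, inner_smul_right, OrthonormalBasis.inner_eq_ite]
    by_cases hij : i = j
    · subst hij
      simp [Real.mul_self_sqrt (hpos i).le]
    · have h0 : w (b i) (b j) = 0 := hb hij
      simp [hij, h0]
  intro u v
  exact DFunLike.congr_fun (DFunLike.congr_fun this u) v

end Normalization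

section Taylor

variable {E F : Type*} [NormedAddCommGroup E] [NormedSpace ℝ E]
  [NormedAddCommGroup F] [NormedSpace ℝ F]

/-- The point `(1 - t) π z + t z`, where `π = 1 - j p` is a linear projection. -/
def segPoint (p : E →L[ℝ] F) (j : F →L[ℝ] E) (z : E) (t : ℝ) : E := (z - j (p z)) + t • j (p z)

/-- The weighted integral of the second derivative of `f` that occurs in the remainder of the
Taylor formula of order two in the direction of the image of `j`. -/
def taylorForm (f : E → ℝ) (p : E →L[ℝ] F) (j : F →L[ℝ] E) (z : E) : E →L[ℝ] E →L[ℝ] ℝ :=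
  ∫ t in (0 : ℝ)..1, (1 - t) • fderiv ℝ (fderiv ℝ f) (segPoint p j z t)

variable {f : E → ℝ} {p : E →L[ℝ] F} {j : F →L[ℝ] E}

lemma contDiff_segPoint : ContDiff ℝ ∞ fun q : E × ℝ => segPoint p j q.1 q.2 := by
  unfold segPoint; fun_prop

lemma contDiff_fderiv_fderiv (hf : ContDiff ℝ ∞ f) : ContDiff ℝ ∞ (fderiv ℝ (fderiv ℝ f)) :=
  (hf.fderiv_right (m := ∞) (by simp)).fderiv_right (m := ∞) (by simp)

lemma contDiff_taylorForm (hf : ContDiff ℝ ∞ f) : ContDiff ℝ ∞ (taylorForm f p j) :=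
  contDiff_integral_one_sub_smul
    (g := fun q : E × ℝ => fderiv ℝ (fderiv ℝ f) (segPoint p j q.1 q.2))
    ((contDiff_fderiv_fderiv hf).comp contDiff_segPoint)

lemma taylorForm_apply (hf : ContDiff ℝ ∞ f) (z u v : E) : taylorForm f p j z u v =
    ∫ t in (0 : ℝ)..1, (1 - t) * fderiv ℝ (fderiv ℝ f) (segPoint p j z t) u v := by
  have hc : Continuous fun t : ℝ => (1 - t) • fderiv ℝ (fderiv ℝ f) (segPoint p j z t) := by
    refine (continuous_const.sub continuous_id).smul ?_
    exact (contDiff_fderiv_fderiv hf).continuous.comp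
      (contDiff_segPoint.continuous.comp (Continuous.prodMk_right z))
  let ev : (E →L[ℝ] E →L[ℝ] ℝ) →L[ℝ] ℝ :=
    (ContinuousLinearMap.apply ℝ ℝ v) ∘L (ContinuousLinearMap.apply ℝ (E →L[ℝ] ℝ) u)
  exact (ContinuousLinearMap.intervalIntegral_comp_comm (𝕜 := ℝ) (E := E →L[ℝ] E →L[ℝ] ℝ)
    (F := ℝ) (μ := MeasureTheory.volume) (a := 0) (b := 1) ev (Continuous.intervalIntegrable
      (E := E →L[ℝ] E →L[ℝ] ℝ) (μ := MeasureTheory.volume) hc 0 1)).symm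

lemma fderiv_fderiv_comm (hf : ContDiff ℝ ∞ f) (z u v : E) :
    fderiv ℝ (fderiv ℝ f) z u v = fderiv ℝ (fderiv ℝ f) z v u :=
  (hf.contDiffAt.isSymmSndFDerivAt (n := ∞) (by simpa using two_le_infty)).eq u v

lemma taylorForm_comm (hf : ContDiff ℝ ∞ f) (z u v : E) :
    taylorForm f p j z u v = taylorForm f p j z v u := by
  simp only [taylorForm_apply hf, fderiv_fderiv_comm hf _ u v]

lemma taylorForm_eq_of_apply_eq_zero {z : E} (hz : p z = 0) :
    taylorForm f p j z = (1 / 2 : ℝ) • fderiv ℝ (fderiv ℝ f) z := by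
  have h : ∫ t in (0 : ℝ)..1, (1 - t) = 1 / 2 := by
    rw [intervalIntegral.integral_sub (by simp) (by simp)]
    simp
    norm_num
  simp only [taylorForm, segPoint, hz, map_zero, sub_zero, smul_zero, add_zero]
  exact (intervalIntegral.integral_smul_const (E := E →L[ℝ] E →L[ℝ] ℝ) (fun t : ℝ => 1 - t)
    (fderiv ℝ (fderiv ℝ f) z)).trans (by rw [h])

/-- Taylor's formula for a function that vanishes to first order along the kernel of `p`. -/
lemma eq_taylorForm (hf : ContDiff ℝ ∞ f) (hpj : ∀ v, p (j v) = v) (h0 : ∀ z, p z = 0 → f z = 0)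
    (h1 : ∀ z, p z = 0 → fderiv ℝ f z = 0) (z : E) :
    f z = taylorForm f p j z (j (p z)) (j (p z)) := by
  rw [taylorForm_apply hf]
  set v := j (p z) with hv
  have hseg : ∀ t : ℝ, HasDerivAt (segPoint p j z) v t := fun t => by
    have := ((hasDerivAt_id t).smul_const v).const_add (z - v)
    rw [one_smul] at this
    exact this
  have hd1 : ∀ t : ℝ, HasDerivAt (fun t => f (segPoint p j z t))
      (fderiv ℝ f (segPoint p j z t) v) t := fun t =>
    (hf.differentiable (by simp) _).hasFDerivAt.comp_hasDerivAt t (hseg t)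
  have hd2 : ∀ t : ℝ, HasDerivAt (fun t => fderiv ℝ f (segPoint p j z t) v)
      (fderiv ℝ (fderiv ℝ f) (segPoint p j z t) v v) t := fun t => by
    have h := ((hf.fderiv_right (m := ∞) (by simp)).differentiable (by simp)
      (segPoint p j z t)).hasFDerivAt.comp_hasDerivAt t (hseg t)
    have := h.clm_apply (hasDerivAt_const t v)
    simpa using this
  have hd3 : ∀ t : ℝ, HasDerivAt
      (fun t => (1 - t) * fderiv ℝ f (segPoint p j z t) v + f (segPoint p j z t))
      ((1 - t) * fderiv ℝ (fderiv ℝ f) (segPoint p j z t) v v) t := fun t => by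
    have := (((hasDerivAt_id t).const_sub 1).mul (hd2 t)).add (hd1 t)
    refine this.congr_deriv ?_
    simp
  have hc : Continuous fun t : ℝ =>
      (1 - t) * fderiv ℝ (fderiv ℝ f) (segPoint p j z t) v v := by
    refine (continuous_const.sub continuous_id).mul ?_
    have hcs : Continuous fun t : ℝ => fderiv ℝ (fderiv ℝ f) (segPoint p j z t) :=
      (contDiff_fderiv_fderiv hf).continuous.comp
        (contDiff_segPoint.continuous.comp (Continuous.prodMk_right z))
    fun_prop
  rw [intervalIntegral.integral_eq_sub_of_hasDerivAt (fun t _ => hd3 t)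
    (hc.intervalIntegrable 0 1)]
  have hp0 : p (segPoint p j z 0) = 0 := by simp [segPoint, hpj]
  have hs1 : segPoint p j z 1 = z := by simp [segPoint]
  rw [h1 _ hp0, h0 _ hp0, hs1]
  simp

end Taylor

section MorseLemma

variable {E : Type*} [NormedAddCommGroup E] [NormedSpace ℝ E] [FiniteDimensional ℝ E]
  {F : Type*} [NormedAddCommGroup F] [InnerProductSpace ℝ F] [FiniteDimensional ℝ F]
  {f : E → ℝ} {p : E →L[ℝ] F} {j : F →L[ℝ] E}

lemma fderiv_eq_zero_of_nonneg (h0 : ∀ z, 0 ≤ f z) {z : E} (hz : f z = 0) : fderiv ℝ f z = 0 := by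
  refine IsLocalMin.fderiv_eq_zero (Eventually.of_forall fun y => ?_)
  rw [hz]; exact h0 y

/-- At a zero of a nonnegative function that vanishes along the kernel of `p` and whose Hessian has
the maximal possible rank, the Hessian is positive definite in the complementary directions. -/
lemma fderiv_fderiv_pos (hf : ContDiff ℝ ∞ f) (hpj : ∀ v, p (j v) = v) (hnn : ∀ z, 0 ≤ f z)
    (h0 : ∀ z, p z = 0 → f z = 0) {z₀ : E} (hz₀ : p z₀ = 0)
    (hrank : Module.finrank ℝ (LinearMap.range (fderiv ℝ (fderiv ℝ f) z₀).toLinearMap)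
      = Module.finrank ℝ F) {u : F} (hu : u ≠ 0) :
    0 < fderiv ℝ (fderiv ℝ f) z₀ (j u) (j u) := by
  set D := fderiv ℝ (fderiv ℝ f) z₀ with hD
  have h1 : ∀ z, p z = 0 → fderiv ℝ f z = 0 := fun z hz => fderiv_eq_zero_of_nonneg hnn (h0 z hz)
  have hsymm : ∀ u v, D u v = D v u := fderiv_fderiv_comm hf z₀
  -- the Hessian vanishes along the kernel of `p`, where `f` vanishes to first order
  have hker : ∀ v, p v = 0 → D v = 0 := by
    intro v hv
    have hline : HasDerivAt (fun t : ℝ => z₀ + t • v) v 0 := by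
      simpa using ((hasDerivAt_id (0 : ℝ)).smul_const v).const_add z₀
    have hDz : HasFDerivAt (fderiv ℝ f) D (z₀ + (0 : ℝ) • v) := by
      rw [zero_smul, add_zero]
      exact ((hf.fderiv_right (m := ∞) (by simp)).differentiable (by simp) _).hasFDerivAt
    have h2 := hDz.comp_hasDerivAt (0 : ℝ) hline
    have h3 : (fderiv ℝ f ∘ fun t : ℝ => z₀ + t • v) = fun _ => 0 := by
      funext t
      exact h1 _ (by simp [hz₀, hv])
    rw [h3] at h2
    exact h2.unique (hasDerivAt_const _ _)
  have hproj : ∀ v, D v = D (j (p v)) := fun v => by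
    rw [← sub_eq_zero, ← map_sub]
    exact hker _ (by simp [hpj])
  have hform : ∀ u v, D u v = D (j (p u)) (j (p v)) := fun u v => by
    rw [hproj u, hsymm, hproj v, hsymm]
  have hnonneg : ∀ u, 0 ≤ D (j u) (j u) := by
    intro u
    have hcont : Continuous fun s : ℝ => taylorForm f p j (z₀ + s • j u) (j u) (j u) := by
      have : Continuous fun s : ℝ => taylorForm f p j (z₀ + s • j u) :=
        (contDiff_taylorForm hf).continuous.comp (by fun_prop)
      fun_prop
    have hpos : ∀ s : ℝ, s ≠ 0 → 0 ≤ taylorForm f p j (z₀ + s • j u) (j u) (j u) := by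
      intro s hs
      have h := eq_taylorForm hf hpj h0 h1 (z₀ + s • j u)
      have hps : p (z₀ + s • j u) = s • u := by simp [hz₀, hpj]
      rw [hps] at h
      simp only [map_smul, smul_apply, smul_eq_mul] at h
      have h2 := hnn (z₀ + s • j u)
      rw [h, ← mul_assoc] at h2
      exact nonneg_of_mul_nonneg_right h2 (mul_self_pos.2 hs)
    have hlim : Tendsto (fun s : ℝ => taylorForm f p j (z₀ + s • j u) (j u) (j u)) (𝓝[≠] 0)
        (𝓝 (taylorForm f p j z₀ (j u) (j u))) := by
      have := hcont.tendsto 0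
      rw [zero_smul, add_zero] at this
      exact this.mono_left nhdsWithin_le_nhds
    have h3 := ge_of_tendsto hlim (eventually_mem_nhdsWithin.mono fun s hs => hpos s hs)
    rw [taylorForm_eq_of_apply_eq_zero hz₀] at h3
    simp only [smul_apply, smul_eq_mul] at h3
    linarith
  have hinj : Function.Injective (D.toLinearMap ∘ₗ j.toLinearMap) := by
    refine LinearMap.ker_eq_bot.1 ?_
    have hr : LinearMap.range (D.toLinearMap ∘ₗ j.toLinearMap) = LinearMap.range D.toLinearMap := by
      refine le_antisymm (LinearMap.range_comp_le_range _ _) ?_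
      rintro _ ⟨v, rfl⟩
      exact ⟨p v, (hproj v).symm⟩
    have h4 := LinearMap.finrank_range_add_finrank_ker (D.toLinearMap ∘ₗ j.toLinearMap)
    rw [hr, hrank] at h4
    exact Submodule.finrank_eq_zero.1 (by omega)
  refine lt_of_le_of_ne (hnonneg u) fun hzero => hu ?_
  -- a vector that is isotropic for a positive semidefinite form lies in its kernel
  have hiso : ∀ v, D (j u) (j v) = 0 := by
    intro v
    by_contra hne
    set a := D (j u) (j v) with ha
    set c := D (j v) (j v) with hc
    have h5 : ∀ s : ℝ, 0 ≤ 2 * s * a + s ^ 2 * c := by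
      intro s
      have h := hnonneg (u + s • v)
      simp only [map_add, map_smul, add_apply, smul_apply,
        smul_eq_mul, ← hzero, ← hc, hsymm (j v) (j u), ← ha] at h
      linarith
    have hc0 : 0 ≤ c := hnonneg v
    have h6 := h5 (-a / (c + 1))
    have h7 : 2 * (-a / (c + 1)) * a + (-a / (c + 1)) ^ 2 * c
        = -(a ^ 2 * (c + 2)) / (c + 1) ^ 2 := by field_simp; ring
    rw [h7] at h6
    have h8 : 0 < a ^ 2 * (c + 2) / (c + 1) ^ 2 := by positivity
    rw [neg_div] at h6
    linarith
  refine hinj ?_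
  ext v
  have : D (j u) v = 0 := by
    rw [hform, hpj]; exact hiso _
  simpa using this

/-- **Morse–Bott lemma** for nonnegative functions: such a function is a sum of squares of
coordinate functions in suitable coordinates. Taylor's formula gives `f z = ⟪H z v, v⟫`, where `v`
is a linear function of `p z` and the symmetric operator `H z` depends smoothly on `z` and is the
identity at `z₀`; its square root `S z` gives `f z = ‖S z v‖ ^ 2`. -/
lemma exists_morse_coordinates (hf : ContDiff ℝ ∞ f) (hpj : ∀ v, p (j v) = v)
    (hnn : ∀ z, 0 ≤ f z) (h0 : ∀ z, p z = 0 → f z = 0) {z₀ : E} (hz₀ : p z₀ = 0)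
    (hrank : Module.finrank ℝ (LinearMap.range (fderiv ℝ (fderiv ℝ f) z₀).toLinearMap)
      = Module.finrank ℝ F) :
    ∃ (φ : E → E) (φ' : E ≃L[ℝ] E), (∀ᶠ z in 𝓝 z₀, ContDiffAt ℝ ∞ φ z) ∧
      HasFDerivAt φ (φ' : E →L[ℝ] E) z₀ ∧
      ∀ᶠ z in 𝓝 z₀, f z = ‖p (φ z)‖ ^ 2 := by
  have h1 : ∀ z, p z = 0 → fderiv ℝ f z = 0 := fun z hz => fderiv_eq_zero_of_nonneg hnn (h0 z hz)
  set T := taylorForm f p j with hT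
  have hTz₀ : T z₀ = (1 / 2 : ℝ) • fderiv ℝ (fderiv ℝ f) z₀ := taylorForm_eq_of_apply_eq_zero hz₀
  obtain ⟨B, hB⟩ := exists_equiv_inner_of_posDef
    (((ContinuousLinearMap.compL ℝ F E ℝ).flip j) ∘L (T z₀ ∘L j))
    (fun u v => taylorForm_comm hf z₀ (j u) (j v)) (fun u hu => by
      change 0 < T z₀ (j u) (j u)
      rw [hTz₀]
      have := fderiv_fderiv_pos hf hpj hnn h0 hz₀ hrank hu
      simp only [smul_apply, smul_eq_mul]
      linarith)
  replace hB : ∀ u v, T z₀ (j u) (j v) = inner ℝ (B u) (B v) := hB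
  -- the operator `H z` representing the form `T z` in the coordinates given by `B`
  let i : F →L[ℝ] E := j ∘L (B.symm : F →L[ℝ] F)
  let R : (F →L[ℝ] ℝ) →L[ℝ] F := LinearMap.toContinuousLinearMap
    { toFun := (InnerProductSpace.toDual ℝ F).symm
      map_add' := map_add _
      map_smul' := fun c w => by simp }
  let C : (E →L[ℝ] E →L[ℝ] ℝ) →L[ℝ] (F →L[ℝ] F) :=
    (ContinuousLinearMap.compL ℝ F (F →L[ℝ] ℝ) F R) ∘L
    (ContinuousLinearMap.compL ℝ F (E →L[ℝ] ℝ) (F →L[ℝ] ℝ)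
      ((ContinuousLinearMap.compL ℝ F E ℝ).flip i)) ∘L
    ((ContinuousLinearMap.compL ℝ F E (E →L[ℝ] ℝ)).flip i)
  have hC : ∀ w u v, inner ℝ (C w u) v = w (i u) (i v) := by
    intro w u v
    exact InnerProductSpace.toDual_symm_apply (𝕜 := ℝ)
  let H : E → F →L[ℝ] F := fun z => C (T z)
  have hH : ContDiff ℝ ∞ H :=
    ContDiff.comp (g := C) (f := T)
      (ContinuousLinearMap.contDiff (𝕜 := ℝ) (E := E →L[ℝ] E →L[ℝ] ℝ) (F := F →L[ℝ] F) (n := ∞) C)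
      (contDiff_taylorForm hf)
  have hH₀ : H z₀ = 1 := by
    ext1 u
    refine ext_inner_right ℝ fun v => ?_
    rw [hC, one_apply_eq_self]
    change T z₀ (j (B.symm u)) (j (B.symm v)) = _
    rw [hB, B.apply_symm_apply, B.apply_symm_apply]
  have hHsymm : ∀ z, (H z).adjoint = H z := fun z => by
    refine ((ContinuousLinearMap.eq_adjoint_iff _ _).2 fun u v => ?_).symm
    rw [hC, real_inner_comm, hC]
    exact taylorForm_comm hf z _ _
  obtain ⟨ρ, hρ, hρ1, hρsq, hρinv⟩ := exists_sqrt_near_one (A := F →L[ℝ] F)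
  let S : E → F →L[ℝ] F := fun z => ρ (H z)
  have hSev : ∀ᶠ z in 𝓝 z₀, ContDiffAt ℝ ∞ S z := by
    have := hH.continuous.tendsto z₀
    rw [hH₀] at this
    filter_upwards [this.eventually hρ] with z hz using hz.comp z hH.contDiffAt
  have hS : ContDiffAt ℝ ∞ S z₀ := hSev.self_of_nhds
  have hS₀ : S z₀ = 1 := by simp only [S, hH₀, hρ1]
  have hSq : ∀ᶠ z in 𝓝 z₀, S z * S z = H z := by
    have := hH.continuous.tendsto z₀
    rw [hH₀] at this
    exact this.eventually hρsq
  -- the adjoint of `S z` is a square root of `H z` near `1` too, so it equals `S z`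
  have hSsymm : ∀ᶠ z in 𝓝 z₀, (S z).adjoint = S z := by
    have hcont : Tendsto (fun z => (S z).adjoint) (𝓝 z₀) (𝓝 1) := by
      have h : ContinuousAt (fun z => (S z).adjoint) z₀ :=
        (ContinuousLinearMap.adjoint (𝕜 := ℝ) (E := F) (F := F)).continuous.continuousAt.comp
          hS.continuousAt
      have h2 : (S z₀).adjoint = 1 := by rw [hS₀, ← ContinuousLinearMap.star_eq_adjoint, star_one]
      rw [ContinuousAt, h2] at h
      exact h
    filter_upwards [hcont.eventually hρinv, hSq] with z h2 h3
    have h4 : (S z).adjoint * (S z).adjoint = H z := by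
      rw [← hHsymm z, ← h3, ← ContinuousLinearMap.star_eq_adjoint,
        ← ContinuousLinearMap.star_eq_adjoint, star_mul]
    rw [h4] at h2
    exact h2.symm
  let φ : E → E := fun z => j (S z (B (p z))) + (z - j (p z))
  have hpφ : ∀ z, p (φ z) = S z (B (p z)) := fun z => by simp [φ, hpj]
  have hφ : ∀ᶠ z in 𝓝 z₀, ContDiffAt ℝ ∞ φ z := by
    filter_upwards [hSev] with z hz
    have h2 : ContDiffAt ℝ ∞ (fun z => B (p z)) z := by fun_prop
    have h3 : ContDiffAt ℝ ∞ (fun z => S z (B (p z))) z := hz.clm_apply h2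
    have h4 : ContDiffAt ℝ ∞ (fun z => z - j (p z)) z := by fun_prop
    exact (j.contDiff.contDiffAt.comp z h3).add h4
  let A : E →L[ℝ] E := j ∘L (B : F →L[ℝ] F) ∘L p + (ContinuousLinearMap.id ℝ E - j ∘L p)
  let A' : E →L[ℝ] E := j ∘L (B.symm : F →L[ℝ] F) ∘L p + (ContinuousLinearMap.id ℝ E - j ∘L p)
  let φ' : E ≃L[ℝ] E := ContinuousLinearEquiv.equivOfInverse A A'
    (fun z => by simp [A, A', hpj]) (fun z => by simp [A, A', hpj])
  refine ⟨φ, φ', hφ, ?_, ?_⟩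
  · have h2 : HasFDerivAt S (fderiv ℝ S z₀) z₀ := (hS.differentiableAt (by simp)).hasFDerivAt
    have h3 : HasFDerivAt (fun z => B (p z)) ((B : F →L[ℝ] F) ∘L p) z₀ :=
      ((B : F →L[ℝ] F) ∘L p).hasFDerivAt
    have h4 := j.hasFDerivAt.comp z₀ (h2.clm_apply h3)
    have h5 := h4.add (ContinuousLinearMap.id ℝ E - j ∘L p).hasFDerivAt
    refine h5.congr_fderiv ?_
    ext v
    simp [φ', A, hS₀, hz₀]
  · filter_upwards [hSq, hSsymm] with z h2 h3
    rw [hpφ, ← real_inner_self_eq_norm_sq]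
    nth_rw 1 [← h3]
    rw [ContinuousLinearMap.adjoint_inner_left, ← mul_apply_eq_comp, h2,
      real_inner_comm, hC, eq_taylorForm hf hpj h0 h1 z]
    simp [i, hT]

end MorseLemma

/-! ### Morse–Bott charts on manifolds -/

section HessianRank

variable {E : Type*} [NormedAddCommGroup E] [NormedSpace ℝ E] [FiniteDimensional ℝ E]

/-- The rank of the second derivative at a critical point does not depend on the coordinates. -/
lemma finrank_range_fderiv_fderiv_comp {f g : E → ℝ} {ψ : E → E} {z : E}
    (hfg : f =ᶠ[𝓝 z] g ∘ ψ) (hg : ContDiffAt ℝ ∞ g (ψ z)) (hψ : ContDiffAt ℝ ∞ ψ z)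
    (hcrit : fderiv ℝ g (ψ z) = 0) (hsurj : Function.Surjective (fderiv ℝ ψ z)) :
    Module.finrank ℝ (LinearMap.range (fderiv ℝ (fderiv ℝ f) z).toLinearMap)
      = Module.finrank ℝ (LinearMap.range (fderiv ℝ (fderiv ℝ g) (ψ z)).toLinearMap) := by
  have hev : fderiv ℝ f =ᶠ[𝓝 z] fun y => (fderiv ℝ g (ψ y)) ∘L (fderiv ℝ ψ y) := by
    have h1 : ∀ᶠ y in 𝓝 z, DifferentiableAt ℝ ψ y :=
      ((hψ.of_le (m := 1) (by simp)).eventually (by simp)).mono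
        fun y hy => hy.differentiableAt (by simp)
    have h2 : ∀ᶠ y in 𝓝 z, DifferentiableAt ℝ g (ψ y) :=
      hψ.continuousAt.eventually (((hg.of_le (m := 1) (by simp)).eventually (by simp)).mono
        fun y hy => hy.differentiableAt (by simp))
    filter_upwards [hfg.fderiv (𝕜 := ℝ), h1, h2] with y hy h1 h2
    rw [hy, fderiv_comp y h2 h1]
  have hg2 : HasFDerivAt (fderiv ℝ g) (fderiv ℝ (fderiv ℝ g) (ψ z)) (ψ z) :=
    ((hg.fderiv_right (m := ∞) (by simp)).differentiableAt (by simp)).hasFDerivAt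
  have hψ1 : HasFDerivAt ψ (fderiv ℝ ψ z) z := (hψ.differentiableAt (by simp)).hasFDerivAt
  have hψ2 : HasFDerivAt (fderiv ℝ ψ) (fderiv ℝ (fderiv ℝ ψ) z) z :=
    ((hψ.fderiv_right (m := ∞) (by simp)).differentiableAt (by simp)).hasFDerivAt
  have hD := (hg2.comp z hψ1).clm_comp hψ2
  set D := fderiv ℝ (fderiv ℝ g) (ψ z) with hDdef
  set A := fderiv ℝ ψ z with hA
  let J : (E →L[ℝ] ℝ) →ₗ[ℝ] (E →L[ℝ] ℝ) := ((ContinuousLinearMap.compL ℝ E E ℝ).flip A).toLinearMap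
  have hJ : Function.Injective J := by
    intro w w' h
    ext v
    obtain ⟨u, rfl⟩ := hsurj v
    exact DFunLike.congr_fun h u
  have hDf : (fderiv ℝ (fderiv ℝ f) z).toLinearMap = J ∘ₗ (D.toLinearMap ∘ₗ A.toLinearMap) := by
    rw [hev.fderiv_eq]
    refine LinearMap.ext fun u => ContinuousLinearMap.ext fun v => ?_
    have := DFunLike.congr_fun (DFunLike.congr_fun hD.fderiv u) v
    refine this.trans ?_
    simp [J, hcrit]
  have hr : LinearMap.range (J ∘ₗ (D.toLinearMap ∘ₗ A.toLinearMap))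
      = (LinearMap.range D.toLinearMap).map J := by
    rw [LinearMap.range_comp, LinearMap.range_comp, LinearMap.range_eq_top.2 hsurj,
      Submodule.map_top]
  rw [hDf, hr]
  exact (LinearEquiv.finrank_eq (Submodule.equivMapOfInjective J hJ _)).symm

end HessianRank

section MorseChart

variable {n m : ℕ}

/-- The projection of `ℝⁿ` to the first `m` coordinates. -/
def firstProj (h : m ≤ n) : EuclideanSpace ℝ (Fin n) →L[ℝ] EuclideanSpace ℝ (Fin m) :=
  (EuclideanSpace.equiv (Fin m) ℝ).symm.toContinuousLinearMap ∘L
    ContinuousLinearMap.pi fun i => EuclideanSpace.proj (Fin.castLE h i)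

/-- The inclusion of `ℝᵐ` in `ℝⁿ` by the first `m` coordinates. -/
def firstIncl (h : m ≤ n) : EuclideanSpace ℝ (Fin m) →L[ℝ] EuclideanSpace ℝ (Fin n) :=
  ∑ i : Fin m, (EuclideanSpace.proj i).smulRight (EuclideanSpace.single (Fin.castLE h i) (1 : ℝ))

lemma firstProj_apply (h : m ≤ n) (z : EuclideanSpace ℝ (Fin n)) (i : Fin m) :
    firstProj h z i = z (Fin.castLE h i) := rfl

lemma firstProj_firstIncl (h : m ≤ n) (v : EuclideanSpace ℝ (Fin m)) :
    firstProj h (firstIncl h v) = v := by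
  ext i
  rw [firstProj_apply]
  simp only [firstIncl, sum_apply, ContinuousLinearMap.smulRight_apply,
    WithLp.ofLp_sum, Finset.sum_apply]
  rw [Finset.sum_eq_single i]
  · simp
  · intro a _ ha
    have : Fin.castLE h i ≠ Fin.castLE h a := fun hia => ha (Fin.castLE_injective h hia).symm
    simp [this]
  · simp

lemma norm_firstProj_sq (h : m ≤ n) (z : EuclideanSpace ℝ (Fin n)) :
    ‖firstProj h z‖ ^ 2 = normSq n m z := by
  rw [EuclideanSpace.real_norm_sq_eq, normSq_apply]
  have : firstCoords n m = Finset.univ.map (Fin.castLEEmb h) := by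
    ext i
    simp only [firstCoords, Finset.mem_filter, Finset.mem_univ, true_and, Finset.mem_map]
    constructor
    · intro hi
      exact ⟨⟨i, hi⟩, rfl⟩
    · rintro ⟨a, rfl⟩
      exact a.2
  rw [this, Finset.sum_map]
  rfl

lemma firstProj_eq_zero_iff (h : m ≤ n) (z : EuclideanSpace ℝ (Fin n)) :
    firstProj h z = 0 ↔ ∀ i : Fin n, (i : ℕ) < m → z i = 0 := by
  constructor
  · intro hz i hi
    exact congrArg (fun v : EuclideanSpace ℝ (Fin m) => v ⟨i, hi⟩) hz
  · intro hz
    ext i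
    exact hz _ i.2

variable {X : Type*} [TopologicalSpace X] [ChartedSpace (EuclideanSpace ℝ (Fin n)) X]
  [IsManifold (𝓡 n) ∞ X]

lemma contDiffOn_comp_symm_max {f : X → ℝ} (hf : ContMDiff (𝓡 n) 𝓘(ℝ, ℝ) ∞ f)
    {e : OpenPartialHomeomorph X (EuclideanSpace ℝ (Fin n))}
    (he : e ∈ IsManifold.maximalAtlas (𝓡 n) ∞ X) : ContDiffOn ℝ ∞ (f ∘ e.symm) e.target := by
  rw [← contMDiffOn_iff_contDiffOn]
  exact hf.comp_contMDiffOn (contMDiffOn_symm_of_mem_maximalAtlas he)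

/-- The rank of the Hessian at a zero of a nonnegative function can be computed in any chart of the
maximal atlas. -/
lemma finrank_range_hessian {μ : C^∞⟮𝓡 n, X; 𝓘(ℝ, ℝ), ℝ⟯} {y : X} (hnn : ∀ x, 0 ≤ μ x)
    (hy : μ y = 0) {e : OpenPartialHomeomorph X (EuclideanSpace ℝ (Fin n))}
    (he : e ∈ IsManifold.maximalAtlas (𝓡 n) ∞ X) (hye : y ∈ e.source) :
    Module.finrank ℝ (LinearMap.range (fderiv ℝ (fderiv ℝ (μ ∘ e.symm)) (e y)).toLinearMap)
      = Module.finrank ℝ (LinearMap.range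
        (hessian (E := EuclideanSpace ℝ (Fin n)) μ y).toLinearMap) := by
  set c := chartAt (EuclideanSpace ℝ (Fin n)) y with hc
  have hca : c ∈ IsManifold.maximalAtlas (𝓡 n) ∞ X := mem_max (chart_mem_atlas _ y)
  have hyc : y ∈ c.source := mem_chart_source _ y
  have hyt := e.map_source hye
  have hey : e.symm (e y) = y := e.left_inv hye
  have hψ : ContDiffAt ℝ ∞ (c ∘ e.symm) (e y) :=
    contDiffAt_transition_max he hca hyt (by rwa [hey])
  have hψy : (c ∘ e.symm) (e y) = c y := congrArg c hey
  have hgt : ContDiffAt ℝ ∞ (μ ∘ c.symm) (c y) :=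
    (contDiffOn_comp_symm_max μ.contMDiff hca).contDiffAt (c.open_target.mem_nhds (c.map_source hyc))
  have hcrit : fderiv ℝ (μ ∘ c.symm) (c y) = 0 :=
    fderiv_eq_zero_of_nonneg (fun z => hnn _) (by simpa [c.left_inv hyc] using hy)
  refine (finrank_range_fderiv_fderiv_comp (g := μ ∘ c.symm) (ψ := c ∘ e.symm) ?_
    (by rwa [hψy]) hψ (by rwa [hψy]) ?_).trans (by rw [hψy]; rfl)
  · filter_upwards [(isOpen_chart_set e c.open_source).mem_nhds ⟨hyt, by rwa [mem_preimage, hey]⟩]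
      with z hz
    simp only [Function.comp_apply]
    rw [c.left_inv hz.2]
  · have h1 : MDifferentiableAt (𝓡 n) (𝓡 n) c (e.symm (e y)) :=
      (contMDiffAt_of_mem_maximalAtlas hca (by rwa [hey])).mdifferentiableAt (by simp)
    have h2 : MDifferentiableAt (𝓡 n) (𝓡 n) e.symm (e y) :=
      (contMDiffAt_symm_of_mem_maximalAtlas he hyt).mdifferentiableAt (by simp)
    have h3 : fderiv ℝ (c ∘ e.symm) (e y)
        = chartDeriv c (e.symm (e y)) ∘L chartSymmDeriv e (e y) := by
      rw [← mfderiv_eq_fderiv]; exact mfderiv_comp (e y) h1 h2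
    rw [h3, hey]
    intro v
    refine ⟨chartDeriv e y (chartSymmDeriv c (c y) v), ?_⟩
    rw [ContinuousLinearMap.comp_apply, chartSymmDeriv_chartDeriv he hye]
    have := chartDeriv_chartSymmDeriv hca (c.map_source hyc) v
    rwa [c.left_inv hyc] at this

/-- **Morse–Bott charts**: near a point of its zero set, a nonnegative Morse–Bott function is the
sum of the squares of the first `m` coordinates in a suitable smooth chart. -/
theorem exists_morseBott_chart (hm : m ≤ n) {Y : Set X} {μ : C^∞⟮𝓡 n, X; 𝓘(ℝ, ℝ), ℝ⟯}
    (hY : IsClosedSubmanifold n Y m) (hμ : IsNonnegMorseBott μ Y m) {y : X} (hy : y ∈ Y) :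
    ∃ e ∈ IsManifold.maximalAtlas (𝓡 n) ∞ X, y ∈ e.source ∧
      ∀ x ∈ e.source, μ x = normSq n m (e x) := by
  obtain ⟨e, he, hye, hsl⟩ := hY.exists_chart y hy
  set z₀ := e y with hz₀
  have hz₀t : z₀ ∈ e.target := e.map_source hye
  obtain ⟨R, hR, hRt⟩ := Metric.isOpen_iff.1 e.open_target z₀ hz₀t
  -- a cut-off makes the expression of `μ` in the chart globally smooth
  let b : ContDiffBump z₀ := ⟨R / 3, R / 2, by linarith, by linarith⟩
  have hbR : ∀ z, z ∉ e.target → b z = 0 := fun z hz => b.zero_of_le_dist (by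
    by_contra hlt
    rw [not_le] at hlt
    exact hz (hRt (by
      have : dist z z₀ < R / 2 := hlt
      rw [Metric.mem_ball]; linarith)))
  let f : EuclideanSpace ℝ (Fin n) → ℝ := fun z => b z * μ (e.symm z)
  have hf : ContDiff ℝ ∞ f := by
    rw [contDiff_iff_contDiffAt]
    intro z
    by_cases hz : z ∈ e.target
    · exact b.contDiff.contDiffAt.mul
        ((contDiffOn_comp_symm_max μ.contMDiff he).contDiffAt (e.open_target.mem_nhds hz))
    · have hzc : z ∈ (Metric.closedBall z₀ (R / 2))ᶜ := fun h => hz (hRt (by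
        rw [Metric.mem_closedBall] at h
        rw [Metric.mem_ball]; linarith))
      refine (contDiffAt_const (c := (0 : ℝ))).congr_of_eventuallyEq ?_
      filter_upwards [Metric.isClosed_closedBall.isOpen_compl.mem_nhds hzc] with w hw
      have : b w = 0 := b.zero_of_le_dist (by
        have : R / 2 < dist w z₀ := by simpa using hw
        exact this.le)
      simp [f, this]
  have hnn : ∀ z, 0 ≤ f z := fun z => mul_nonneg b.nonneg (hμ.nonneg _)
  have h0 : ∀ z, firstProj hm z = 0 → f z = 0 := by
    intro z hz
    by_cases hzt : z ∈ e.target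
    · have : e.symm z ∈ Y := (hsl _ (e.map_target hzt)).2 fun i hi => by
        rw [e.right_inv hzt]
        exact (firstProj_eq_zero_iff hm z).1 hz i hi
      simp [f, (hμ.eq_zero_iff _).2 this]
    · simp [f, hbR z hzt]
  have hpz₀ : firstProj hm z₀ = 0 := (firstProj_eq_zero_iff hm z₀).2 ((hsl y hye).1 hy)
  have hff : f =ᶠ[𝓝 z₀] μ ∘ e.symm := by
    filter_upwards [b.eventuallyEq_one] with z hz
    simp only [f, hz, Pi.one_apply, one_mul, Function.comp_apply]
  have hrank : Module.finrank ℝ (LinearMap.range (fderiv ℝ (fderiv ℝ f) z₀).toLinearMap)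
      = Module.finrank ℝ (EuclideanSpace ℝ (Fin m)) := by
    rw [(hff.fderiv (𝕜 := ℝ)).fderiv_eq, finrank_range_hessian hμ.nonneg
      ((hμ.eq_zero_iff y).2 hy) he hye, hμ.rank_hessian y hy, finrank_euclideanSpace_fin]
  obtain ⟨φ, φ', hφ, hφ', hφf⟩ := exists_morse_coordinates hf (firstProj_firstIncl hm) hnn h0 hpz₀
    hrank
  obtain ⟨Φ, rfl, hΦz, hΦP, hΦs, hΦi⟩ := exists_smooth_openPartialHomeomorph hφ hφ'
    (hff.and hφf)
  refine ⟨e.trans Φ, ?_, ⟨hye, hΦz⟩, ?_⟩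
  · refine (e.trans Φ).mem_maximalAtlas_of_contMDiffOn ?_ ?_
    · intro x hx
      have h1 : ContMDiffAt (𝓡 n) (𝓡 n) ∞ Φ (e x) := (hΦs _ hx.2).contMDiffAt
      exact (h1.comp x (contMDiffAt_of_mem_maximalAtlas he hx.1)).contMDiffWithinAt
    · intro w hw
      have h1 : ContMDiffAt (𝓡 n) (𝓡 n) ∞ Φ.symm w := (hΦi _ hw.1).contMDiffAt
      exact ((contMDiffAt_symm_of_mem_maximalAtlas he hw.2).comp w h1).contMDiffWithinAt
  · rintro x ⟨hx, hxΦ⟩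
    obtain ⟨h1, h2⟩ := hΦP _ hxΦ
    have hl : e.symm (e.symm.symm x) = x := e.left_inv hx
    rw [h1, norm_firstProj_sq, Function.comp_apply, hl] at h2
    exact h2

end MorseChart

/-! ### Criteria for inclusions of complexes to be quasi-isomorphisms -/

section QuasiIsomorphism

open CategoryTheory CategoryTheory.Limits

/-- A termwise monomorphism `φ : K ⟶ L` of cochain complexes is a quasi-isomorphism if, for the
object `T k` of cochains of `L` in degree `k` whose differential lies in `K`, the sum of `K.X k` and
of the coboundaries of `L` covers `T k`. In degree `0`, where `k - 1 = 0` in `ℕ`, the differential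
`L.d (k - 1) k` is zero. -/
lemma quasiIso_of_mono_of_cover {C : Type*} [Category* C] [Abelian C] {K L : CochainComplex C ℕ}
    (φ : K ⟶ L) (hφ : ∀ k, Mono (φ.f k)) (T : ℕ → C) (t : ∀ k, T k ⟶ L.X k)
    (hlift : ∀ (k : ℕ) (A : C) (y : A ⟶ L.X k) (z : A ⟶ K.X (k + 1)),
      y ≫ L.d k (k + 1) = z ≫ φ.f (k + 1) → ∃ y' : A ⟶ T k, y' ≫ t k = y)
    (hT : ∀ k, ∃ (P : C) (p : P ⟶ T k) (a : P ⟶ K.X k) (b : P ⟶ L.X (k - 1)), Epi p ∧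
      p ≫ t k = a ≫ φ.f k + b ≫ L.d (k - 1) k) : QuasiIso φ := by
  have hcover : ∀ (k : ℕ) (A : C) (y : A ⟶ L.X k) (z : A ⟶ K.X (k + 1)),
      y ≫ L.d k (k + 1) = z ≫ φ.f (k + 1) → ∃ (A' : C) (π : A' ⟶ A) (_ : Epi π)
        (a : A' ⟶ K.X k) (b : A' ⟶ L.X (k - 1)), π ≫ y = a ≫ φ.f k + b ≫ L.d (k - 1) k := by
    intro k A y z h
    obtain ⟨y', rfl⟩ := hlift k A y z h
    obtain ⟨P, p, a, b, hp, h'⟩ := hT k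
    refine ⟨pullback y' p, pullback.fst y' p, inferInstance, pullback.snd y' p ≫ a,
      pullback.snd y' p ≫ b, ?_⟩
    rw [← Category.assoc, pullback.condition, Category.assoc, h', Preadditive.comp_add,
      Category.assoc, Category.assoc]
  have hprev : ∀ k, (ComplexShape.up ℕ).prev k = k - 1 := by
    rintro (_ | k)
    · simp
    · simp
  rw [quasiIso_iff]
  intro k
  rw [quasiIsoAt_iff_isIso_homologyMap]
  have hmono : Mono (HomologicalComplex.homologyMap φ k) := by
    rw [HomologicalComplex.mono_homologyMap_iff_up_to_refinements φ (k - 1) k (k + 1) (hprev k)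
      (by simp)]
    intro A x _ y hxy
    rcases k with _ | k
    · have h0 : L.d (0 - 1) 0 = 0 := L.shape _ _ (by simp)
      rw [h0, comp_zero] at hxy
      have hx : x = 0 := by rw [← cancel_mono (φ.f 0), hxy, zero_comp]
      exact ⟨A, 𝟙 A, inferInstance, 0, by simp [hx]⟩
    · obtain ⟨A', π, hπ, a, b, h⟩ := hcover k A y x hxy.symm
      refine ⟨A', π, hπ, a, ?_⟩
      change π ≫ x = a ≫ K.d k (k + 1)
      have hxy' : x ≫ φ.f (k + 1) = y ≫ L.d k (k + 1) := hxy
      rw [← cancel_mono (φ.f (k + 1)), Category.assoc, hxy', ← Category.assoc, h,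
        Preadditive.add_comp, Category.assoc, Category.assoc, L.d_comp_d, comp_zero, add_zero,
        φ.comm, Category.assoc]
  have hepi : Epi (HomologicalComplex.homologyMap φ k) := by
    rw [HomologicalComplex.epi_homologyMap_iff_up_to_refinements φ (k - 1) k (k + 1) (hprev k)
      (by simp)]
    intro A y hy
    obtain ⟨A', π, hπ, a, b, h⟩ := hcover k A y 0 (by rw [hy, zero_comp])
    refine ⟨A', π, hπ, a, ?_, b, h⟩
    have h2 : (a ≫ φ.f k) ≫ L.d k (k + 1) = 0 := by
      rw [← add_sub_cancel_right (a ≫ φ.f k) (b ≫ L.d (k - 1) k), ← h, Preadditive.sub_comp,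
        Category.assoc, hy, Category.assoc, L.d_comp_d, comp_zero, comp_zero, sub_zero]
    rw [← cancel_mono (φ.f (k + 1)), zero_comp, Category.assoc, ← φ.comm, ← Category.assoc, h2]
  exact isIso_of_mono_of_epi _

lemma biprod_desc_comp {C : Type*} [Category* C] [Preadditive C] [HasBinaryBiproducts C]
    {A B T L : C} (a : A ⟶ T) (b : B ⟶ T) (t : T ⟶ L) :
    biprod.desc a b ≫ t = biprod.fst ≫ a ≫ t + biprod.snd ≫ b ≫ t := by
  refine biprod.hom_ext' _ _ ?_ ?_ <;> simp

end QuasiIsomorphism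

section FormComplexes

open CategoryTheory CategoryTheory.Limits TopologicalSpace Opposite

variable {E : Type} [NormedAddCommGroup E] [NormedSpace ℝ E]
  {X : Type u} [TopologicalSpace X] [ChartedSpace E X] {𝕜 : Type} [RCLike 𝕜] {U : Opens X} {k : ℕ}
  [IsManifold 𝓘(ℝ, E) ∞ X]

lemma FormPresheaf.dSec_dSec (K : FormPresheaf E 𝕜 U) {V : Opens X} {α : Sec 𝕜 E U k V}
    (hα : α ∈ K.sec k V) : dSec (dSec α) = 0 :=
  congrArg Subtype.val (K.d_d k V ⟨α, hα⟩)

variable (K L : FormPresheaf E 𝕜 U)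

/-- The forms in `L` whose differential lies in `K`. -/
def FormPresheaf.withDiff (hKL : ∀ k V, K.sec k V ≤ L.sec k V) : FormPresheaf E 𝕜 U where
  sec k V :=
    { carrier := {α | α ∈ L.sec k V ∧ dSec α ∈ K.sec (k + 1) V}
      add_mem' := by
        rintro α β ⟨hα, hα'⟩ ⟨hβ, hβ'⟩
        refine ⟨add_mem hα hβ, ?_⟩
        rw [show dSec (α + β) = dSec α + dSec β from
          congrArg Subtype.val ((L.d k V).map_add ⟨α, hα⟩ ⟨β, hβ⟩)]
        exact add_mem hα' hβ'
      zero_mem' := by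
        refine ⟨zero_mem _, ?_⟩
        rw [show dSec (0 : Sec 𝕜 E U k V) = 0 from congrArg Subtype.val (L.d k V).map_zero]
        exact zero_mem _
      smul_mem' := by
        rintro c α ⟨hα, hα'⟩
        refine ⟨Submodule.smul_mem _ c hα, ?_⟩
        rw [show dSec (c • α) = c • dSec α from
          congrArg Subtype.val ((L.d k V).map_smul c ⟨α, hα⟩)]
        exact Submodule.smul_mem _ c hα' }
  smooth hα := L.smooth hα.1
  restrict_mem {k V W} h {α} hα := ⟨L.restrict_mem h hα.1, by
    rw [dSec_restrict]; exact K.restrict_mem h hα.2⟩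
  d_mem {k V α} hα := ⟨hKL _ _ hα.2, by
    rw [L.dSec_dSec hα.1]; exact zero_mem _⟩

lemma FormPresheaf.complexAt_d (V : Opens X) (k : ℕ) :
    (L.complexAt V).d k (k + 1) = AddCommGrpCat.ofHom (L.d k V).toAddMonoidHom := by
  simp only [complexAt, CochainComplex.of_d]

variable {K L} in
/-- A criterion for the inclusion of complexes of sections over an open set to be a
quasi-isomorphism. -/
theorem FormPresheaf.quasiIso_inclAt (hKL : ∀ k V, K.sec k V ≤ L.sec k V) (V : Opens X)
    (h0 : ∀ α ∈ L.sec 0 V, dSec α ∈ K.sec 1 V → α ∈ K.sec 0 V)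
    (hs : ∀ (k : ℕ), ∀ α ∈ L.sec (k + 1) V, dSec α ∈ K.sec (k + 2) V →
      ∃ κ ∈ K.sec (k + 1) V, ∃ η ∈ L.sec k V, α = κ + dSec η) :
    QuasiIso (FormPresheaf.inclAt (K := K) (L := L) V (fun k => hKL k V)) := by
  let T := K.withDiff L hKL
  have hTL : ∀ k, T.sec k V ≤ L.sec k V := fun k α hα => hα.1
  have hKT : ∀ k, K.sec k V ≤ T.sec k V := fun k α hα => ⟨hKL _ _ hα, K.d_mem hα⟩
  refine quasiIso_of_mono_of_cover _ (fun k => ?_) (fun k => AddCommGrpCat.of (T.sec k V))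
    (fun k => AddCommGrpCat.ofHom (Submodule.inclusion (hTL k)).toAddMonoidHom) ?_ ?_
  · rw [AddCommGrpCat.mono_iff_injective]
    exact Submodule.inclusion_injective (hKL k V)
  · intro k A y z hyz
    rw [L.complexAt_d] at hyz
    have h1 : ∀ a, dSec (y.hom a).1 = (z.hom a).1 := fun a =>
      congrArg Subtype.val (DFunLike.congr_fun (congrArg AddCommGrpCat.Hom.hom hyz) a)
    refine ⟨AddCommGrpCat.ofHom (AddMonoidHom.mk' (fun a => (⟨(y.hom a).1, (y.hom a).2, by
      rw [h1]; exact (z.hom a).2⟩ : T.sec k V)) fun a b => ?_), rfl⟩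
    exact Subtype.ext (show (y.hom (a + b)).1 = (y.hom a).1 + (y.hom b).1 from
      congrArg Subtype.val (y.hom.map_add a b))
  · rintro (_ | k)
    · refine ⟨AddCommGrpCat.of (K.sec 0 V),
        AddCommGrpCat.ofHom (Submodule.inclusion (hKT 0)).toAddMonoidHom, 𝟙 _, 0, ?_, ?_⟩
      · rw [AddCommGrpCat.epi_iff_surjective]
        rintro ⟨α, hα⟩
        exact ⟨⟨α, h0 α hα.1 hα.2⟩, rfl⟩
      · rw [zero_comp, add_zero]
        exact (Category.id_comp ((FormPresheaf.inclAt V fun k => hKL k V).f 0)).symm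
    · let dT : L.sec k V →+ T.sec (k + 1) V := AddMonoidHom.mk'
        (fun η => ⟨dSec η.1, L.d_mem η.2, by rw [L.dSec_dSec η.2]; exact zero_mem _⟩)
        fun η η' => Subtype.ext (show dSec (η + η').1 = dSec η.1 + dSec η'.1 from
          congrArg Subtype.val ((L.d k V).map_add η η'))
      refine ⟨AddCommGrpCat.of (K.sec (k + 1) V × L.sec k V), AddCommGrpCat.ofHom
        (AddMonoidHom.coprod (Submodule.inclusion (hKT (k + 1))).toAddMonoidHom dT),
        AddCommGrpCat.ofHom (AddMonoidHom.fst _ _), AddCommGrpCat.ofHom (AddMonoidHom.snd _ _),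
        ?_, ?_⟩
      · rw [AddCommGrpCat.epi_iff_surjective]
        rintro ⟨α, hα⟩
        obtain ⟨κ, hκ, η, hη, h⟩ := hs k α hα.1 hα.2
        exact ⟨(⟨κ, hκ⟩, ⟨η, hη⟩), Subtype.ext h.symm⟩
      · change _ = _ + _ ≫ (L.complexAt V).d k (k + 1)
        rw [L.complexAt_d]
        rfl

end FormComplexes

section SheafComplexes

open CategoryTheory CategoryTheory.Limits TopologicalSpace Opposite

variable {E : Type} [NormedAddCommGroup E] [NormedSpace ℝ E]
  {X : Type u} [TopologicalSpace X] [ChartedSpace E X] {𝕜 : Type} [RCLike 𝕜] {U : Opens X} {k : ℕ}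
  [IsManifold 𝓘(ℝ, E) ∞ X]

lemma FormSheaf.complex_d (L : FormSheaf E 𝕜 U) (k : ℕ) : L.complex.d k (k + 1) = L.dHom k := by
  simp only [complex, CochainComplex.of_d]

variable {K L : FormSheaf E 𝕜 U}

variable (K L) in
/-- The sheaf of forms in `L` whose differential lies in `K`. -/
def FormSheaf.withDiff (hKL : ∀ k V, K.sec k V ≤ L.sec k V) : FormSheaf E 𝕜 U where
  toFormPresheaf := K.toFormPresheaf.withDiff L.toFormPresheaf hKL
  local_mem {k V α} hα := ⟨L.local_mem fun x hx => by
      obtain ⟨W, h, hxW, hW⟩ := hα x hx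
      exact ⟨W, h, hxW, hW.1⟩, K.local_mem fun x hx => by
      obtain ⟨W, h, hxW, hW⟩ := hα x hx
      exact ⟨W, h, hxW, by rw [← dSec_restrict]; exact hW.2⟩⟩

/-- The inclusion of sheaves of forms of a given degree. -/
def FormSheaf.inclHom {k : ℕ} (h : ∀ V, K.sec k V ≤ L.sec k V) : K.sheaf k ⟶ L.sheaf k :=
  ObjectProperty.homMk
    { app := fun V => AddCommGrpCat.ofHom (Submodule.inclusion (h V.unop)).toAddMonoidHom
      naturality := fun _ _ _ => rfl }

lemma FormSheaf.mono_inclHom {k : ℕ} (h : ∀ V, K.sec k V ≤ L.sec k V) :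
    Mono (FormSheaf.inclHom h) := by
  have : Mono ((sheafToPresheaf _ _).map (FormSheaf.inclHom h)) := by
    have : ∀ V, Mono ((FormSheaf.inclHom h).hom.app V) := fun V => by
      rw [AddCommGrpCat.mono_iff_injective]
      exact Submodule.inclusion_injective (h V.unop)
    exact NatTrans.mono_of_mono_app (FormSheaf.inclHom h).hom
  exact (sheafToPresheaf _ _).mono_of_mono_map this

/-- A criterion for the inclusion of complexes of sheaves to be a quasi-isomorphism. -/
theorem FormSheaf.quasiIso_incl (hKL : ∀ k V, K.sec k V ≤ L.sec k V)
    (h0 : ∀ (V : Opens X), ∀ α ∈ L.sec 0 V, dSec α ∈ K.sec 1 V → α ∈ K.sec 0 V)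
    (hs : ∀ (k : ℕ) (V : Opens X), ∀ α ∈ L.sec (k + 1) V, dSec α ∈ K.sec (k + 2) V →
      ∀ x ∈ V, ∃ (W : Opens X) (h : W ≤ V), x ∈ W ∧
        ∃ κ ∈ K.sec (k + 1) W, ∃ η ∈ L.sec k W, restrict h α = κ + dSec η) :
    QuasiIso (FormSheaf.incl (K := K) (L := L) hKL) := by
  let T := K.withDiff L hKL
  have hTL : ∀ k V, T.sec k V ≤ L.sec k V := fun k V α hα => hα.1
  have hKT : ∀ k V, K.sec k V ≤ T.sec k V := fun k V α hα => ⟨hKL _ _ hα, K.d_mem hα⟩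
  refine quasiIso_of_mono_of_cover _ (fun k => FormSheaf.mono_inclHom (hKL k)) (fun k => T.sheaf k)
    (fun k => FormSheaf.inclHom (hTL k)) ?_ ?_
  · intro k A y z hyz
    rw [L.complex_d] at hyz
    have h1 : ∀ V a, dSec ((y.hom.app V).hom a).1 = ((z.hom.app V).hom a).1 := fun V a =>
      congrArg Subtype.val (DFunLike.congr_fun (congrArg AddCommGrpCat.Hom.hom
        (congrArg (fun f => f.hom.app V) hyz)) a)
    refine ⟨ObjectProperty.homMk
      { app := fun V => AddCommGrpCat.ofHom (AddMonoidHom.mk' (fun a =>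
          (⟨((y.hom.app V).hom a).1, ((y.hom.app V).hom a).2, by
            rw [h1]; exact ((z.hom.app V).hom a).2⟩ : T.sec k V.unop))
          fun a b => Subtype.ext (show ((y.hom.app V).hom (a + b)).1
            = ((y.hom.app V).hom a).1 + ((y.hom.app V).hom b).1 from
              congrArg Subtype.val ((y.hom.app V).hom.map_add a b)))
        naturality := fun V W f => by
          ext a
          exact Subtype.ext (show ((y.hom.app W).hom ((A.obj.map f).hom a)).1
            = restrict f.unop.le ((y.hom.app V).hom a).1 from congrArg Subtype.val
              (DFunLike.congr_fun (congrArg AddCommGrpCat.Hom.hom (y.hom.naturality f)) a)) },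
        rfl⟩
  · rintro (_ | k)
    · refine ⟨K.sheaf 0, FormSheaf.inclHom (hKT 0), 𝟙 _, 0, ?_, ?_⟩
      · rw [← TopCat.Sheaf.isLocallySurjective_iff_epi, TopCat.Presheaf.isLocallySurjective_iff]
        rintro V ⟨α, hα⟩ x hx
        exact ⟨V, le_rfl, ⟨⟨α, h0 V α hα.1 hα.2⟩, rfl⟩, hx⟩
      · rw [zero_comp, add_zero]
        exact (Category.id_comp ((FormSheaf.incl hKL).f 0)).symm
    · let dT : L.sheaf k ⟶ T.sheaf (k + 1) := ObjectProperty.homMk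
        { app := fun V => AddCommGrpCat.ofHom (AddMonoidHom.mk'
            (fun η => (⟨dSec η.1, L.d_mem η.2, by
              rw [L.toFormPresheaf.dSec_dSec η.2]; exact zero_mem _⟩ : T.sec (k + 1) V.unop))
            fun η η' => Subtype.ext (show dSec (η + η').1 = dSec η.1 + dSec η'.1 from
              congrArg Subtype.val ((L.d k V.unop).map_add η η')))
          naturality := fun V W f => by
            ext η
            exact Subtype.ext (dSec_restrict f.unop.le η.1) }
      refine ⟨K.sheaf (k + 1) ⊞ L.sheaf k, biprod.desc (FormSheaf.inclHom (hKT (k + 1))) dT,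
        biprod.fst, biprod.snd, ?_, ?_⟩
      · rw [← TopCat.Sheaf.isLocallySurjective_iff_epi, TopCat.Presheaf.isLocallySurjective_iff]
        rintro V ⟨α, hα⟩ x hx
        obtain ⟨W, h, hxW, κ, hκ, η, hη, hsum⟩ := hs k V α hα.1 hα.2 x hx
        refine ⟨W, h, ⟨((biprod.inl : K.sheaf (k + 1) ⟶ K.sheaf (k + 1) ⊞ L.sheaf k).hom.app
          (op W)).hom ⟨κ, hκ⟩ + ((biprod.inr : L.sheaf k ⟶ K.sheaf (k + 1) ⊞ L.sheaf k).hom.app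
          (op W)).hom ⟨η, hη⟩, ?_⟩, hxW⟩
        have h1 : ∀ s, ((biprod.desc (FormSheaf.inclHom (hKT (k + 1))) dT).hom.app (op W)).hom
            (((biprod.inl : K.sheaf (k + 1) ⟶ K.sheaf (k + 1) ⊞ L.sheaf k).hom.app (op W)).hom s)
            = ((FormSheaf.inclHom (hKT (k + 1))).hom.app (op W)).hom s := fun s =>
          DFunLike.congr_fun (congrArg AddCommGrpCat.Hom.hom (congrArg (fun f => f.hom.app (op W))
            (biprod.inl_desc (FormSheaf.inclHom (hKT (k + 1))) dT))) s
        have h2 : ∀ s, ((biprod.desc (FormSheaf.inclHom (hKT (k + 1))) dT).hom.app (op W)).hom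
            (((biprod.inr : L.sheaf k ⟶ K.sheaf (k + 1) ⊞ L.sheaf k).hom.app (op W)).hom s)
            = (dT.hom.app (op W)).hom s := fun s =>
          DFunLike.congr_fun (congrArg AddCommGrpCat.Hom.hom (congrArg (fun f => f.hom.app (op W))
            (biprod.inr_desc (FormSheaf.inclHom (hKT (k + 1))) dT))) s
        refine (map_add ((biprod.desc (FormSheaf.inclHom (hKT (k + 1))) dT).hom.app
          (op W)).hom _ _).trans ?_
        exact (congrArg₂ (· + ·) (h1 ⟨κ, hκ⟩) (h2 ⟨η, hη⟩)).trans (Subtype.ext hsum.symm)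
      · change _ = _ + _ ≫ L.complex.d k (k + 1)
        rw [L.complex_d]
        exact biprod_desc_comp _ dT (FormSheaf.inclHom (hTL (k + 1)))

end SheafComplexes

/-! ### Forms with tame singularities -/

section TameOn

variable {E : Type} [NormedAddCommGroup E] [NormedSpace ℝ E]
  {X : Type*} [TopologicalSpace X] [ChartedSpace E X] {𝕜 : Type} [RCLike 𝕜] {k : ℕ}

/-- The form `α` has tame singularities of order `p` on `W`: the forms `μ ^ p α` and
`μ ^ (p - 1) dμ ∧ α` extend smoothly to `W`. -/
def TameOn (μ : X → ℝ) (p : ℤ) (α : X → E [⋀^Fin k]→L[ℝ] 𝕜) (W : Set X) : Prop :=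
  Extends μ (fun z => μ z ^ p • α z) W ∧ Extends μ (fun z => μ z ^ (p - 1) • dWedge μ α z) W

lemma TameOn.congr {μ : X → ℝ} {p : ℤ} {α β : X → E [⋀^Fin k]→L[ℝ] 𝕜} {W : Set X}
    (hα : TameOn μ p α W) (h : ∀ z ∈ W, μ z ≠ 0 → β z = α z) : TameOn μ p β W :=
  ⟨hα.1.congr fun z hz h0 => by rw [h z hz h0],
    hα.2.congr fun z hz h0 => by simp only [dWedge, h z hz h0]⟩

lemma TameOn.mono {μ : X → ℝ} {p : ℤ} {α : X → E [⋀^Fin k]→L[ℝ] 𝕜} {V W : Set X}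
    (hα : TameOn μ p α W) (h : V ⊆ W) : TameOn μ p α V := ⟨hα.1.mono h, hα.2.mono h⟩

variable [IsManifold 𝓘(ℝ, E) ∞ X] {μ : C^∞⟮𝓘(ℝ, E), X; 𝓘(ℝ, ℝ), ℝ⟯}

lemma SmoothOn.zpow_smul {S : Set X} {α : X → E [⋀^Fin k]→L[ℝ] 𝕜} (hα : SmoothOn α S)
    (h0 : ∀ z ∈ S, μ z ≠ 0) (p : ℤ) : SmoothOn (fun z => μ z ^ p • α z) S := by
  intro e he
  have hμ : ContDiffOn ℝ ∞ (μ ∘ e.symm) (e.target ∩ e.symm ⁻¹' S) :=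
    (contDiffOn_comp_symm μ.contMDiff he).mono inter_subset_left
  have hp : ContDiffOn ℝ ∞ (fun y => μ (e.symm y) ^ p) (e.target ∩ e.symm ⁻¹' S) := by
    rcases p with N | N
    · simpa using hμ.pow N
    · have := (hμ.pow (N + 1)).inv fun y hy => pow_ne_zero _ (h0 _ hy.2)
      exact this.congr fun y _ => zpow_negSucc _ _
  refine (hp.smul (hα e he)).congr fun y hy => ?_
  ext v
  simp [chartRep]

/-- If near every point either `μ` does not vanish or `μ` vanishes identically, then the extension
condition is void. -/
lemma Extends.of_dichotomy {W : Set X} (hW : ∀ x ∈ W, μ x ≠ 0 ∨ ∀ᶠ z in 𝓝 x, μ z = 0)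
    {β : X → E [⋀^Fin k]→L[ℝ] 𝕜} (hβ : SmoothOn β (W ∩ nonzeroLocus μ)) : Extends μ β W := by
  classical
  refine ⟨fun z => if μ z = 0 then 0 else β z, ?_, fun z _ h0 => if_neg h0⟩
  have h1 : SmoothOn (fun z => if μ z = 0 then 0 else β z) (W ∩ nonzeroLocus μ) :=
    hβ.congr fun z hz => if_neg hz.2
  intro e he y hy
  rcases hW _ hy.2 with h | h
  · have hN := (isOpen_chart_set e (nonzeroLocus μ).isOpen).mem_nhds ⟨hy.1, h⟩
    refine ((h1 e he) y ⟨hy.1, hy.2, h⟩).mono_of_mem_nhdsWithin ?_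
    filter_upwards [self_mem_nhdsWithin, mem_nhdsWithin_of_mem_nhds hN] with w hw hw'
      using ⟨hw.1, hw.2, hw'.2⟩
  · obtain ⟨O, hO, hOo, hyO⟩ := eventually_nhds_iff.1 h
    refine ContDiffAt.contDiffWithinAt ?_
    refine (contDiffAt_const (c := 0)).congr_of_eventuallyEq ?_
    filter_upwards [(isOpen_chart_set e hOo).mem_nhds ⟨hy.1, hyO⟩] with w hw
    ext v
    simp [chartRep, hO _ hw.2]

lemma TameOn.of_dichotomy {W : Set X} (hW : ∀ x ∈ W, μ x ≠ 0 ∨ ∀ᶠ z in 𝓝 x, μ z = 0)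
    {α : X → E [⋀^Fin k]→L[ℝ] 𝕜} (hα : SmoothOn α (W ∩ nonzeroLocus μ)) (p : ℤ) :
    TameOn μ p α W :=
  ⟨Extends.of_dichotomy hW (hα.zpow_smul (fun _ hz => hz.2) p),
    Extends.of_dichotomy hW ((hα.dWedge μ.contMDiff).zpow_smul (fun _ hz => hz.2) (p - 1))⟩

lemma dWedge_pow_succ (s : ℕ) (α : X → E [⋀^Fin k]→L[ℝ] 𝕜) {z : X} (h0 : μ z ≠ 0) :
    dWedge (fun z => μ z ^ (s + 1)) α z = (((s : ℝ) + 1) * μ z ^ s) • dWedge μ α z := by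
  have h1 : dFun (E := E) (fun z => μ z ^ (s + 1)) z
      = (((s : ℝ) + 1) * μ z ^ s) • dFun (E := E) μ z := by
    have := dFun_pow (E := E) μ.contMDiff (s + 1) z
    refine smul_right_injective _ h0 ?_
    refine this.trans ?_
    simp only [smul_smul]
    push_cast
    ring_nf
  simp only [dWedge]
  rw [h1, ← ContinuousAlternatingMap.alternatizeUncurryFin_smul]
  congr 1
  ext v w
  simp [mul_smul]

/-- The formula `d(μ ^ (s + 1) α) = μ ^ (s + 1) dα + (s + 1) μ ^ s dμ ∧ α` for a smooth extension
of `μ ^ (s + 1) α`. -/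
lemma extD_extension {W : Set X} (hW : IsOpen W) {α ζ : X → E [⋀^Fin k]→L[ℝ] 𝕜}
    (hα : SmoothOn α (W ∩ nonzeroLocus μ)) {s : ℕ}
    (h : ∀ z ∈ W, μ z ≠ 0 → ζ z = μ z ^ (s + 1) • α z) {z : X} (hz : z ∈ W) (h0 : μ z ≠ 0) :
    extD ζ z = μ z ^ (s + 1) • extD α z + (((s : ℝ) + 1) * μ z ^ s) • dWedge μ α z := by
  have hO : IsOpen (W ∩ (nonzeroLocus μ : Set X)) := hW.inter (nonzeroLocus μ).isOpen
  have hμN : ContMDiff 𝓘(ℝ, E) 𝓘(ℝ, ℝ) ∞ (fun z => μ z ^ (s + 1)) := μ.contMDiff.pow _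
  rw [← dWedge_pow_succ s α h0, ← extD_smul_fun hμN hO hα ⟨hz, h0⟩]
  exact extD_congr hO (fun w hw => h w hw.1 hw.2) ⟨hz, h0⟩

/-- For positive orders, a form is tame if and only if the form and its differential have poles of
bounded order. -/
lemma tameOn_iff {r : ℕ} (hr : 1 ≤ r) {W : Set X} (hW : IsOpen W)
    {α : X → E [⋀^Fin k]→L[ℝ] 𝕜} (hα : SmoothOn α (W ∩ nonzeroLocus μ)) :
    TameOn μ r α W ↔ Extends μ (fun z => μ z ^ r • α z) W ∧
      Extends μ (fun z => μ z ^ r • extD α z) W := by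
  obtain ⟨s, rfl⟩ : ∃ s, r = s + 1 := ⟨r - 1, by omega⟩
  simp only [TameOn, zpow_natCast, Nat.cast_add, Nat.cast_one, add_sub_cancel_right]
  have hcast : ∀ z, μ z ^ ((s : ℤ) + 1) = μ z ^ (s + 1) := fun z => by
    rw [← zpow_natCast]; norm_cast
  simp only [hcast]
  have hs : (s : ℝ) + 1 ≠ 0 := by positivity
  refine and_congr_right ?_
  rintro ⟨ζ, hζ, h⟩
  constructor
  · rintro ⟨ξ, hξ, h'⟩
    refine ⟨extD ζ + fun z => (-((s : ℝ) + 1)) • ξ z,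
      (hζ.extD hW).add (hξ.smul_fun (f := fun _ => -((s : ℝ) + 1)) contMDiff_const),
      fun z hz h0 => ?_⟩
    rw [Pi.add_apply, extD_extension hW hα h hz h0, h' z hz h0]
    module
  · rintro ⟨ξ, hξ, h'⟩
    refine ⟨fun z => ((s : ℝ) + 1)⁻¹ • (extD ζ + fun z => (-1 : ℝ) • ξ z) z,
      SmoothOn.smul_fun (f := fun _ => ((s : ℝ) + 1)⁻¹) contMDiff_const
        ((hζ.extD hW).add (hξ.smul_fun (f := fun _ => (-1 : ℝ)) contMDiff_const)),
      fun z hz h0 => ?_⟩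
    change ((s : ℝ) + 1)⁻¹ • (extD ζ z + (-1 : ℝ) • ξ z) = μ z ^ s • dWedge μ α z
    rw [extD_extension hW hα h hz h0, h' z hz h0]
    match_scalars
    · ring
    · field_simp

lemma sub_eq_add_neg_one_smul (α β : X → E [⋀^Fin k]→L[ℝ] 𝕜) : α - β = α + (-1 : 𝕜) • β := by
  ext x v
  simp [sub_eq_add_neg]

lemma SmoothOn.sub {α β : X → E [⋀^Fin k]→L[ℝ] 𝕜} {S : Set X} (hα : SmoothOn α S)
    (hβ : SmoothOn β S) : SmoothOn (α - β) S := by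
  rw [sub_eq_add_neg_one_smul]
  exact hα.add (hβ.smul _)

lemma extD_sub_extD {S : Set X} (hS : IsOpen S) {α : X → E [⋀^Fin (k + 1)]→L[ℝ] 𝕜}
    {η : X → E [⋀^Fin k]→L[ℝ] 𝕜} (hα : SmoothOn α S) (hη : SmoothOn η S) {x : X} (hx : x ∈ S) :
    extD (α - extD η) x = extD α x := by
  rw [sub_eq_add_neg_one_smul, extD_add hS hα ((hη.extD hS).smul _) hx,
    extD_smul hS (hη.extD hS) _ hx, extD_extD hS hη hx]
  ext v
  simp

/-- Tame forms are preserved by the de Rham differential. -/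
lemma TameOn.extD {r : ℕ} {W : Set X} (hW : IsOpen W)
    (hr : 1 ≤ r ∨ ∀ x ∈ W, μ x ≠ 0 ∨ ∀ᶠ z in 𝓝 x, μ z = 0)
    {α : X → E [⋀^Fin k]→L[ℝ] 𝕜} (hα : SmoothOn α (W ∩ nonzeroLocus μ)) (h : TameOn μ r α W) :
    TameOn μ r (extD α) W := by
  have hO : IsOpen (W ∩ (nonzeroLocus μ : Set X)) := hW.inter (nonzeroLocus μ).isOpen
  rcases hr with hr | hr
  · rw [tameOn_iff hr hW (hα.extD hO)]
    refine ⟨((tameOn_iff hr hW hα).1 h).2, (Extends.zero μ W).congr fun z hz h0 => ?_⟩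
    rw [extD_extD hO hα ⟨hz, h0⟩]
    ext v
    simp
  · exact TameOn.of_dichotomy hr (hα.extD hO) r

end TameOn

section LocalTameReduction

variable {n : ℕ} {X : Type*} [TopologicalSpace X] [ChartedSpace (EuclideanSpace ℝ (Fin n)) X]
  [IsManifold (𝓡 n) ∞ X] {𝕜 : Type} [RCLike 𝕜] {r : ℕ} {μ : C^∞⟮𝓡 n, X; 𝓘(ℝ, ℝ), ℝ⟯}

/-- The sets on which forms with tame singularities are compared with all forms with poles: either
the pole condition is void, or there is a Morse–Bott chart. -/
def IsAdapted (r : ℕ) (μ : C^∞⟮𝓡 n, X; 𝓘(ℝ, ℝ), ℝ⟯) (W : Set X) : Prop :=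
  (∀ x ∈ W, μ x ≠ 0 ∨ ∀ᶠ z in 𝓝 x, μ z = 0) ∨
    (1 ≤ r ∧ ∃ e ∈ IsManifold.maximalAtlas (𝓡 n) ∞ X, W ⊆ e.source ∧
      ∀ x ∈ e.source, μ x = normSq n (2 * r) (e x))

lemma IsAdapted.mono {V W : Set X} (hW : IsAdapted r μ W) (h : V ⊆ W) : IsAdapted r μ V := by
  rcases hW with hW | ⟨hr, e, he, hWe, hμ⟩
  · exact Or.inl fun x hx => hW x (h hx)
  · exact Or.inr ⟨hr, e, he, h.trans hWe, hμ⟩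

/-- A function with a tame differential is tame. -/
theorem tameOn_of_extD_zero (hn : 2 * r ≤ n) {W : Set X} (hW : IsOpen W) (hWa : IsAdapted r μ W)
    {α : X → EuclideanSpace ℝ (Fin n) [⋀^Fin 0]→L[ℝ] 𝕜} (hα : SmoothOn α (W ∩ nonzeroLocus μ))
    {N : ℕ} (hN : Extends μ (fun x => μ x ^ N • α x) W) (hd : TameOn μ r (extD α) W) :
    TameOn μ r α W := by
  rcases hWa with hWa | ⟨hr, e, he, hWe, hμ⟩
  · exact TameOn.of_dichotomy hWa hα r
  · have hd' : Extends μ (fun x => μ x ^ r • extD α x) W := by simpa using hd.1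
    exact (tameOn_iff hr hW hα).2
      ⟨local_reduction_zero hn hr le_rfl he hμ hW hWe hα hN hd', hd'⟩

/-- A form with poles and with a tame differential is tame up to a coboundary. -/
theorem exists_tameOn_sub_extD (hn : 2 * r ≤ n) {W : Set X} (hW : IsOpen W)
    (hWa : IsAdapted r μ W) {k : ℕ} {α : X → EuclideanSpace ℝ (Fin n) [⋀^Fin (k + 1)]→L[ℝ] 𝕜}
    (hα : SmoothOn α (W ∩ nonzeroLocus μ))
    {N : ℕ} (hN : Extends μ (fun x => μ x ^ N • α x) W) (hd : TameOn μ r (extD α) W) :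
    ∃ η : X → EuclideanSpace ℝ (Fin n) [⋀^Fin k]→L[ℝ] 𝕜, SmoothOn η (W ∩ nonzeroLocus μ) ∧
      (∃ M : ℕ, Extends μ (fun x => μ x ^ M • η x) W) ∧ TameOn μ r (α - extD η) W := by
  have hO : IsOpen (W ∩ (nonzeroLocus μ : Set X)) := hW.inter (nonzeroLocus μ).isOpen
  have hsub : ∀ η : X → EuclideanSpace ℝ (Fin n) [⋀^Fin k]→L[ℝ] 𝕜,
      SmoothOn η (W ∩ nonzeroLocus μ) → SmoothOn (α - extD η) (W ∩ nonzeroLocus μ) :=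
    fun η hη => hα.sub (hη.extD hO)
  rcases hWa with hWa | ⟨hr, e, he, hWe, hμ⟩
  · refine ⟨0, SmoothOn.zero _, ⟨0, ?_⟩, TameOn.of_dichotomy hWa (hsub 0 (SmoothOn.zero _)) r⟩
    rw [fun_smul_zero]
    exact Extends.zero _ _
  · have hd' : Extends μ (fun x => μ x ^ r • extD α x) W := by simpa using hd.1
    obtain ⟨η, hη, hM, h⟩ := local_reduction_succ hn hr le_rfl he hμ hW hWe hα hN hd'
    refine ⟨η, hη, hM, (tameOn_iff hr hW (hsub η hη)).2 ⟨h, hd'.congr fun z hz h0 => ?_⟩⟩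
    rw [extD_sub_extD hO hα hη ⟨hz, h0⟩]

end LocalTameReduction

section Sections

open TopologicalSpace

variable {E : Type} [NormedAddCommGroup E] [NormedSpace ℝ E]
  {X : Type u} [TopologicalSpace X] [ChartedSpace E X]
  {𝕜 : Type} [RCLike 𝕜] {k : ℕ}

/-- The section over `V` given by a form on `X`. -/
def toSec (U V : Opens X) (η : X → E [⋀^Fin k]→L[ℝ] 𝕜) : Sec 𝕜 E U k V := fun x => η x

lemma extZero_toSec {U V : Opens X} (η : X → E [⋀^Fin k]→L[ℝ] 𝕜) {x : X} (hx : x ∈ V ⊓ U) :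
    extZero (toSec U V η) x = η x := extZero_apply _ hx

variable [IsManifold 𝓘(ℝ, E) ∞ X] {μ : C^∞⟮𝓘(ℝ, E), X; 𝓘(ℝ, ℝ), ℝ⟯}

lemma mem_tamePresheafSec {p : ℤ} {V : Opens X} {α : Sec 𝕜 E (nonzeroLocus μ) k V} :
    α ∈ tamePresheafSec 𝕜 μ p k V ↔
      α ∈ (polarPresheaf 𝕜 μ).sec k V ∧ TameOn μ p (extZero α) V := Iff.rfl

/-- The two extension conditions in the definition of `F_p 𝒜_{X,μ}` can be required on a common
neighbourhood. -/
lemma mem_tameSheafSec {p : ℤ} {V : Opens X} {α : Sec 𝕜 E (nonzeroLocus μ) k V} :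
    α ∈ tameSheafSec 𝕜 μ p k V ↔ α ∈ (polarSheaf 𝕜 μ).sec k V ∧
      ∀ x ∈ V, ∃ W : Opens X, x ∈ W ∧ W ≤ V ∧ TameOn μ p (extZero α) W := by
  refine and_congr_right fun _ => forall₂_congr fun x hx => ?_
  constructor
  · rintro ⟨⟨W, hW, hxW, h⟩, W', hW', hxW', h'⟩
    exact ⟨⟨W ∩ W' ∩ V, (hW.inter hW').inter V.isOpen⟩, ⟨⟨hxW, hxW'⟩, hx⟩, fun _ hz => hz.2,
      h.mono fun _ hz => hz.1.1, h'.mono fun _ hz => hz.1.2⟩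
  · rintro ⟨W, hxW, -, h⟩
    exact ⟨⟨W, W.isOpen, hxW, h.1⟩, W, W.isOpen, hxW, h.2⟩

/-- The de Rham differential preserves `F_r 𝒜_{X,μ}`. -/
lemma dSec_mem_tameSheafSec {r : ℕ} (hr : 1 ≤ r ∨ ∀ x, μ x ≠ 0 ∨ ∀ᶠ z in 𝓝 x, μ z = 0)
    {V : Opens X} {α : Sec 𝕜 E (nonzeroLocus μ) k V} (hα : α ∈ tameSheafSec 𝕜 μ r k V) :
    dSec α ∈ tameSheafSec 𝕜 μ r (k + 1) V := by
  rw [mem_tameSheafSec] at hα ⊢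
  refine ⟨(polarSheaf 𝕜 μ).d_mem hα.1, fun x hx => ?_⟩
  obtain ⟨W, hxW, hWV, h⟩ := hα.2 x hx
  have hs : SmoothOn (extZero α) (W ∩ nonzeroLocus μ) :=
    hα.1.1.mono fun z hz => ⟨hWV hz.1, hz.2⟩
  exact ⟨W, hxW, hWV, (h.extD W.isOpen (hr.imp_right fun h x _ => h x) hs).congr
    fun z hz h0 => extZero_dSec α ⟨hWV hz, h0⟩⟩

/-- The de Rham differential preserves `F_r 𝒜_μ(V)`. -/
lemma dSec_mem_tamePresheafSec {r : ℕ} (hr : 1 ≤ r ∨ ∀ x, μ x ≠ 0 ∨ ∀ᶠ z in 𝓝 x, μ z = 0)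
    {V : Opens X} {α : Sec 𝕜 E (nonzeroLocus μ) k V} (hα : α ∈ tamePresheafSec 𝕜 μ r k V) :
    dSec α ∈ tamePresheafSec 𝕜 μ r (k + 1) V := by
  rw [mem_tamePresheafSec] at hα ⊢
  exact ⟨(polarPresheaf 𝕜 μ).d_mem hα.1,
    (hα.2.extD V.isOpen (hr.imp_right fun h x _ => h x) hα.1.1).congr
      fun z hz h0 => extZero_dSec α ⟨hz, h0⟩⟩

end Sections

/-! ### Comparison of the complexes -/

section QuasiIso

open TopologicalSpace

variable {n r : ℕ} {X : Type u} [TopologicalSpace X] [ChartedSpace (EuclideanSpace ℝ (Fin n)) X]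
  [IsManifold (𝓡 n) ∞ X] {𝕜 : Type} [RCLike 𝕜] {μ : C^∞⟮𝓡 n, X; 𝓘(ℝ, ℝ), ℝ⟯} {k : ℕ}

lemma extZero_sub_dSec_toSec {V : Opens X}
    {α : Sec 𝕜 (EuclideanSpace ℝ (Fin n)) (nonzeroLocus μ) (k + 1) V}
    {η : X → EuclideanSpace ℝ (Fin n) [⋀^Fin k]→L[ℝ] 𝕜} {z : X} (hz : z ∈ V ⊓ nonzeroLocus μ) :
    extZero (α - dSec (toSec (nonzeroLocus μ) V η)) z = (extZero α - extD η) z := by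
  rw [extZero_apply _ hz, Pi.sub_apply, Pi.sub_apply, extZero_apply _ hz]
  congr 1
  exact extD_congr (V ⊓ nonzeroLocus μ).isOpen (fun w hw => extZero_toSec η hw) hz

/-- Over an adapted open set, forms with tame singularities and all forms with poles along `Y` have
the same cohomology. -/
theorem quasiIso_inclAt_tame (hn : 2 * r ≤ n)
    (hd : ∀ (k : ℕ) (V : Opens X), ∀ α ∈ tamePresheafSec 𝕜 μ r k V,
      dSec α ∈ tamePresheafSec 𝕜 μ r (k + 1) V) {V : Opens X} (hV : IsAdapted r μ (V : Set X)) :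
    QuasiIso (FormPresheaf.inclAt (K := tamePresheaf 𝕜 μ r hd) (L := polarPresheaf 𝕜 μ) V
      (fun _ _ hα => hα.1)) := by
  refine FormPresheaf.quasiIso_inclAt (K := tamePresheaf 𝕜 μ r hd) (L := polarPresheaf 𝕜 μ)
    (fun k V α hα => hα.1) V ?_ ?_
  · rintro α ⟨hα, N, hN⟩ hd
    refine mem_tamePresheafSec.2 ⟨⟨hα, N, hN⟩, tameOn_of_extD_zero hn V.isOpen hV hα hN ?_⟩
    exact (mem_tamePresheafSec.1 hd).2.congr fun z hz h0 => (extZero_dSec α ⟨hz, h0⟩).symm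
  · rintro k α ⟨hα, N, hN⟩ hd
    obtain ⟨η, hη, ⟨M, hM⟩, h⟩ := exists_tameOn_sub_extD hn V.isOpen hV hα hN
      ((mem_tamePresheafSec.1 hd).2.congr fun z hz h0 => (extZero_dSec α ⟨hz, h0⟩).symm)
    have hηmem : toSec (nonzeroLocus μ) V η ∈ (polarPresheaf 𝕜 μ).sec k V :=
      ⟨hη.congr fun z hz => extZero_toSec η hz, M,
        hM.congr fun z hz h0 => by rw [extZero_toSec η ⟨hz, h0⟩]⟩
    refine ⟨α - dSec (toSec (nonzeroLocus μ) V η), mem_tamePresheafSec.2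
      ⟨sub_mem ⟨hα, N, hN⟩ ((polarPresheaf 𝕜 μ).d_mem hηmem), h.congr fun z hz h0 => ?_⟩,
      toSec (nonzeroLocus μ) V η, hηmem, (sub_add_cancel _ _).symm⟩
    exact extZero_sub_dSec_toSec ⟨hz, h0⟩

/-- If every point has an adapted neighbourhood, then the sheaf complexes of forms with tame
singularities and of all forms with poles along `Y` are quasi-isomorphic. -/
theorem quasiIso_incl_tame (hn : 2 * r ≤ n)
    (hd : ∀ (k : ℕ) (V : Opens X), ∀ α ∈ tameSheafSec 𝕜 μ r k V,
      dSec α ∈ tameSheafSec 𝕜 μ r (k + 1) V)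
    (hX : ∀ x : X, ∃ W : Opens X, x ∈ W ∧ IsAdapted r μ (W : Set X)) :
    QuasiIso (FormSheaf.incl (K := tameSheaf 𝕜 μ r hd) (L := polarSheaf 𝕜 μ)
      (fun _ _ _ hα => hα.1)) := by
  -- a neighbourhood that is adapted and on which all extension conditions hold at once
  have key : ∀ {k : ℕ} {V : Opens X}
      {α : Sec 𝕜 (EuclideanSpace ℝ (Fin n)) (nonzeroLocus μ) k V},
      α ∈ (polarSheaf 𝕜 μ).sec k V → dSec α ∈ tameSheafSec 𝕜 μ r (k + 1) V → ∀ x ∈ V,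
      ∃ W : Opens X, x ∈ W ∧ W ≤ V ∧ IsAdapted r μ (W : Set X) ∧
        SmoothOn (extZero α) (W ∩ nonzeroLocus μ) ∧
        (∃ N : ℕ, Extends μ (fun z => μ z ^ N • extZero α z) W) ∧
        TameOn μ r (extD (extZero α)) W := by
    intro k V α hα hdα x hx
    obtain ⟨W₁, hxW₁, hW₁⟩ := hX x
    obtain ⟨N, W₂, hW₂, hxW₂, hN⟩ := hα.2 x hx
    obtain ⟨W₃, hxW₃, hW₃V, hW₃⟩ := (mem_tameSheafSec.1 hdα).2 x hx
    refine ⟨W₁ ⊓ ⟨W₂, hW₂⟩ ⊓ W₃, ⟨⟨hxW₁, hxW₂⟩, hxW₃⟩, fun z hz => hW₃V hz.2,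
      hW₁.mono fun z hz => hz.1.1, hα.1.mono fun z hz => ⟨hW₃V hz.1.2, hz.2⟩,
      ⟨N, hN.mono fun z hz => hz.1.2⟩,
      (hW₃.mono fun z hz => hz.2).congr fun z hz h0 => ?_⟩
    exact (extZero_dSec α ⟨hW₃V hz.2, h0⟩).symm
  refine FormSheaf.quasiIso_incl (K := tameSheaf 𝕜 μ r hd) (L := polarSheaf 𝕜 μ)
    (fun k V α hα => hα.1) ?_ ?_
  · intro V α hα hdα
    refine mem_tameSheafSec.2 ⟨hα, fun x hx => ?_⟩
    obtain ⟨W, hxW, hWV, hWa, hs, ⟨N, hN⟩, h⟩ := key hα hdα x hx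
    exact ⟨W, hxW, hWV, tameOn_of_extD_zero hn W.isOpen hWa hs hN h⟩
  · intro k V α hα hdα x hx
    obtain ⟨W, hxW, hWV, hWa, hs, ⟨N, hN⟩, h⟩ := key hα hdα x hx
    obtain ⟨η, hη, ⟨M, hM⟩, h⟩ := exists_tameOn_sub_extD hn W.isOpen hWa hs hN h
    have hηmem : toSec (nonzeroLocus μ) W η ∈ (polarSheaf 𝕜 μ).sec k W :=
      ⟨hη.congr fun z hz => extZero_toSec η hz, fun x hx => ⟨M, W, W.isOpen, hx,
        hM.congr fun z hz h0 => by rw [extZero_toSec η ⟨hz, h0⟩]⟩⟩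
    refine ⟨W, hWV, hxW, restrict hWV α - dSec (toSec (nonzeroLocus μ) W η), mem_tameSheafSec.2
      ⟨sub_mem ((polarSheaf 𝕜 μ).restrict_mem hWV hα) ((polarSheaf 𝕜 μ).d_mem hηmem),
        fun x hx => ⟨W, hx, le_rfl, h.congr fun z hz h0 => ?_⟩⟩,
      toSec (nonzeroLocus μ) W η, hηmem, (sub_add_cancel _ _).symm⟩
    rw [extZero_sub_dSec_toSec ⟨hz, h0⟩, Pi.sub_apply, Pi.sub_apply, extZero_restrict hWV α hz]

/-- Near every point, either the pole condition is void or there is a Morse–Bott chart. -/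
lemma exists_isAdapted (hn : 2 * r ≤ n) {Y : Set X} (hY : IsClosedSubmanifold n Y (2 * r))
    (hμ : IsNonnegMorseBott μ Y (2 * r)) (x : X) :
    ∃ W : Opens X, x ∈ W ∧ IsAdapted r μ (W : Set X) := by
  by_cases hx : μ x = 0
  · have hxY : x ∈ Y := (hμ.eq_zero_iff x).1 hx
    rcases Nat.eq_zero_or_pos r with rfl | hr
    · obtain ⟨e, -, hxe, h⟩ := hY.exists_chart x hxY
      refine ⟨⟨e.source, e.open_source⟩, hxe, Or.inl fun z hz => Or.inr ?_⟩
      filter_upwards [e.open_source.mem_nhds hz] with w hw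
      exact (hμ.eq_zero_iff w).2 ((h w hw).2 fun i hi => absurd hi (by simp))
    · obtain ⟨e, he, hxe, h⟩ := exists_morseBott_chart hn hY hμ hxY
      exact ⟨⟨e.source, e.open_source⟩, hxe, Or.inr ⟨hr, e, he, subset_rfl, h⟩⟩
  · exact ⟨nonzeroLocus μ, hx, Or.inl fun z hz => Or.inl hz⟩

/-- For `r = 0` the pole condition is void everywhere. -/
lemma dichotomy_of_exists_isAdapted_zero
    (hX : ∀ x : X, ∃ W : Opens X, x ∈ W ∧ IsAdapted 0 μ (W : Set X)) (x : X) :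
    μ x ≠ 0 ∨ ∀ᶠ z in 𝓝 x, μ z = 0 := by
  obtain ⟨W, hxW, h | ⟨h, -⟩⟩ := hX x
  · exact h x hxW
  · omega

end QuasiIso

end TameForms

end

theorem mainTheorem4 (𝕜 : Type) [RCLike 𝕜] (n r : ℕ) (hr : 2 * r ≤ n) :
    (∀ (X : Type u) [TopologicalSpace X] [ChartedSpace (EuclideanSpace ℝ (Fin n)) X]
      [IsManifold (𝓡 n) ∞ X] (Y : Set X) (μ : C^∞⟮𝓡 n, X; 𝓘(ℝ, ℝ), ℝ⟯),
      IsClosedSubmanifold n Y (2 * r) → IsNonnegMorseBott μ Y (2 * r) →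
      ∃ hd : ∀ (k : ℕ) (V : TopologicalSpace.Opens X), ∀ α ∈ tameSheafSec 𝕜 μ r k V,
          dSec α ∈ tameSheafSec 𝕜 μ r (k + 1) V,
        QuasiIso (FormSheaf.incl (K := tameSheaf 𝕜 μ r hd) (L := polarSheaf 𝕜 μ)
          (fun _ _ _ hα => hα.1))) ∧
    (∀ R : ℝ, 0 < R →
      ∃ hd : ∀ (k : ℕ) (V : TopologicalSpace.Opens (EuclideanSpace ℝ (Fin n))),
          ∀ α ∈ tamePresheafSec 𝕜 (normSq n (2 * r)) r k V,
            dSec α ∈ tamePresheafSec 𝕜 (normSq n (2 * r)) r (k + 1) V,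
        QuasiIso (FormPresheaf.inclAt (K := tamePresheaf 𝕜 (normSq n (2 * r)) r hd)
          (L := polarPresheaf 𝕜 (normSq n (2 * r))) (openBall n R)
          (fun _ _ hα => hα.1))) := by
  refine ⟨fun X _ _ _ Y μ hY hμ => ?_, fun R _ => ?_⟩
  · have hX := exists_isAdapted hr hY hμ
    refine ⟨fun k V α hα => dSec_mem_tameSheafSec ?_ hα, quasiIso_incl_tame hr _ hX⟩
    rcases Nat.eq_zero_or_pos r with rfl | h
    · exact Or.inr (dichotomy_of_exists_isAdapted_zero hX)
    · exact Or.inl h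
  · have hdich : 1 ≤ r ∨ ∀ x, normSq n (2 * r) x ≠ 0 ∨ ∀ᶠ z in 𝓝 x, normSq n (2 * r) z = 0 := by
      rcases Nat.eq_zero_or_pos r with rfl | h
      · refine Or.inr fun x => Or.inr (Eventually.of_forall fun z => ?_)
        simp [normSq_apply, firstCoords]
      · exact Or.inl h
    refine ⟨fun k V α hα => dSec_mem_tamePresheafSec hdich hα, quasiIso_inclAt_tame hr _ ?_⟩
    rcases hdich with h | h
    · exact Or.inr ⟨h, OpenPartialHomeomorph.refl _, StructureGroupoid.id_mem_maximalAtlas _,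
        fun _ _ => trivial, fun _ _ => rfl⟩
    · exact Or.inl fun x _ => h x
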